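/- For $d\in\mathbb N$ and $\tau>0$ let $\gamma_\tau$ be the Gaussian measure on $\mathbb R^d$ with density $(2\pi\tau)^{-d/2}\exp(-|x|^2/(2\tau))$, and let $\gamma=\gamma_1$. Let $L$ be the Ornstein-Uhlenbeck operator on $L^2(\mathbb R^d,\gamma)$ (complex-valued functions), that is, the closure of the operator $f\mapsto -\Delta f+x\cdot\nabla f$ with domain $C_c^2(\mathbb R^d)$. For $0<\theta\le\frac\pi2$ put $\Sigma_\theta=\{z\in\mathbb C: z\neq 0,\ |\arg z|<\theta\}$. A strongly continuous holomorphic semigroup of angle $\theta$ on a complex Banach space $E$ is a family $(T(z))_{z\in\Sigma_\theta\cup\{0\}}$ of bounded operators on $E$ such that $T(0)=I$, $T(z+w)=T(z)T(w)$ for $z,w\in\Sigma_\theta$, $z\mapsto T(z)$ is holomorphic on $\Sigma_\theta$, and $T(z)x\to x$ as $z\to0$ in $\Sigma_{\theta'}$ for all $x\in E$ and $0<\theta'<\theta$; its generator is the generator of $(T(t))_{t\ge 0}$. The operator $-L$ generates a strongly continuous holomorphic semigroup $(\exp(-zL))$ of angle $\frac\pi2$ on $L^2(\mathbb R^d,\gamma)$.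 Moreover, for every $p\in[1,2]$: (1) For all $z\in\mathbb C$ with $\operatorname{Re} z>0$ the operator $\exp(-zL)$ maps $L^p(\mathbb R^d,\gamma_{2/p})$ into $L^2(\mathbb R^d,\gamma)$; that is, there is a bounded linear operator from $L^p(\mathbb R^d,\gamma_{2/p})$ to $L^2(\mathbb R^d,\gamma)$ which agrees with $\exp(-zL)$ on $L^p(\mathbb R^d,\gamma_{2/p})\cap L^2(\mathbb R^d,\gamma)$. (2) The semigroup generated by $-L$ extends to a strongly continuous holomorphic semigroup $T$ of angle $\frac12\pi$ on $L^p(\mathbb R^d,\gamma_{2/p})$; that is, there is such a semigroup $T$ with $T(z)f=\exp(-zL)f$ almost everywhere for all $\operatorname{Re}z>0$ and all $f\in L^p(\mathbb R^d,\gamma_{2/p})\cap L^2(\mathbb R^d,\gamma)$, and the generator of $T$ maps $f$ to $\Delta f-x\cdot\nabla f$ for every $f\in C_c^2(\mathbb R^d)$. (3) For each $\theta\in(0,\frac12\pi)$ this semigroup is uniformly bounded on the sector: $\sup_{z\in\Sigma_\theta}\|T(z)\|<\infty$. -/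

import Mathlib

open MeasureTheory Filter Topology
open scoped ENNReal

noncomputable section

namespace OU

/-- The open sector `{z ∈ ℂ : z ≠ 0, |arg z| < θ}`. -/
def sector (θ : ℝ) : Set ℂ :=
  {z | z ≠ 0 ∧ |Complex.arg z| < θ}

section Semigroups

variable {E : Type*} [NormedAddCommGroup E] [NormedSpace ℂ E]

/-- Strongly continuous holomorphic semigroups of angle `θ` on `E`. Only the values of `T` on
`sector θ ∪ {0}` matter. -/
structure IsHolomorphicSemigroup (θ : ℝ) (T : ℂ → E →L[ℂ] E) : Prop where
  map_zero : T 0 = ContinuousLinearMap.id ℂ E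
  map_add : ∀ z ∈ sector θ, ∀ w ∈ sector θ, T (z + w) = (T z).comp (T w)
  holomorphic : DifferentiableOn ℂ T (sector θ)
  strongly_continuous : ∀ θ' : ℝ, 0 < θ' → θ' < θ → ∀ x : E,
    Tendsto (fun z : ℂ => T z x) (𝓝[sector θ'] 0) (𝓝 x)

/-- The graph of the generator of `(T t)_{t ≥ 0}`: all pairs `(x, y)` such that
`(T t x - x) / t → y` in `E` as `t ↓ 0`. -/
def generatorGraph (T : ℂ → E →L[ℂ] E) : Set (E × E) :=
  {q | Tendsto (fun t : ℝ => ((t : ℂ)⁻¹) • (T (t : ℂ) q.1 - q.1)) (𝓝[>] (0 : ℝ)) (𝓝 q.2)}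

/-- `T` is a strongly continuous holomorphic semigroup of angle `θ` whose generator is `-A`, where
the (possibly unbounded) operator `A` is given through its graph. -/
def IsGeneratedByNeg (θ : ℝ) (A : Set (E × E)) (T : ℂ → E →L[ℂ] E) : Prop :=
  IsHolomorphicSemigroup θ T ∧ generatorGraph T = {q | (q.1, -q.2) ∈ A}

/-- `z ↦ exp (-z A)`: the strongly continuous holomorphic semigroup of angle `θ` generated by `-A`
(it is unique on `sector θ ∪ {0}`), and an unspecified value if there is none. -/
def expNeg (θ : ℝ) (A : Set (E × E)) : ℂ → E →L[ℂ] E :=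
  Classical.epsilon (IsGeneratedByNeg θ A)

end Semigroups

/-- The centred Gaussian measure `γ_τ` on `ℝ^d`, with density
`(2πτ)^{-d/2} exp (-|x|² / (2τ))`. -/
def gaussian (d : ℕ) (τ : ℝ) : Measure (EuclideanSpace ℝ (Fin d)) :=
  volume.withDensity fun x =>
    ENNReal.ofReal ((2 * Real.pi * τ) ^ (-(d : ℝ) / 2) * Real.exp (-‖x‖ ^ 2 / (2 * τ)))

/-- The differential expression `L f (x) = -Δ f (x) + x · ∇ f (x)`. -/
def ouExpr {d : ℕ} (f : EuclideanSpace ℝ (Fin d) → ℂ) (x : EuclideanSpace ℝ (Fin d)) : ℂ :=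
  -(Laplacian.laplacian f x) + fderiv ℝ f x x

/-- The graph of `f ↦ L f` in `L^p(γ_τ) × L^p(γ_τ)`, with domain `C_c^2(ℝ^d)`. -/
def ouTestGraph (d : ℕ) (p : ℝ≥0∞) (τ : ℝ) :
    Set (Lp ℂ p (gaussian d τ) × Lp ℂ p (gaussian d τ)) :=
  {q | ∃ f : EuclideanSpace ℝ (Fin d) → ℂ, ContDiff ℝ 2 f ∧ HasCompactSupport f ∧
    q.1 =ᵐ[gaussian d τ] f ∧ q.2 =ᵐ[gaussian d τ] ouExpr f}

/-- The graph of the Ornstein-Uhlenbeck operator `L` on `L²(γ)`, `γ = γ_1`: the closure of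
`-Δ + x · ∇` on `C_c^2(ℝ^d)`. -/
def ouGraph (d : ℕ) : Set (Lp ℂ 2 (gaussian d 1) × Lp ℂ 2 (gaussian d 1)) :=
  closure (ouTestGraph d 2 1)

/-- `exp (-z L)` on `L²(γ)`, for `Re z > 0`. -/
def expNegL (d : ℕ) : ℂ → Lp ℂ 2 (gaussian d 1) →L[ℂ] Lp ℂ 2 (gaussian d 1) :=
  expNeg (Real.pi / 2) (ouGraph d)

end OU

end

noncomputable section

namespace OU

/-! ### Bounded holomorphic semigroups and their generators -/

section Semigroups

/-! The exponents satisfy `p τ = 2`, so `|f|^p dγ_τ` is a constant times `|exp (-|x|²/4) f|^p dx`,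
with one weight for all `p` (`eLpNorm_gaussian`). Put `w = exp (-z)`, so `|w| < 1` when `Re z > 0`.
After conjugation with this weight, the Mehler kernel has modulus a constant times `exp (-(a |x+y|²
+ b |x-y|²)/8)`, where `a = Re ((1-w)/(1+w))` and `b = Re ((1+w)/(1-w))` are positive
(`norm_mehler`).

Two uses of this formula give all the analysis. Keeping both squares, the conjugated kernel is
dominated by `exp (-c (|x|² + |y|²))`, so by Hölder the same kernel is bounded from `L^p` to `L^2`
and from `L^p` to itself; Cauchy estimates on the kernel, pointwise in `(x, y)`, make it holomorphic
in operator norm (`hasDerivAt_kernelOp_mehler`). Keeping only `|x-y|²`, Young's inequality gives a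
norm bound that stays finite on each proper subsector, including near `0`
(`norm_kernelOp_mehler_le`, `exists_mehler_ratio_le`).

The semigroup law is checked on exponentials in `L²(γ)`, which the kernel maps to exponentials, and
passes to `L^p` through test functions. Integrating by parts gives `∂_z T(z) f = -T(z) L f` on test
functions (`kernelInt_mehlerDeriv`), whence strong continuity on sectors and the action of the
generator.

It remains to see that on `L²(γ)` the generator is exactly `-L`, with `L` a closure. By
`generatorGraph_eq_closure` this needs only that `1 + L` have dense range on test functions. The
exponentials lie in the domain of the closure, and the semigroup maps each to a multiple of another;
for `h` orthogonal to the range, `exp (-t) ⟨h, T(t) e_ξ⟩` is then constant in `t` and tends to `0`.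
Uniqueness of the semigroup with a given generator identifies `expNegL` with the Mehler operators
(`expNegL_eq`). -/

theorem mem_sector_pi_div_two {z : ℂ} : z ∈ sector (Real.pi / 2) ↔ 0 < z.re := by
  rw [sector, Set.mem_ofPred_eq, Complex.abs_arg_lt_pi_div_two_iff]
  constructor
  · rintro ⟨h0, h | h⟩
    · exact h
    · exact absurd h h0
  · intro h
    refine ⟨?_, Or.inl h⟩
    rintro rfl
    simp at h

theorem sector_pi_div_two : sector (Real.pi / 2) = {z : ℂ | 0 < z.re} :=
  Set.ext fun _ => mem_sector_pi_div_two

theorem ofReal_mem_sector {θ : ℝ} (hθ : 0 < θ) {t : ℝ} (ht : 0 < t) : (t : ℂ) ∈ sector θ := by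
  refine ⟨by exact_mod_cast ht.ne', ?_⟩
  rwa [Complex.arg_ofReal_of_nonneg ht.le, abs_zero]

theorem isOpen_re_pos : IsOpen {z : ℂ | 0 < z.re} :=
  isOpen_lt continuous_const Complex.continuous_re

variable {E : Type*} [NormedAddCommGroup E] [NormedSpace ℂ E] {S T : ℂ → E →L[ℂ] E}

theorem _root_.HasDerivAt.comp_complex_ofReal {f : ℂ → E} {e : E} {t : ℝ}
    (h : HasDerivAt f e (t : ℂ)) : HasDerivAt (fun s : ℝ => f s) e t := by
  simpa [Function.comp_def] using h.scomp t Complex.ofRealCLM.hasDerivAt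

namespace IsHolomorphicSemigroup

theorem tendsto_real (h : IsHolomorphicSemigroup (Real.pi / 2) T) (x : E) :
    Tendsto (fun t : ℝ => T t x) (𝓝[>] 0) (𝓝 x) := by
  have hπ := Real.pi_pos
  refine (h.strongly_continuous (Real.pi / 4) (by linarith) (by linarith) x).comp ?_
  refine tendsto_nhdsWithin_iff.2 ⟨?_, ?_⟩
  · have : Tendsto (fun t : ℝ => (t : ℂ)) (𝓝 0) (𝓝 ((0 : ℝ) : ℂ)) :=
      Complex.continuous_ofReal.tendsto 0
    rw [Complex.ofReal_zero] at this
    exact this.mono_left nhdsWithin_le_nhds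
  · filter_upwards [self_mem_nhdsWithin] with t ht
    exact ofReal_mem_sector (by linarith) ht

theorem hasDerivAt (h : IsHolomorphicSemigroup (Real.pi / 2) T) {z : ℂ} (hz : 0 < z.re) :
    HasDerivAt T (deriv T z) z := by
  have h1 := h.holomorphic
  rw [sector_pi_div_two] at h1
  exact (h1.differentiableAt (isOpen_re_pos.mem_nhds hz)).hasDerivAt

theorem hasDerivAt_apply (h : IsHolomorphicSemigroup (Real.pi / 2) T) {z : ℂ} (hz : 0 < z.re)
    (x : E) : HasDerivAt (fun r => T r x) (deriv T z x) z := by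
  simpa using (h.hasDerivAt hz).clm_apply (hasDerivAt_const z x)

theorem map_add_of_re_pos (h : IsHolomorphicSemigroup (Real.pi / 2) T) {z w : ℂ}
    (hz : 0 < z.re) (hw : 0 < w.re) (x : E) : T (z + w) x = T z (T w x) := by
  rw [h.map_add z (mem_sector_pi_div_two.2 hz) w (mem_sector_pi_div_two.2 hw)]
  rfl

theorem hasDerivWithinAt_zero (h : IsHolomorphicSemigroup (Real.pi / 2) T) {x y : E}
    (hxy : (x, y) ∈ generatorGraph T) :
    HasDerivWithinAt (fun s : ℝ => T s x) y (Set.Ici 0) 0 := by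
  rw [← hasDerivWithinAt_Ioi_iff_Ici, hasDerivWithinAt_iff_tendsto_slope' (by simp)]
  refine Tendsto.congr (fun t => ?_) hxy
  simp only [slope_def_module, sub_zero, Complex.ofReal_zero, h.map_zero,
    ContinuousLinearMap.id_apply]
  rw [← Complex.ofReal_inv, Complex.coe_smul]

/-- Reading the generator as a right derivative at `0` makes the mean value inequalities for
one-sided derivatives available, so no vector-valued integral is needed below. -/
theorem mem_generatorGraph_iff (h : IsHolomorphicSemigroup (Real.pi / 2) T) {x y : E} :
    (x, y) ∈ generatorGraph T ↔ HasDerivWithinAt (fun s : ℝ => T s x) y (Set.Ici 0) 0 := by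
  refine ⟨h.hasDerivWithinAt_zero, fun H => ?_⟩
  rw [← hasDerivWithinAt_Ioi_iff_Ici, hasDerivWithinAt_iff_tendsto_slope' (by simp)] at H
  refine Tendsto.congr (fun t => ?_) H
  simp only [slope_def_module, sub_zero, Complex.ofReal_zero, h.map_zero,
    ContinuousLinearMap.id_apply]
  rw [← Complex.ofReal_inv, Complex.coe_smul]

theorem map_mem_generatorGraph (h : IsHolomorphicSemigroup (Real.pi / 2) T) {x y : E}
    (hxy : (x, y) ∈ generatorGraph T) {z : ℂ} (hz : 0 < z.re) :
    (T z x, T z y) ∈ generatorGraph T := by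
  have h1 : Tendsto (fun t : ℝ => T z ((t : ℂ)⁻¹ • (T (t : ℂ) x - x))) (𝓝[>] 0) (𝓝 (T z y)) :=
    ((T z).continuous.tendsto y).comp hxy
  refine h1.congr' ?_
  filter_upwards [self_mem_nhdsWithin] with t ht
  have ht' : 0 < (t : ℂ).re := by simpa using ht
  simp only [map_smul, map_sub]
  rw [← h.map_add_of_re_pos hz ht', ← h.map_add_of_re_pos ht' hz, add_comm]

/-- Holomorphy supplies the derivative at `t > 0`; its value is read off from the right, where `T s
x = T (s - t) (T t x)` and `T t x` is again in the domain. -/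
theorem deriv_apply (h : IsHolomorphicSemigroup (Real.pi / 2) T) {x y : E}
    (hxy : (x, y) ∈ generatorGraph T) {t : ℝ} (ht : 0 < t) : deriv T t x = T t y := by
  have ht' : 0 < (t : ℂ).re := by simpa using ht
  have h1 : HasDerivAt (fun s : ℝ => T s x) (deriv T t x) t :=
    (h.hasDerivAt_apply ht' x).comp_complex_ofReal
  have h2 : HasDerivWithinAt (fun s : ℝ => T s x) (T t y) (Set.Ici t) t := by
    have h3 := h.hasDerivWithinAt_zero (h.map_mem_generatorGraph hxy ht')
    have h4 : HasDerivWithinAt (fun s : ℝ => T ((s - t : ℝ) : ℂ) (T t x)) (T t y) (Set.Ici t) t := by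
      have h5 : HasDerivWithinAt (fun s : ℝ => s - t) 1 (Set.Ici t) t :=
        ((hasDerivAt_id t).sub_const t).hasDerivWithinAt
      have h3' : HasDerivWithinAt (fun s : ℝ => T s (T t x)) (T t y) (Set.Ici 0) (t - t) := by
        rwa [sub_self]
      have := HasDerivWithinAt.scomp (h := fun s : ℝ => s - t) t h3' h5
        (fun s hs => Set.mem_Ici.2 (sub_nonneg.2 (Set.mem_Ici.1 hs)))
      simpa [Function.comp_def] using this
    refine h4.congr_of_mem (fun s hs => ?_) Set.self_mem_Ici
    rcases eq_or_lt_of_le (show t ≤ s from hs) with rfl | hs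
    · simp [h.map_zero]
    · rw [← h.map_add_of_re_pos (by simpa using hs) ht']
      simp
  exact (uniqueDiffWithinAt_Ici t).eq_deriv _ h1.hasDerivWithinAt h2

theorem hasDerivAt_real (h : IsHolomorphicSemigroup (Real.pi / 2) T) {x y : E}
    (hxy : (x, y) ∈ generatorGraph T) {t : ℝ} (ht : 0 < t) :
    HasDerivAt (fun s : ℝ => T s x) (T t y) t := by
  rw [← h.deriv_apply hxy ht]
  exact (h.hasDerivAt_apply (z := t) (by simpa using ht) x).comp_complex_ofReal

theorem hasDerivWithinAt_real (h : IsHolomorphicSemigroup (Real.pi / 2) T) {x y : E}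
    (hxy : (x, y) ∈ generatorGraph T) {t : ℝ} (ht : 0 ≤ t) :
    HasDerivWithinAt (fun s : ℝ => T s x) (T t y) (Set.Ici t) t := by
  rcases ht.eq_or_lt with rfl | ht
  · simpa [h.map_zero] using h.hasDerivWithinAt_zero hxy
  · exact (h.hasDerivAt_real hxy ht).hasDerivWithinAt

theorem continuousOn_real (h : IsHolomorphicSemigroup (Real.pi / 2) T) (x : E) :
    ContinuousOn (fun s : ℝ => T s x) (Set.Ici 0) := by
  intro t ht
  rcases (show 0 ≤ t from ht).eq_or_lt with rfl | ht
  · rw [← continuousWithinAt_Ioi_iff_Ici]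
    have := h.tendsto_real x
    rw [ContinuousWithinAt]
    simpa [h.map_zero] using this
  · exact (h.hasDerivAt_apply (z := t)
      (by simpa using ht) x).comp_complex_ofReal.continuousAt.continuousWithinAt

/-- The graph of the generator of a bounded semigroup is closed. -/
theorem isClosed_generatorGraph (h : IsHolomorphicSemigroup (Real.pi / 2) T) {M : ℝ}
    (hM : ∀ t : ℝ, 0 ≤ t → ‖T t‖ ≤ M) : IsClosed (generatorGraph T) := by
  refine isClosed_of_closure_subset ?_
  rintro ⟨x, y⟩ hxy
  rw [h.mem_generatorGraph_iff, hasDerivWithinAt_iff_isLittleO,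
    Asymptotics.isLittleO_iff]
  intro ε hε
  have hM0 : 0 ≤ M := (norm_nonneg _).trans (hM 0 le_rfl)
  have hc := h.continuousOn_real y 0 Set.self_mem_Ici
  rw [Metric.continuousWithinAt_iff] at hc
  obtain ⟨δ, hδ, hc⟩ := hc (ε / 2) (half_pos hε)
  rw [eventually_nhdsWithin_iff]
  filter_upwards [Metric.ball_mem_nhds (0 : ℝ) hδ] with t ht ht0
  have ht0 : 0 ≤ t := ht0
  have htδ : t < δ := by simpa [abs_of_nonneg ht0] using ht
  obtain ⟨u, hu, hlim⟩ := mem_closure_iff_seq_limit.1 hxy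
  rw [Prod.tendsto_iff] at hlim
  -- Mean value inequality for `s ↦ T s (u n).1 - s • (u n).2`, whose right derivative is `T s (u
  -- n).2 - (u n).2`. The estimate survives the limit in `n`, and then says that the difference
  -- quotient of `T s x` is within `ε / 2` of `y`.
  have key : ∀ n, ‖T t (u n).1 - (u n).1 - t • (u n).2‖ ≤
      (ε / 2 + (M + 1) * ‖(u n).2 - y‖) * t := by
    intro n
    have hcont : ContinuousOn (fun s : ℝ => T s (u n).1 - s • (u n).2) (Set.Icc 0 t) :=
      ((h.continuousOn_real (u n).1).mono Set.Icc_subset_Ici_self).sub (by fun_prop)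
    have hder : ∀ s ∈ Set.Ico 0 t, HasDerivWithinAt (fun s : ℝ => T s (u n).1 - s • (u n).2)
        (T s (u n).2 - (1 : ℝ) • (u n).2) (Set.Ici s) s := fun s hs =>
      (h.hasDerivWithinAt_real (hu n) hs.1).sub
        ((hasDerivAt_id s).smul_const (u n).2).hasDerivWithinAt
    have := norm_image_sub_le_of_norm_deriv_right_le_segment hcont hder
      (C := ε / 2 + (M + 1) * ‖(u n).2 - y‖) (fun s hs => ?_) t ⟨ht0, le_rfl⟩
    · simpa [h.map_zero, sub_right_comm] using this
    · have e : T s (u n).2 - (1 : ℝ) • (u n).2 =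
          (T s y - y) + (T s ((u n).2 - y) - ((u n).2 - y)) := by
        rw [map_sub, one_smul]; abel
      have h1 : ‖T s y - y‖ ≤ ε / 2 := by
        have := hc (show s ∈ Set.Ici 0 from hs.1)
          (by simpa [abs_of_nonneg hs.1] using hs.2.trans htδ)
        simpa [h.map_zero, dist_eq_norm] using this.le
      have h2 : ‖T s ((u n).2 - y)‖ ≤ M * ‖(u n).2 - y‖ :=
        (T s).le_of_opNorm_le (hM s hs.1) _
      rw [e]
      refine (norm_add_le _ _).trans (add_le_add h1 ((norm_sub_le _ _).trans ?_))
      linarith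
  have l1 : Tendsto (fun n => ‖T t (u n).1 - (u n).1 - t • (u n).2‖) atTop
      (𝓝 ‖T t x - x - t • y‖) :=
    (((((T t).continuous.tendsto x).comp hlim.1).sub hlim.1).sub (hlim.2.const_smul t)).norm
  have l2 : Tendsto (fun n => (ε / 2 + (M + 1) * ‖(u n).2 - y‖) * t) atTop
      (𝓝 ((ε / 2 + (M + 1) * ‖y - y‖) * t)) :=
    (((hlim.2.sub_const y).norm.const_mul _).const_add _).mul_const _
  have := le_of_tendsto_of_tendsto' l1 l2 key
  simp only [Complex.ofReal_zero, h.map_zero, sub_zero, ContinuousLinearMap.id_apply,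
    Real.norm_eq_abs, abs_of_nonneg ht0]
  refine this.trans ?_
  simp only [sub_self, norm_zero, mul_zero, add_zero]
  nlinarith

/-- The generator `A` of a semigroup bounded by `M` satisfies `‖x‖ ≤ M ‖x - A x‖`. -/
theorem norm_le_of_mem (h : IsHolomorphicSemigroup (Real.pi / 2) T) {M : ℝ}
    (hM : ∀ t : ℝ, 0 ≤ t → ‖T t‖ ≤ M) {x y : E} (hxy : (x, y) ∈ generatorGraph T) :
    ‖x‖ ≤ M * ‖x - y‖ := by
  have hM0 : 0 ≤ M := (norm_nonneg _).trans (hM 0 le_rfl)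
  -- The derivative of `exp (-s) T s x` is `-exp (-s) T s (x - y)`. Letting `t → ∞` afterwards plays
  -- the role of the Laplace transform formula for the resolvent.
  have key : ∀ t : ℝ, 0 ≤ t → ‖Real.exp (-t) • T t x - x‖ ≤ M * ‖x - y‖ * (1 - Real.exp (-t)) := by
    intro t ht
    have hcont : ContinuousOn (fun s : ℝ => Real.exp (-s) • T s x - x) (Set.Icc 0 t) :=
      (ContinuousOn.smul (Real.continuous_exp.comp continuous_neg).continuousOn
        ((h.continuousOn_real x).mono Set.Icc_subset_Ici_self)).sub continuousOn_const
    have hexp : ∀ s : ℝ, HasDerivAt (fun s : ℝ => Real.exp (-s)) (-Real.exp (-s)) s := fun s => by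
      simpa using (hasDerivAt_neg s).exp
    have hder : ∀ s ∈ Set.Ico 0 t, HasDerivWithinAt (fun s : ℝ => Real.exp (-s) • T s x - x)
        (Real.exp (-s) • T s y + (-Real.exp (-s)) • T s x) (Set.Ici s) s := fun s hs =>
      ((hexp s).hasDerivWithinAt.smul (h.hasDerivWithinAt_real hxy hs.1)).sub_const x
    refine image_norm_le_of_norm_deriv_right_le_deriv_boundary hcont hder
      (B := fun s => M * ‖x - y‖ * (1 - Real.exp (-s)))
      (B' := fun s => M * ‖x - y‖ * Real.exp (-s)) ?_ ?_ ?_ ⟨ht, le_rfl⟩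
    · simp [h.map_zero]
    · intro s
      simpa using ((hexp s).const_sub 1).const_mul (M * ‖x - y‖)
    · intro s hs
      have e : Real.exp (-s) • T s y + (-Real.exp (-s)) • T s x =
          (-Real.exp (-s)) • T s (x - y) := by
        rw [map_sub, smul_sub, neg_smul, neg_smul]; abel
      rw [e, norm_smul, norm_neg, Real.norm_eq_abs, Real.abs_exp, mul_comm]
      gcongr
      exact (T s).le_of_opNorm_le (hM s hs.1) _
  have key2 : ∀ t : ℝ, 0 ≤ t → ‖x‖ ≤ M * ‖x - y‖ + Real.exp (-t) * (M * ‖x‖) := by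
    intro t ht
    have h1 : ‖x‖ ≤ ‖Real.exp (-t) • T t x - x‖ + ‖Real.exp (-t) • T t x‖ := by
      have := norm_sub_le (Real.exp (-t) • T t x) (Real.exp (-t) • T t x - x)
      rw [sub_sub_cancel] at this
      linarith
    have h2 : ‖Real.exp (-t) • T t x‖ ≤ Real.exp (-t) * (M * ‖x‖) := by
      rw [norm_smul, Real.norm_eq_abs, Real.abs_exp]
      gcongr
      exact (T t).le_of_opNorm_le (hM t ht) _
    have h3 : M * ‖x - y‖ * (1 - Real.exp (-t)) ≤ M * ‖x - y‖ :=
      mul_le_of_le_one_right (by positivity) (by linarith [Real.exp_pos (-t)])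
    linarith [key t ht]
  have l : Tendsto (fun t : ℝ => M * ‖x - y‖ + Real.exp (-t) * (M * ‖x‖)) atTop
      (𝓝 (M * ‖x - y‖ + 0 * (M * ‖x‖))) :=
    ((Real.tendsto_exp_neg_atTop_nhds_zero).mul_const _).const_add _
  rw [zero_mul, add_zero] at l
  refine ge_of_tendsto l ?_
  filter_upwards [eventually_ge_atTop 0] with t ht using key2 t ht

/-- If `-A` is contained in the generator and `1 + A` has dense range, then the generator is the
closure of `-A`. -/
theorem generatorGraph_eq_closure (h : IsHolomorphicSemigroup (Real.pi / 2) T) {M : ℝ}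
    (hM : ∀ t : ℝ, 0 ≤ t → ‖T t‖ ≤ M) {A : Set (E × E)}
    (hA : ∀ q ∈ A, (q.1, -q.2) ∈ generatorGraph T) (hd : Dense ((fun q : E × E => q.1 + q.2) '' A)) :
    generatorGraph T = {q | (q.1, -q.2) ∈ closure A} := by
  have hcl := h.isClosed_generatorGraph hM
  apply Set.Subset.antisymm
  · rintro ⟨x, y⟩ hxy
    -- Approximate `x - y` by values of `1 + A`. The estimate `norm_le_of_mem`, applied to
    -- differences, forces the first components to converge to `x`; the second then converge to
    -- `-y`.
    obtain ⟨v, hv, hlim⟩ := mem_closure_iff_seq_limit.1 (hd (x - y))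
    choose q hq hqv using hv
    have hfst : Tendsto (fun n => (q n).1) atTop (𝓝 x) := by
      rw [tendsto_iff_norm_sub_tendsto_zero]
      have hb : ∀ n, ‖(q n).1 - x‖ ≤ M * ‖v n - (x - y)‖ := by
        intro n
        have hmem : ((q n).1 - x, -(q n).2 - y) ∈ generatorGraph T := by
          have := (hA _ (hq n))
          rw [h.mem_generatorGraph_iff] at this hxy ⊢
          simpa only [map_sub, Pi.sub_def] using this.sub hxy
        have := h.norm_le_of_mem hM hmem
        convert this using 3
        rw [← hqv n]
        simp only
        abel
      refine squeeze_zero (fun n => norm_nonneg _) hb ?_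
      simpa using ((hlim.sub_const (x - y)).norm.const_mul M)
    have hsnd : Tendsto (fun n => (q n).2) atTop (𝓝 (-y)) := by
      have := hlim.sub hfst
      rw [sub_sub_cancel_left] at this
      refine this.congr fun n => ?_
      rw [← hqv n]
      simp
    exact mem_closure_of_tendsto (hfst.prodMk_nhds hsnd) (Eventually.of_forall hq)
  · rintro ⟨x, y⟩ hxy
    have hcl' : IsClosed {q : E × E | (q.1, -q.2) ∈ generatorGraph T} :=
      hcl.preimage (by fun_prop : Continuous fun q : E × E => (q.1, -q.2))
    have := closure_minimal hA hcl' hxy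
    simpa only [neg_neg] using show (x, - -y) ∈ generatorGraph T from this

/-- A bounded holomorphic semigroup is determined by its (densely defined) generator. -/
theorem eq_of_generatorGraph_eq [CompleteSpace E] (hT : IsHolomorphicSemigroup (Real.pi / 2) T)
    (hS : IsHolomorphicSemigroup (Real.pi / 2) S) {M : ℝ} (hM : ∀ t : ℝ, 0 ≤ t → ‖T t‖ ≤ M)
    (hG : generatorGraph T = generatorGraph S) (hd : Dense (Prod.fst '' generatorGraph T))
    {z : ℂ} (hz : 0 < z.re) : T z = S z := by
  have hreal : ∀ t : ℝ, 0 < t → T t = S t := by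
    intro t ht
    refine ContinuousLinearMap.ext_on (hd.mono Submodule.subset_span) ?_
    rintro _ ⟨⟨x, y⟩, hxy, rfl⟩
    simp only
    have hxy' : (x, y) ∈ generatorGraph S := hG ▸ hxy
    -- This path interpolates between `T t x` at `s = 0` and `S t x` at `s = t`. Its derivative
    -- vanishes because `S s x` lies in the common domain and both generators act on it alike.
    let φ : ℝ → E := fun s => T ((t : ℂ) - (s : ℂ)) (S s x)
    have hφ : ∀ s ∈ Set.Ioo 0 t, HasDerivAt φ 0 s := by
      intro s hs
      have hts : 0 < ((t : ℂ) - (s : ℂ)).re := by simpa using hs.2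
      have h1 : HasDerivAt (fun r : ℂ => T ((t : ℂ) - r)) (-deriv T ((t : ℂ) - s)) (s : ℂ) := by
        have := (hT.hasDerivAt hts).scomp (s : ℂ) ((hasDerivAt_id (s : ℂ)).const_sub (t : ℂ))
        simpa [Function.comp_def] using this
      have h2 : HasDerivAt (fun r : ℂ => S r x) (deriv S s x) (s : ℂ) :=
        hS.hasDerivAt_apply (by simpa using hs.1) x
      have h3 := (h1.clm_apply h2).comp_complex_ofReal
      convert h3 using 1
      have hSx : (S s x, S s y) ∈ generatorGraph T := by
        rw [hG]
        exact hS.map_mem_generatorGraph hxy' (by simpa using hs.1)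
      have h4 := hT.deriv_apply hSx (t := t - s) (by linarith [hs.2])
      rw [Complex.ofReal_sub] at h4
      rw [hS.deriv_apply hxy' hs.1, neg_apply, h4, neg_add_cancel]
    have hconst : ∀ a ∈ Set.Ioo 0 t, ∀ b ∈ Set.Ioo 0 t, φ a = φ b := by
      intro a ha b hb
      exact (convex_Ioo (0 : ℝ) t).is_const_of_fderivWithin_eq_zero (𝕜 := ℝ)
        (fun s hs => (hφ s hs).differentiableAt.differentiableWithinAt)
        (fun s hs => by
          rw [((hφ s hs).hasFDerivAt.hasFDerivWithinAt).fderivWithin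
            (isOpen_Ioo.uniqueDiffWithinAt hs)]
          ext; simp) ha hb
    have hmid : t / 2 ∈ Set.Ioo 0 t := ⟨by linarith, by linarith⟩
    have l0 : Tendsto φ (𝓝[>] 0) (𝓝 (T t x)) := by
      have h1 : Tendsto (fun s : ℝ => T ((t : ℂ) - (s : ℂ))) (𝓝[>] 0) (𝓝 (T t)) := by
        have hc : ContinuousAt (fun s : ℝ => T ((t : ℂ) - (s : ℂ))) 0 := by
          have := (hT.hasDerivAt (z := (t : ℂ)) (by simpa using ht)).continuousAt
          refine ContinuousAt.comp (g := T) ?_ (by fun_prop)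
          simpa using this
        have := hc.tendsto
        simp only [Complex.ofReal_zero, sub_zero] at this
        exact this.mono_left nhdsWithin_le_nhds
      exact (isBoundedBilinearMap_apply.continuous.tendsto (T t, x)).comp
        (h1.prodMk_nhds (hS.tendsto_real x))
    have l1 : Tendsto φ (𝓝[<] t) (𝓝 (S t x)) := by
      have h1 : Tendsto (fun s : ℝ => S s x) (𝓝[<] t) (𝓝 (S t x)) :=
        ((hS.continuousOn_real x).continuousAt (Ici_mem_nhds ht)).tendsto.mono_left
          nhdsWithin_le_nhds
      have h2 : Tendsto (fun s : ℝ => T ((t : ℂ) - (s : ℂ)) (S t x)) (𝓝[<] t) (𝓝 (S t x)) := by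
        have h3 : Tendsto (fun s : ℝ => t - s) (𝓝[<] t) (𝓝[>] 0) := by
          refine tendsto_nhdsWithin_iff.2 ⟨?_, ?_⟩
          · have : Tendsto (fun s : ℝ => t - s) (𝓝 t) (𝓝 (t - t)) :=
              (continuous_const.sub continuous_id).tendsto t
            rw [sub_self] at this
            exact this.mono_left nhdsWithin_le_nhds
          · filter_upwards [self_mem_nhdsWithin] with s hs
            simpa using hs
        have := (hT.tendsto_real (S t x)).comp h3
        simpa [Function.comp_def] using this
      -- At the end `s = t` the operator and the vector vary together and `T` is only strongly
      -- continuous at `0`; the uniform bound `M` is what controls this term.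
      have h3 : Tendsto (fun s : ℝ => T ((t : ℂ) - (s : ℂ)) (S s x - S t x)) (𝓝[<] t) (𝓝 0) := by
        rw [tendsto_zero_iff_norm_tendsto_zero]
        refine squeeze_zero' (Eventually.of_forall fun _ => norm_nonneg _)
          (g := fun s : ℝ => M * ‖S s x - S t x‖) ?_ ?_
        · filter_upwards [self_mem_nhdsWithin] with s hs
          have := hM (t - s) (by linarith [show s < t from hs])
          rw [Complex.ofReal_sub] at this
          exact ContinuousLinearMap.le_of_opNorm_le _ this _
        · simpa using ((h1.sub_const (S t x)).norm.const_mul M)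
      have := h3.add h2
      rw [zero_add] at this
      refine this.congr fun s => ?_
      simp [φ]
    have e0 : Tendsto φ (𝓝[>] 0) (𝓝 (φ (t / 2))) := by
      refine tendsto_const_nhds.congr' ?_
      filter_upwards [Ioo_mem_nhdsGT ht] with s hs using hconst _ hmid _ hs
    have e1 : Tendsto φ (𝓝[<] t) (𝓝 (φ (t / 2))) := by
      refine tendsto_const_nhds.congr' ?_
      filter_upwards [Ioo_mem_nhdsLT ht] with s hs using hconst _ hmid _ hs
    rw [tendsto_nhds_unique l0 e0, tendsto_nhds_unique l1 e1]
  have hTa : AnalyticOnNhd ℂ T {z : ℂ | 0 < z.re} := by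
    have := hT.holomorphic
    rw [sector_pi_div_two] at this
    exact this.analyticOnNhd isOpen_re_pos
  have hSa : AnalyticOnNhd ℂ S {z : ℂ | 0 < z.re} := by
    have := hS.holomorphic
    rw [sector_pi_div_two] at this
    exact this.analyticOnNhd isOpen_re_pos
  have hpre : IsPreconnected {z : ℂ | 0 < z.re} := (convex_halfSpace_re_gt 0).isPreconnected
  -- Identity theorem: agreement at the real times accumulating at `1` propagates to the half-plane.
  refine hTa.eqOn_of_preconnected_of_frequently_eq hSa hpre (z₀ := 1) (by simp) ?_ hz
  have hseq : Tendsto (fun t : ℝ => (t : ℂ)) (𝓝[>] 1) (𝓝[≠] 1) := by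
    refine tendsto_nhdsWithin_iff.2 ⟨?_, ?_⟩
    · have : Tendsto (fun t : ℝ => (t : ℂ)) (𝓝 1) (𝓝 ((1 : ℝ) : ℂ)) :=
        Complex.continuous_ofReal.tendsto 1
      rw [Complex.ofReal_one] at this
      exact this.mono_left nhdsWithin_le_nhds
    · filter_upwards [self_mem_nhdsWithin] with t ht
      have : t ≠ 1 := (show 1 < t from ht).ne'
      simpa using this
  refine hseq.frequently (Eventually.frequently ?_)
  filter_upwards [self_mem_nhdsWithin] with t ht
  exact hreal t (zero_lt_one.trans ht)

end IsHolomorphicSemigroup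

end Semigroups

/-! ### Gaussian weights and integral operators with Gaussian kernels -/

section Gaussian

variable {d : ℕ}

theorem integrable_exp_neg_mul_sq_norm {b : ℝ} (hb : 0 < b) :
    Integrable fun x : EuclideanSpace ℝ (Fin d) => Real.exp (-(b * ‖x‖ ^ 2)) := by
  have := (GaussianFourier.integrable_cexp_neg_mul_sq_norm_add
    (V := EuclideanSpace ℝ (Fin d)) (b := (b : ℂ)) (by simpa using hb) 0 0).norm
  refine this.congr (Eventually.of_forall fun x => ?_)
  simp only [Complex.norm_exp]
  congr 1
  simp [← Complex.ofReal_pow, ← Complex.ofReal_mul, ← Complex.ofReal_neg]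

theorem memLp_exp_neg_mul_sq_norm {b : ℝ} (hb : 0 < b) (r : ℝ≥0∞) :
    MemLp (fun x : EuclideanSpace ℝ (Fin d) => Real.exp (-(b * ‖x‖ ^ 2))) r := by
  have hm : AEStronglyMeasurable
      (fun x : EuclideanSpace ℝ (Fin d) => Real.exp (-(b * ‖x‖ ^ 2))) := by fun_prop
  rcases eq_or_ne r 0 with rfl | hr0
  · simpa using hm
  rcases eq_or_ne r ⊤ with rfl | hr
  · refine memLp_top_of_bound hm 1 (Eventually.of_forall fun x => ?_)
    rw [Real.norm_eq_abs, Real.abs_exp]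
    exact Real.exp_le_one_iff.2 (by have := sq_nonneg ‖x‖; nlinarith)
  · rw [← integrable_norm_rpow_iff hm hr0 hr]
    refine (integrable_exp_neg_mul_sq_norm
      (mul_pos hb (ENNReal.toReal_pos hr0 hr))).congr (Eventually.of_forall fun x => ?_)
    simp only [Real.norm_eq_abs, Real.abs_exp, ← Real.exp_mul]
    ring_nf

theorem gaussian_absolutelyContinuous (τ : ℝ) : gaussian d τ ≪ volume :=
  withDensity_absolutelyContinuous _ _

theorem volume_absolutelyContinuous {τ : ℝ} (hτ : 0 < τ) :
    (volume : Measure (EuclideanSpace ℝ (Fin d))) ≪ gaussian d τ := by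
  refine withDensity_absolutelyContinuous' ?_ (Eventually.of_forall fun x => ?_)
  · exact Measurable.aemeasurable (by fun_prop)
  · have := Real.pi_pos
    exact (ENNReal.ofReal_pos.2 (by positivity)).ne'

/-- The density is strictly positive, so the null sets do not depend on `τ`. Almost everywhere
identities can then be stated for `volume`, which lets elements of `L^p` over different Gaussian
measures be compared. -/
theorem ae_gaussian {τ : ℝ} (hτ : 0 < τ) : ae (gaussian d τ) = ae volume :=
  le_antisymm (gaussian_absolutelyContinuous τ).ae_le (volume_absolutelyContinuous hτ).ae_le

theorem isFiniteMeasure_gaussian {τ : ℝ} (hτ : 0 < τ) : IsFiniteMeasure (gaussian d τ) := by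
  refine isFiniteMeasure_withDensity_ofReal (Integrable.hasFiniteIntegral ?_)
  refine Integrable.const_mul ?_ _
  refine (integrable_exp_neg_mul_sq_norm (b := 1 / (2 * τ)) (by positivity)).congr
    (Eventually.of_forall fun x => ?_)
  simp only
  ring_nf

/-- Multiplication by `exp (-|x|² / 4)`. -/
def weighted (f : EuclideanSpace ℝ (Fin d) → ℂ) (x : EuclideanSpace ℝ (Fin d)) : ℂ :=
  Real.exp (-‖x‖ ^ 2 / 4) • f x

theorem aestronglyMeasurable_gaussian_iff {τ : ℝ} (hτ : 0 < τ)
    {f : EuclideanSpace ℝ (Fin d) → ℂ} :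
    AEStronglyMeasurable f (gaussian d τ) ↔ AEStronglyMeasurable f volume :=
  ⟨fun h => h.mono_ac (volume_absolutelyContinuous hτ),
    fun h => h.mono_ac (gaussian_absolutelyContinuous τ)⟩

theorem _root_.MeasureTheory.AEStronglyMeasurable.weighted {f : EuclideanSpace ℝ (Fin d) → ℂ}
    (hf : AEStronglyMeasurable f volume) : AEStronglyMeasurable (OU.weighted f) volume :=
  AEStronglyMeasurable.smul (f := fun x => Real.exp (-‖x‖ ^ 2 / 4)) (by fun_prop) hf

/-- The normalising constant relating `L^p(γ_τ)` and weighted `L^p(dx)`. -/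
def gaussianConst (d : ℕ) (p : ℝ≥0∞) (τ : ℝ) : ℝ≥0∞ :=
  ENNReal.ofReal ((2 * Real.pi * τ) ^ (-(d : ℝ) / 2)) ^ (1 / p.toReal)

theorem gaussianConst_ne_top {p : ℝ≥0∞} {τ : ℝ} : gaussianConst d p τ ≠ ⊤ :=
  ENNReal.rpow_ne_top_of_nonneg (by positivity) ENNReal.ofReal_ne_top

theorem gaussianConst_ne_zero {p : ℝ≥0∞} {τ : ℝ} (hτ : 0 < τ) :
    gaussianConst d p τ ≠ 0 := by
  have := Real.pi_pos
  refine (ENNReal.rpow_pos (ENNReal.ofReal_pos.2 (by positivity)) ENNReal.ofReal_ne_top).ne'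

/-- For `p τ = 2` the `L^p(γ_τ)`-norm is a multiple of the `L^p(dx)`-norm of `exp (-|x|² / 4) f`. -/
theorem eLpNorm_gaussian {p : ℝ≥0∞} (hp0 : p ≠ 0) (hp : p ≠ ⊤) {τ : ℝ}
    (hτ : p.toReal * τ = 2) (f : EuclideanSpace ℝ (Fin d) → ℂ) :
    eLpNorm f p (gaussian d τ) = gaussianConst d p τ * eLpNorm (weighted f) p volume := by
  have hpp : 0 < p.toReal := ENNReal.toReal_pos hp0 hp
  have hτ0 : 0 < τ := by
    by_contra! h
    nlinarith
  have hπ := Real.pi_pos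
  rw [eLpNorm_eq_lintegral_rpow_enorm_toReal hp0 hp, eLpNorm_eq_lintegral_rpow_enorm_toReal hp0 hp,
    gaussianConst, ← ENNReal.mul_rpow_of_nonneg _ _ (by positivity)]
  congr 1
  rw [gaussian, lintegral_withDensity_eq_lintegral_mul_non_measurable _ (by fun_prop)
    (Eventually.of_forall fun x => ENNReal.ofReal_lt_top),
    ← lintegral_const_mul' _ _ ENNReal.ofReal_ne_top]
  congr 1
  ext x
  rw [Pi.mul_apply, ENNReal.ofReal_mul (by positivity), mul_assoc]
  congr 1
  rw [weighted, enorm_smul, ENNReal.mul_rpow_of_nonneg _ _ hpp.le]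
  congr 1
  rw [Real.enorm_eq_ofReal (Real.exp_pos _).le, ENNReal.ofReal_rpow_of_pos (Real.exp_pos _),
    ← Real.exp_mul]
  congr 2
  field_simp
  nlinarith

theorem tau_pos {p : ℝ≥0∞} {τ : ℝ} (hτ : p.toReal * τ = 2) : 0 < τ := by
  by_contra! h
  nlinarith [ENNReal.toReal_nonneg (a := p)]

theorem exists_lintegral_le_mul_eLpNorm {p : ℝ≥0∞} (hp1 : 1 ≤ p) (hp : p ≠ ⊤) {τ : ℝ}
    (hτ : p.toReal * τ = 2) {c : ℝ} (hc : 0 < c) :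
    ∃ C : ℝ≥0∞, C ≠ ⊤ ∧ ∀ f : EuclideanSpace ℝ (Fin d) → ℂ, AEStronglyMeasurable f volume →
      ∫⁻ y, ENNReal.ofReal (Real.exp (-((1 / 4 + c) * ‖y‖ ^ 2))) * ‖f y‖ₑ ≤
        C * eLpNorm f p (gaussian d τ) := by
  have hp0 : p ≠ 0 := (zero_lt_one.trans_le hp1).ne'
  have hτ0 : 0 < τ := tau_pos hτ
  -- For `p = 1` the conjugate exponent is `⊤`, which is why `memLp_exp_neg_mul_sq_norm` covers
  -- every exponent.
  obtain ⟨p', hp'⟩ : ∃ p' : ℝ≥0∞, ENNReal.HolderTriple p' p 1 :=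
    ⟨p.conjExponent, (ENNReal.HolderConjugate.conjExponent hp1).symm⟩
  let φ : EuclideanSpace ℝ (Fin d) → ℝ := fun x => Real.exp (-(c * ‖x‖ ^ 2))
  have hφ : MemLp φ p' volume := memLp_exp_neg_mul_sq_norm hc p'
  refine ⟨eLpNorm φ p' volume * (gaussianConst d p τ)⁻¹, ENNReal.mul_ne_top hφ.eLpNorm_ne_top
    (ENNReal.inv_ne_top.2 (gaussianConst_ne_zero hτ0)), fun f hf => ?_⟩
  rw [eLpNorm_gaussian hp0 hp hτ, mul_assoc,
    ENNReal.inv_mul_cancel_left' (fun h => absurd h (gaussianConst_ne_zero hτ0))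
      (fun h => absurd h gaussianConst_ne_top)]
  refine le_trans (le_of_eq ?_)
    (eLpNorm_smul_le_mul_eLpNorm (p := p') (q := p) (r := 1) hf.weighted hφ.1)
  rw [eLpNorm_one_eq_lintegral_enorm]
  congr 1
  ext y
  rw [Pi.smul_apply', weighted, smul_smul, enorm_smul, ← Real.exp_add,
    Real.enorm_eq_ofReal (Real.exp_pos _).le]
  ring_nf

/-- A kernel which, after conjugation with `exp (-|x|² / 4)`, decays like
`exp (-c (|x|² + |y|²))`. -/
structure GaussianBound (K : EuclideanSpace ℝ (Fin d) → EuclideanSpace ℝ (Fin d) → ℂ)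
    (c M : ℝ) : Prop where
  measurable : StronglyMeasurable (Function.uncurry K)
  bound : ∀ x y, ‖K x y‖ ≤
    M * Real.exp ((1 / 4 - c) * ‖x‖ ^ 2) * Real.exp (-((1 / 4 + c) * ‖y‖ ^ 2))

/-- The integral operator with kernel `K`. -/
def kernelInt (K : EuclideanSpace ℝ (Fin d) → EuclideanSpace ℝ (Fin d) → ℂ)
    (f : EuclideanSpace ℝ (Fin d) → ℂ) (x : EuclideanSpace ℝ (Fin d)) : ℂ :=
  ∫ y, K x y * f y

theorem kernelInt_congr (K : EuclideanSpace ℝ (Fin d) → EuclideanSpace ℝ (Fin d) → ℂ)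
    {f g : EuclideanSpace ℝ (Fin d) → ℂ} (h : f =ᵐ[volume] g) : kernelInt K f = kernelInt K g := by
  ext x
  refine integral_congr_ae ?_
  filter_upwards [h] with y hy
  rw [hy]

namespace GaussianBound

variable {K K' : EuclideanSpace ℝ (Fin d) → EuclideanSpace ℝ (Fin d) → ℂ} {c M M' : ℝ}

theorem lintegral_enorm_le (h : GaussianBound K c M) (f : EuclideanSpace ℝ (Fin d) → ℂ)
    (x : EuclideanSpace ℝ (Fin d)) :
    ∫⁻ y, ‖K x y * f y‖ₑ ≤ ENNReal.ofReal (M * Real.exp ((1 / 4 - c) * ‖x‖ ^ 2)) *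
      ∫⁻ y, ENNReal.ofReal (Real.exp (-((1 / 4 + c) * ‖y‖ ^ 2))) * ‖f y‖ₑ := by
  rw [← lintegral_const_mul' _ _ ENNReal.ofReal_ne_top]
  refine lintegral_mono fun y => ?_
  rw [enorm_mul, ← mul_assoc]
  gcongr
  rw [← ENNReal.ofReal_mul' (Real.exp_pos _).le, ← ofReal_norm]
  exact ENNReal.ofReal_le_ofReal (h.bound x y)

theorem integrable (h : GaussianBound K c M) (hc : 0 < c) {p : ℝ≥0∞} (hp1 : 1 ≤ p) (hp : p ≠ ⊤)
    {τ : ℝ} (hτ : p.toReal * τ = 2) {f : EuclideanSpace ℝ (Fin d) → ℂ}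
    (hf : MemLp f p (gaussian d τ)) (x : EuclideanSpace ℝ (Fin d)) :
    Integrable fun y => K x y * f y := by
  have hfm := (aestronglyMeasurable_gaussian_iff (tau_pos hτ)).1 hf.1
  refine ⟨(h.measurable.of_uncurry_left).aestronglyMeasurable.mul hfm, ?_⟩
  obtain ⟨C, hC, hCf⟩ := exists_lintegral_le_mul_eLpNorm (d := d) hp1 hp hτ hc
  refine (h.lintegral_enorm_le f x).trans_lt ?_
  exact ENNReal.mul_lt_top ENNReal.ofReal_lt_top
    ((hCf f hfm).trans_lt (ENNReal.mul_lt_top hC.lt_top hf.2))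

theorem aestronglyMeasurable_kernelInt (h : GaussianBound K c M)
    {f : EuclideanSpace ℝ (Fin d) → ℂ} (hf : AEStronglyMeasurable f volume) :
    AEStronglyMeasurable (kernelInt K f) volume :=
  AEStronglyMeasurable.integral_prod_right'
    (f := fun z : EuclideanSpace ℝ (Fin d) × EuclideanSpace ℝ (Fin d) => K z.1 z.2 * f z.2)
    (h.measurable.aestronglyMeasurable.mul hf.comp_snd)

/-- After conjugation the kernel is at most `M exp (-c |x|²) exp (-c |y|²)`: Hölder absorbs the
factor in `y`, and the factor in `x` lies in `L^q`. The constant is chosen before `K` and `M` and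
the bound is linear in `M`; this uniformity turns pointwise estimates of kernels, such as Taylor
remainders, into estimates of operator norms. -/
theorem exists_eLpNorm_kernelInt_le {p q : ℝ≥0∞} (hp1 : 1 ≤ p) (hp : p ≠ ⊤) (hq0 : q ≠ 0)
    (hq : q ≠ ⊤) {τ σ : ℝ} (hτ : p.toReal * τ = 2) (hσ : q.toReal * σ = 2) (hc : 0 < c) :
    ∃ C : ℝ, 0 ≤ C ∧ ∀ K M, 0 ≤ M → GaussianBound (d := d) K c M → ∀ f,
      MemLp f p (gaussian d τ) → eLpNorm (kernelInt K f) q (gaussian d σ) ≤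
        ENNReal.ofReal (C * M) * eLpNorm f p (gaussian d τ) := by
  obtain ⟨C, hC, hCf⟩ := exists_lintegral_le_mul_eLpNorm (d := d) hp1 hp hτ hc
  let φ : EuclideanSpace ℝ (Fin d) → ℝ := fun x => Real.exp (-(c * ‖x‖ ^ 2))
  have hφ : MemLp φ q volume := memLp_exp_neg_mul_sq_norm hc q
  let D : ℝ≥0∞ := gaussianConst d q σ * eLpNorm φ q volume * C
  have hD : D ≠ ⊤ :=
    ENNReal.mul_ne_top (ENNReal.mul_ne_top gaussianConst_ne_top hφ.eLpNorm_ne_top) hC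
  refine ⟨D.toReal, ENNReal.toReal_nonneg, fun K M hM h f hf => ?_⟩
  have hfm := (aestronglyMeasurable_gaussian_iff (tau_pos hτ)).1 hf.1
  set N : ℝ≥0∞ := C * eLpNorm f p (gaussian d τ) with hN
  have hN' : N ≠ ⊤ := ENNReal.mul_ne_top hC hf.eLpNorm_ne_top
  have hpt : ∀ x, ‖weighted (kernelInt K f) x‖ₑ ≤ ‖(M * N.toReal) • φ x‖ₑ := by
    intro x
    have h1 : ‖kernelInt K f x‖ₑ ≤
        ENNReal.ofReal (M * Real.exp ((1 / 4 - c) * ‖x‖ ^ 2)) * N :=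
      (enorm_integral_le_lintegral_enorm _).trans
        ((h.lintegral_enorm_le f x).trans (by gcongr; exact hCf f hfm))
    rw [weighted, enorm_smul]
    refine (mul_le_mul_right h1 _).trans (le_of_eq ?_)
    rw [smul_eq_mul, ← ENNReal.ofReal_toReal hN', Real.enorm_eq_ofReal (Real.exp_pos _).le,
      Real.enorm_eq_ofReal (by positivity), ← ENNReal.ofReal_mul (by positivity),
      ← ENNReal.ofReal_mul (by positivity), ENNReal.toReal_ofReal ENNReal.toReal_nonneg]
    congr 1
    have : φ x = Real.exp (-‖x‖ ^ 2 / 4) * Real.exp ((1 / 4 - c) * ‖x‖ ^ 2) := by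
      rw [← Real.exp_add]
      simp only [φ]
      ring_nf
    rw [this]
    ring
  rw [eLpNorm_gaussian hq0 hq hσ]
  calc gaussianConst d q σ * eLpNorm (weighted (kernelInt K f)) q volume
      ≤ gaussianConst d q σ * eLpNorm ((M * N.toReal) • φ) q volume := by
        gcongr
        exact eLpNorm_mono_enorm hpt
    _ = ENNReal.ofReal (D.toReal * M) * eLpNorm f p (gaussian d τ) := by
        rw [eLpNorm_const_smul, Real.enorm_eq_ofReal (by positivity),
          ENNReal.ofReal_mul hM, ENNReal.ofReal_toReal hN', ENNReal.ofReal_mul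
          ENNReal.toReal_nonneg, ENNReal.ofReal_toReal hD, hN]
        simp only [D]
        ring

theorem memLp_kernelInt (h : GaussianBound K c M) (hM : 0 ≤ M) (hc : 0 < c)
    {p q : ℝ≥0∞} (hp1 : 1 ≤ p) (hp : p ≠ ⊤) (hq0 : q ≠ 0)
    (hq : q ≠ ⊤) {τ σ : ℝ} (hτ : p.toReal * τ = 2) (hσ : q.toReal * σ = 2)
    {f : EuclideanSpace ℝ (Fin d) → ℂ} (hf : MemLp f p (gaussian d τ)) :
    MemLp (kernelInt K f) q (gaussian d σ) := by
  obtain ⟨C, hC, H⟩ := exists_eLpNorm_kernelInt_le (d := d) hp1 hp hq0 hq hτ hσ hc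
  have hfm := (aestronglyMeasurable_gaussian_iff (tau_pos hτ)).1 hf.1
  exact ⟨(aestronglyMeasurable_gaussian_iff (tau_pos hσ)).2 (h.aestronglyMeasurable_kernelInt hfm),
    (H K M hM h f hf).trans_lt (ENNReal.mul_lt_top ENNReal.ofReal_lt_top hf.2)⟩

theorem exists_clm {p q : ℝ≥0∞} [Fact (1 ≤ p)] [Fact (1 ≤ q)] (hp : p ≠ ⊤) (hq : q ≠ ⊤)
    {τ σ : ℝ} (hτ : p.toReal * τ = 2) (hσ : q.toReal * σ = 2) (hc : 0 < c) :
    ∃ C : ℝ, 0 ≤ C ∧ ∀ K M, 0 ≤ M → GaussianBound (d := d) K c M →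
      ∃ R : Lp ℂ p (gaussian d τ) →L[ℂ] Lp ℂ q (gaussian d σ), ‖R‖ ≤ C * M ∧
        ∀ f, R f =ᵐ[volume] kernelInt K f := by
  have hp1 : 1 ≤ p := Fact.out
  have hq0 : q ≠ 0 := (zero_lt_one.trans_le (Fact.out : 1 ≤ q)).ne'
  obtain ⟨C, hC, H⟩ := exists_eLpNorm_kernelInt_le (d := d) hp1 hp hq0 hq hτ hσ hc
  refine ⟨C, hC, fun K M hM h => ?_⟩
  have hmem : ∀ f : Lp ℂ p (gaussian d τ), MemLp (kernelInt K f) q (gaussian d σ) := fun f =>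
    h.memLp_kernelInt hM hc hp1 hp hq0 hq hτ hσ (Lp.memLp f)
  have hae : ∀ f, (hmem f).toLp _ =ᵐ[volume] kernelInt K f := fun f =>
    ae_gaussian (d := d) (tau_pos hσ) ▸ (hmem f).coeFn_toLp
  let R : Lp ℂ p (gaussian d τ) →ₗ[ℂ] Lp ℂ q (gaussian d σ) :=
    { toFun := fun f => (hmem f).toLp _
      map_add' := fun f g => by
        rw [← MemLp.toLp_add]
        refine MemLp.toLp_congr _ _ (Eventually.of_forall fun x => ?_)
        have e : kernelInt K (f + g : Lp ℂ p (gaussian d τ)) = kernelInt K (⇑f + ⇑g) :=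
          kernelInt_congr K (ae_gaussian (d := d) (tau_pos hτ) ▸ Lp.coeFn_add f g)
        rw [e, Pi.add_apply, kernelInt, kernelInt, kernelInt,
          ← integral_add (h.integrable hc hp1 hp hτ (Lp.memLp f) x)
            (h.integrable hc hp1 hp hτ (Lp.memLp g) x)]
        simp only [Pi.add_apply, mul_add]
      map_smul' := fun a f => by
        rw [RingHom.id_apply, ← MemLp.toLp_const_smul]
        refine MemLp.toLp_congr _ _ (Eventually.of_forall fun x => ?_)
        have e : kernelInt K (a • f : Lp ℂ p (gaussian d τ)) = kernelInt K (a • ⇑f) :=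
          kernelInt_congr K (ae_gaussian (d := d) (tau_pos hτ) ▸ Lp.coeFn_smul a f)
        rw [e, Pi.smul_apply, kernelInt, kernelInt, smul_eq_mul, ← integral_const_mul]
        congr 1
        ext y
        simp only [Pi.smul_apply, smul_eq_mul]
        ring }
  have hR : ∀ f, ‖R f‖ ≤ C * M * ‖f‖ := by
    intro f
    have h1 := H K M hM h f (Lp.memLp f)
    have h2 : ‖R f‖ = (eLpNorm (kernelInt K f) q (gaussian d σ)).toReal := Lp.norm_toLp _ (hmem f)
    rw [h2, Lp.norm_def]
    have := ENNReal.toReal_mono (ENNReal.mul_ne_top ENNReal.ofReal_ne_top (Lp.eLpNorm_ne_top f)) h1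
    rwa [ENNReal.toReal_mul, ENNReal.toReal_ofReal (by positivity)] at this
  exact ⟨R.mkContinuous (C * M) hR, R.mkContinuous_norm_le (by positivity) hR, hae⟩

end GaussianBound

theorem Lp_ext_volume {p : ℝ≥0∞} {τ : ℝ} (hτ : 0 < τ) {f g : Lp ℂ p (gaussian d τ)}
    (h : f =ᵐ[volume] g) : f = g := by
  rw [Lp.ext_iff, EventuallyEq, ae_gaussian hτ]
  exact h

/-- The bounded operator `L^p(γ_τ) → L^q(γ_σ)` with integral kernel `K`. -/
def kernelOp (p q : ℝ≥0∞) [Fact (1 ≤ p)] [Fact (1 ≤ q)] (τ σ : ℝ)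
    (K : EuclideanSpace ℝ (Fin d) → EuclideanSpace ℝ (Fin d) → ℂ) :
    Lp ℂ p (gaussian d τ) →L[ℂ] Lp ℂ q (gaussian d σ) :=
  Classical.epsilon fun R => ∀ f, R f =ᵐ[volume] kernelInt K f

section kernelOp

variable {p q : ℝ≥0∞} [Fact (1 ≤ p)] [Fact (1 ≤ q)] {τ σ : ℝ}
  {K K' : EuclideanSpace ℝ (Fin d) → EuclideanSpace ℝ (Fin d) → ℂ} {c M : ℝ}

theorem kernelOp_apply (hp : p ≠ ⊤) (hq : q ≠ ⊤) (hτ : p.toReal * τ = 2)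
    (hσ : q.toReal * σ = 2) (hc : 0 < c) (hM : 0 ≤ M) (h : GaussianBound K c M)
    (f : Lp ℂ p (gaussian d τ)) : kernelOp p q τ σ K f =ᵐ[volume] kernelInt K f := by
  obtain ⟨C, -, H⟩ := GaussianBound.exists_clm (d := d) (p := p) (q := q) hp hq hτ hσ hc
  obtain ⟨R, -, hR⟩ := H K M hM h
  exact Classical.epsilon_spec
    (p := fun R : Lp ℂ p (gaussian d τ) →L[ℂ] Lp ℂ q (gaussian d σ) =>
      ∀ f, R f =ᵐ[volume] kernelInt K f) ⟨R, hR⟩ f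

theorem clm_eq_of_kernelInt (hσ : 0 < σ) {R R' : Lp ℂ p (gaussian d τ) →L[ℂ] Lp ℂ q (gaussian d σ)}
    (h : ∀ f, R f =ᵐ[volume] kernelInt K f) (h' : ∀ f, R' f =ᵐ[volume] kernelInt K f) : R = R' :=
  ContinuousLinearMap.ext fun f => Lp_ext_volume hσ ((h f).trans (h' f).symm)

theorem exists_norm_kernelOp_le (d : ℕ) (hp : p ≠ ⊤) (hq : q ≠ ⊤) (hτ : p.toReal * τ = 2)
    (hσ : q.toReal * σ = 2) (hc : 0 < c) :
    ∃ C : ℝ, 0 ≤ C ∧ ∀ K M, 0 ≤ M → GaussianBound (d := d) K c M →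
      ‖kernelOp p q τ σ K‖ ≤ C * M := by
  obtain ⟨C, hC, H⟩ := GaussianBound.exists_clm (d := d) (p := p) (q := q) hp hq hτ hσ hc
  refine ⟨C, hC, fun K M hM h => ?_⟩
  obtain ⟨R, hRn, hR⟩ := H K M hM h
  rwa [clm_eq_of_kernelInt (tau_pos hσ) (kernelOp_apply hp hq hτ hσ hc hM h) hR]

end kernelOp

end Gaussian

/-! ### The Mehler kernel at complex parameter -/

section Mehler

variable {d : ℕ}

namespace GaussianBound

variable {K K' : EuclideanSpace ℝ (Fin d) → EuclideanSpace ℝ (Fin d) → ℂ} {c M M' : ℝ}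

theorem sub (h : GaussianBound K c M) (h' : GaussianBound K' c M') :
    GaussianBound (K - K') c (M + M') where
  measurable := h.measurable.sub h'.measurable
  bound x y := by
    rw [add_mul, add_mul]
    exact (norm_sub_le _ _).trans (add_le_add (h.bound x y) (h'.bound x y))

theorem smul (h : GaussianBound K c M) (a : ℂ) : GaussianBound (a • K) c (‖a‖ * M) where
  measurable := h.measurable.const_smul a
  bound x y := by
    rw [mul_assoc, mul_assoc, ← mul_assoc M]
    exact (norm_smul_le _ _).trans (mul_le_mul_of_nonneg_left (h.bound x y) (norm_nonneg a))

variable {p q : ℝ≥0∞} [Fact (1 ≤ p)] [Fact (1 ≤ q)] {τ σ : ℝ}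

theorem kernelOp_sub (h : GaussianBound K c M) (h' : GaussianBound K' c M') (hp : p ≠ ⊤)
    (hq : q ≠ ⊤) (hτ : p.toReal * τ = 2) (hσ : q.toReal * σ = 2) (hc : 0 < c) (hM : 0 ≤ M)
    (hM' : 0 ≤ M') : kernelOp p q τ σ (K - K') = kernelOp p q τ σ K - kernelOp p q τ σ K' := by
  refine ContinuousLinearMap.ext fun f => Lp_ext_volume (tau_pos hσ) ?_
  have e : (kernelOp p q τ σ K - kernelOp p q τ σ K') f =
    kernelOp p q τ σ K f - kernelOp p q τ σ K' f := rfl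
  have h0 : (kernelOp p q τ σ K f - kernelOp p q τ σ K' f : Lp ℂ q (gaussian d σ)) =ᵐ[volume]
      kernelOp p q τ σ K f - kernelOp p q τ σ K' f :=
    ae_gaussian (d := d) (tau_pos hσ) ▸ Lp.coeFn_sub _ _
  rw [e]
  filter_upwards [h0, kernelOp_apply hp hq hτ hσ hc (by positivity) (h.sub h') f,
    kernelOp_apply hp hq hτ hσ hc hM h f, kernelOp_apply hp hq hτ hσ hc hM' h' f]
    with x h0 h1 h2 h3
  rw [h0, h1, Pi.sub_apply, h2, h3, kernelInt, kernelInt, kernelInt, ← integral_sub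
    (h.integrable hc Fact.out hp hτ (Lp.memLp f) x)
    (h'.integrable hc Fact.out hp hτ (Lp.memLp f) x)]
  simp only [Pi.sub_apply, sub_mul]

theorem kernelOp_smul (h : GaussianBound K c M) (hp : p ≠ ⊤)
    (hq : q ≠ ⊤) (hτ : p.toReal * τ = 2) (hσ : q.toReal * σ = 2) (hc : 0 < c) (hM : 0 ≤ M)
    (a : ℂ) : kernelOp p q τ σ (a • K) = a • kernelOp p q τ σ K := by
  refine ContinuousLinearMap.ext fun f => Lp_ext_volume (tau_pos hσ) ?_
  have e : (a • kernelOp p q τ σ K) f = a • kernelOp p q τ σ K f := rfl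
  have h0 : (a • kernelOp p q τ σ K f : Lp ℂ q (gaussian d σ)) =ᵐ[volume]
      a • ⇑(kernelOp p q τ σ K f) :=
    ae_gaussian (d := d) (tau_pos hσ) ▸ Lp.coeFn_smul _ _
  rw [e]
  filter_upwards [h0, kernelOp_apply hp hq hτ hσ hc (by positivity) (h.smul a) f,
    kernelOp_apply hp hq hτ hσ hc hM h f] with x h0 h1 h2
  rw [h0, h1, Pi.smul_apply, h2, kernelInt, kernelInt, smul_eq_mul, ← integral_const_mul]
  simp only [Pi.smul_apply, smul_eq_mul, mul_assoc]

end GaussianBound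

/-- The Mehler kernel with respect to Lebesgue measure, in the parameter `w = exp (-z)`. -/
def mehler (w : ℂ) (x y : EuclideanSpace ℝ (Fin d)) : ℂ :=
  (2 * Real.pi * (1 - w ^ 2)) ^ (-(d : ℂ) / 2) *
    Complex.exp (-(w ^ 2 * (‖x‖ ^ 2 : ℝ) - 2 * w * (inner ℝ x y : ℝ) + (‖y‖ ^ 2 : ℝ)) /
      (2 * (1 - w ^ 2)))

/-- The derivative of the Mehler kernel in `w`. -/
def mehlerDeriv (w : ℂ) (x y : EuclideanSpace ℝ (Fin d)) : ℂ :=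
  mehler w x y * (d * w / (1 - w ^ 2) - (w * (‖x‖ ^ 2 : ℝ) - (inner ℝ x y : ℝ)) / (1 - w ^ 2) -
    w * (w ^ 2 * (‖x‖ ^ 2 : ℝ) - 2 * w * (inner ℝ x y : ℝ) + (‖y‖ ^ 2 : ℝ)) / (1 - w ^ 2) ^ 2)

variable {w : ℂ}

theorem re_one_sub_sq_pos (hw : ‖w‖ < 1) : 0 < (1 - w ^ 2).re := by
  have h1 : (w ^ 2).re ≤ ‖w‖ ^ 2 := (Complex.re_le_norm _).trans (norm_pow w 2).le
  have h2 : ‖w‖ ^ 2 < 1 := by nlinarith [norm_nonneg w]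
  rw [Complex.sub_re, Complex.one_re]
  linarith

theorem one_sub_sq_ne_zero (hw : ‖w‖ < 1) : 1 - w ^ 2 ≠ 0 := by
  intro h
  have := re_one_sub_sq_pos hw
  rw [h] at this
  simp at this

theorem one_add_ne_zero (hw : ‖w‖ < 1) : 1 + w ≠ 0 := fun h =>
  one_sub_sq_ne_zero hw (by linear_combination (1 - w) * h)

theorem one_sub_ne_zero (hw : ‖w‖ < 1) : 1 - w ≠ 0 := fun h =>
  one_sub_sq_ne_zero hw (by linear_combination (1 + w) * h)

theorem two_pi_mul_mem_slitPlane (hw : ‖w‖ < 1) :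
    2 * (Real.pi : ℂ) * (1 - w ^ 2) ∈ Complex.slitPlane := by
  refine Or.inl ?_
  have : (2 * (Real.pi : ℂ) * (1 - w ^ 2)) = ((2 * Real.pi : ℝ) : ℂ) * (1 - w ^ 2) := by
    push_cast; ring
  rw [this, Complex.re_ofReal_mul]
  have := re_one_sub_sq_pos hw
  have := Real.pi_pos
  positivity

theorem hasDerivAt_mehler (hw : ‖w‖ < 1) (x y : EuclideanSpace ℝ (Fin d)) :
    HasDerivAt (fun w => mehler w x y) (mehlerDeriv w x y) w := by
  have hne := one_sub_sq_ne_zero hw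
  have hsl := two_pi_mul_mem_slitPlane hw
  have hπ : (Real.pi : ℂ) ≠ 0 := by exact_mod_cast Real.pi_ne_zero
  have hne' : 2 * (Real.pi : ℂ) * (1 - w ^ 2) ≠ 0 :=
    mul_ne_zero (mul_ne_zero two_ne_zero hπ) hne
  have h0 : HasDerivAt (fun w : ℂ => 1 - w ^ 2) (-(2 * w)) w := by
    simpa using (hasDerivAt_pow 2 w).const_sub 1
  have h1 := (h0.const_mul (2 * (Real.pi : ℂ))).cpow_const (c := -(d : ℂ) / 2) hsl
  set X : ℂ := ((‖x‖ ^ 2 : ℝ) : ℂ) with hX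
  set Y : ℂ := ((‖y‖ ^ 2 : ℝ) : ℂ) with hY
  set P : ℂ := ((inner ℝ x y : ℝ) : ℂ) with hP
  have h2 : HasDerivAt (fun w : ℂ => -(w ^ 2 * X - 2 * w * P + Y)) (-(2 * w * X - 2 * P)) w := by
    have := ((((hasDerivAt_pow 2 w).mul_const X).sub
      (((hasDerivAt_id w).const_mul 2).mul_const P)).add_const Y).neg
    simpa [Pi.neg_def] using this
  have h3 := (h2.div (h0.const_mul 2) (mul_ne_zero two_ne_zero hne)).cexp
  have h4 := h1.mul h3
  refine h4.congr_deriv ?_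
  simp only [mehlerDeriv, mehler, ← hX, ← hY, ← hP, Pi.div_apply]
  rw [Complex.cpow_sub _ _ hne', Complex.cpow_one]
  field_simp
  ring

theorem continuous_mehler (w : ℂ) :
    Continuous (Function.uncurry (mehler (d := d) w)) := by
  simp only [Function.uncurry_def, mehler]
  fun_prop

theorem continuous_mehlerDeriv (w : ℂ) :
    Continuous (Function.uncurry (mehlerDeriv (d := d) w)) := by
  have := continuous_mehler (d := d) w
  simp only [Function.uncurry_def, mehlerDeriv] at this ⊢
  refine this.mul ?_
  fun_prop

theorem re_cayley {w : ℂ} (hw : 1 + w ≠ 0) :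
    ((1 - w) / (1 + w)).re = (1 - ‖w‖ ^ 2) / ‖1 + w‖ ^ 2 := by
  have h : Complex.normSq (1 + w) ≠ 0 := Complex.normSq_eq_zero.not.2 hw
  rw [← Complex.normSq_eq_norm_sq, ← Complex.normSq_eq_norm_sq, Complex.div_re]
  field_simp
  simp [Complex.normSq_apply]
  ring

/-- Since `1 - w² = (1 - w)(1 + w)`, the quadratic form is diagonal in `x + y` and `x - y`, with
coefficients `(1 - w)/(1 + w)` and its inverse; their real parts come from `re_cayley` at `w` and
`-w`. The term `|x|²/4 - |y|²/4` left over is exactly what conjugation with the weight removes. -/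
theorem norm_mehler (hw : ‖w‖ < 1) (x y : EuclideanSpace ℝ (Fin d)) :
    ‖mehler w x y‖ = ‖2 * Real.pi * (1 - w ^ 2)‖ ^ (-(d : ℝ) / 2) *
      Real.exp (‖x‖ ^ 2 / 4 - ‖y‖ ^ 2 / 4 - 1 / 8 * ((1 - ‖w‖ ^ 2) / ‖1 + w‖ ^ 2 * ‖x + y‖ ^ 2 +
        (1 - ‖w‖ ^ 2) / ‖1 - w‖ ^ 2 * ‖x - y‖ ^ 2)) := by
  have hne := one_sub_sq_ne_zero hw
  have h1 := one_add_ne_zero hw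
  have h2 := one_sub_ne_zero hw
  have e1 : (-(d : ℂ) / 2) = ((-(d : ℝ) / 2 : ℝ) : ℂ) := by push_cast; rfl
  rw [mehler, norm_mul, e1, Complex.norm_cpow_real, Complex.norm_exp]
  congr 2
  have e2 : -(w ^ 2 * (‖x‖ ^ 2 : ℝ) - 2 * w * (inner ℝ x y : ℝ) + (‖y‖ ^ 2 : ℝ)) /
      (2 * (1 - w ^ 2)) = ((‖x‖ ^ 2 / 4 - ‖y‖ ^ 2 / 4 : ℝ) : ℂ) -
      (((1 / 8 * ‖x + y‖ ^ 2 : ℝ) : ℂ) * ((1 - w) / (1 + w)) +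
        ((1 / 8 * ‖x - y‖ ^ 2 : ℝ) : ℂ) * ((1 + w) / (1 - w))) := by
    rw [norm_add_sq_real, norm_sub_sq_real]
    have e3 : 1 - w ^ 2 = (1 - w) * (1 + w) := by ring
    rw [e3]
    push_cast
    field_simp
    ring
  have e4 : ((1 + w) / (1 - w)).re = (1 - ‖w‖ ^ 2) / ‖1 - w‖ ^ 2 := by
    have := re_cayley (w := -w) (by simpa [sub_eq_add_neg] using h2)
    simpa [sub_eq_add_neg] using this
  rw [e2, Complex.sub_re, Complex.add_re, Complex.re_ofReal_mul, Complex.re_ofReal_mul,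
    Complex.ofReal_re, re_cayley h1, e4]
  ring

/-- Because `|1 ± w| ≤ 2`, both coefficients in `norm_mehler` are at least `(1 - r²)/4`. The
parallelogram law turns the two squares into `2 (|x|² + |y|²)`, and `1/8 · 1/4 · 2 = 1/16` gives the
rate. -/
theorem gaussianBound_mehler {r : ℝ} (hr : r < 1) (hw : ‖w‖ ≤ r) :
    GaussianBound (mehler (d := d) w) ((1 - r ^ 2) / 16)
      ((2 * Real.pi * (1 - r ^ 2)) ^ (-(d : ℝ) / 2)) where
  measurable := (continuous_mehler w).stronglyMeasurable
  bound x y := by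
    have hπ := Real.pi_pos
    have hw1 : ‖w‖ < 1 := hw.trans_lt hr
    have hw0 := norm_nonneg w
    have hr2 : ‖w‖ ^ 2 ≤ r ^ 2 := by gcongr
    have hr3 : r ^ 2 < 1 := by nlinarith
    have ha : 0 < ‖1 + w‖ := norm_pos_iff.2 (one_add_ne_zero hw1)
    have hb : 0 < ‖1 - w‖ := norm_pos_iff.2 (one_sub_ne_zero hw1)
    have ha2 : ‖1 + w‖ ≤ 2 := (norm_add_le _ _).trans (by rw [norm_one]; linarith)
    have hb2 : ‖1 - w‖ ≤ 2 := (norm_sub_le _ _).trans (by rw [norm_one]; linarith)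
    rw [norm_mehler hw1, mul_assoc (_ ^ _) (Real.exp _) (Real.exp _), ← Real.exp_add]
    have key : ∀ s : ℝ, 0 < s → s ≤ 2 → (1 - r ^ 2) / 4 ≤ (1 - ‖w‖ ^ 2) / s ^ 2 := by
      intro s hs hs2
      rw [div_le_div_iff₀ (by norm_num) (by positivity)]
      have h4 : s ^ 2 ≤ 4 := by nlinarith
      linarith [mul_le_mul_of_nonneg_left h4 (sub_nonneg.2 hr3.le)]
    have hA := mul_le_mul_of_nonneg_right (key _ ha ha2) (sq_nonneg ‖x + y‖)
    have hB := mul_le_mul_of_nonneg_right (key _ hb hb2) (sq_nonneg ‖x - y‖)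
    have hpar : ‖x + y‖ ^ 2 + ‖x - y‖ ^ 2 = 2 * (‖x‖ ^ 2 + ‖y‖ ^ 2) := by
      rw [norm_add_sq_real, norm_sub_sq_real]; ring
    have hnorm : 2 * Real.pi * (1 - r ^ 2) ≤ ‖2 * (Real.pi : ℂ) * (1 - w ^ 2)‖ := by
      rw [norm_mul, norm_mul, Complex.norm_ofNat, Complex.norm_real, Real.norm_eq_abs,
        abs_of_pos hπ]
      gcongr
      have := norm_sub_norm_le (1 : ℂ) (w ^ 2)
      rw [norm_one, norm_pow] at this
      linarith
    refine mul_le_mul ?_ ?_ (Real.exp_pos _).le (by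
      have : 0 < 1 - r ^ 2 := by linarith
      positivity)
    · refine Real.rpow_le_rpow_of_nonpos ?_ hnorm ?_
      · have : 0 < 1 - r ^ 2 := by linarith
        positivity
      · have : (0 : ℝ) ≤ d := Nat.cast_nonneg d
        linarith
    · refine Real.exp_le_exp.2 ?_
      have e : (1 - r ^ 2) / 4 * ‖x + y‖ ^ 2 + (1 - r ^ 2) / 4 * ‖x - y‖ ^ 2 =
          (1 - r ^ 2) / 4 * (2 * (‖x‖ ^ 2 + ‖y‖ ^ 2)) := by rw [← hpar]; ring
      nlinarith

/-- Cauchy estimates for the derivative and for the second order Taylor remainder. -/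
theorem norm_taylor_le {F : ℂ → ℂ} {a : ℂ} {R B : ℝ} (hR : 0 < R)
    (hF : DifferentiableOn ℂ F (Metric.ball a R)) (hB : ∀ z ∈ Metric.ball a R, ‖F z‖ ≤ B) :
    ‖deriv F a‖ ≤ 2 * B / R ∧
    ∀ z ∈ Metric.ball a R, ‖F z - F a - (z - a) * deriv F a‖ ≤ 4 * B / R ^ 2 * ‖z - a‖ ^ 2 := by
  have ha : a ∈ Metric.ball a R := Metric.mem_ball_self hR
  -- Schwarz lemma: `F` stays within `2 B` of `F a`. The same argument applied to the difference
  -- quotient itself bounds the second-order remainder.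
  have hG : ∀ z ∈ Metric.ball a R, ‖dslope F a z‖ ≤ 2 * B / R := fun z hz =>
    Complex.norm_dslope_le_div_of_mapsTo_ball hF (fun u hu => by
      rw [Metric.mem_closedBall, dist_eq_norm]
      exact (norm_sub_le _ _).trans (by linarith [hB u hu, hB a ha])) hz
  have hGd : DifferentiableOn ℂ (dslope F a) (Metric.ball a R) :=
    (Complex.differentiableOn_dslope (Metric.ball_mem_nhds a hR)).2 hF
  refine ⟨by simpa using hG a ha, fun z hz => ?_⟩
  have hH : ‖dslope (dslope F a) a z‖ ≤ (4 * B / R) / R :=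
    Complex.norm_dslope_le_div_of_mapsTo_ball hGd (fun u hu => by
      rw [Metric.mem_closedBall, dist_eq_norm]
      refine (norm_sub_le _ _).trans ((add_le_add (hG u hu) (hG a ha)).trans_eq (by ring))) hz
  have e : F z - F a - (z - a) * deriv F a = (z - a) ^ 2 * dslope (dslope F a) a z := by
    have h1 := sub_smul_dslope F a z
    have h2 := sub_smul_dslope (dslope F a) a z
    rw [dslope_same, smul_eq_mul] at h2
    rw [smul_eq_mul] at h1
    rw [← h1, ← mul_sub, ← h2]
    ring
  rw [e, norm_mul, norm_pow, mul_comm]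
  refine (mul_le_mul_of_nonneg_right hH (by positivity)).trans_eq ?_
  field_simp

/-! ### Holomorphy of the Mehler operators in operator norm -/

section Holomorphy

variable {p q : ℝ≥0∞} [Fact (1 ≤ p)] [Fact (1 ≤ q)] {τ σ : ℝ}

/-- Common Gaussian bounds for the Mehler kernel, its derivative, and its Taylor remainder. -/
theorem exists_gaussianBound_mehler (d : ℕ) (hw : ‖w‖ < 1) : ∃ c M M' M'' R : ℝ,
    0 < c ∧ 0 ≤ M ∧ 0 ≤ M' ∧ 0 ≤ M'' ∧ 0 < R ∧
    GaussianBound (mehlerDeriv (d := d) w) c M' ∧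
    ∀ z ∈ Metric.ball w R, ‖z‖ < 1 ∧ GaussianBound (mehler (d := d) z) c M ∧
      GaussianBound (mehler (d := d) z - mehler w - (z - w) • mehlerDeriv w) c
        (M'' * ‖z - w‖ ^ 2) := by
  have hw0 := norm_nonneg w
  -- The midpoint between `‖w‖` and `1`: the ball of radius `R` about `w` stays in `‖z‖ ≤ r`, where
  -- one Gaussian bound serves every kernel.
  set r : ℝ := (1 + ‖w‖) / 2 with hr
  set R : ℝ := (1 - ‖w‖) / 2 with hR
  have hr1 : r < 1 := by linarith
  have hR0 : 0 < R := by linarith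
  have hr2 : 0 < 1 - r ^ 2 := by nlinarith
  have hπ := Real.pi_pos
  set c : ℝ := (1 - r ^ 2) / 16
  set M : ℝ := (2 * Real.pi * (1 - r ^ 2)) ^ (-(d : ℝ) / 2)
  have hM : 0 < M := by positivity
  have hball : ∀ z ∈ Metric.ball w R, ‖z‖ ≤ r := by
    intro z hz
    rw [Metric.mem_ball, dist_eq_norm] at hz
    have := norm_sub_norm_le z w
    linarith
  -- With `x` and `y` fixed, the bound `B` is the Gaussian envelope at `(x, y)`, so the derivative
  -- and the remainder inherit the same envelope.
  have htaylor := fun x y : EuclideanSpace ℝ (Fin d) => norm_taylor_le (F := fun z => mehler z x y)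
    (a := w) (B := M * Real.exp ((1 / 4 - c) * ‖x‖ ^ 2) * Real.exp (-((1 / 4 + c) * ‖y‖ ^ 2))) hR0
    (fun z hz => (hasDerivAt_mehler ((hball z hz).trans_lt hr1)
      x y).differentiableAt.differentiableWithinAt)
    (fun z hz => (gaussianBound_mehler hr1 (hball z hz)).bound x y)
  refine ⟨c, M, 2 * M / R, 4 * M / R ^ 2, R, by positivity, hM.le, by positivity, by positivity,
    hR0, ⟨(continuous_mehlerDeriv w).stronglyMeasurable, fun x y => ?_⟩, fun z hz =>
    ⟨(hball z hz).trans_lt hr1, gaussianBound_mehler hr1 (hball z hz), ⟨?_, fun x y => ?_⟩⟩⟩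
  · have := (htaylor x y).1
    rw [(hasDerivAt_mehler hw x y).deriv] at this
    refine this.trans_eq ?_
    ring
  · exact ((continuous_mehler z).stronglyMeasurable.sub
      (continuous_mehler w).stronglyMeasurable).sub
      ((continuous_mehlerDeriv w).stronglyMeasurable.const_smul (z - w))
  · have := (htaylor x y).2 z hz
    rw [(hasDerivAt_mehler hw x y).deriv] at this
    refine this.trans_eq ?_
    ring

theorem kernelOp_mehler_apply (hp : p ≠ ⊤) (hq : q ≠ ⊤) (hτ : p.toReal * τ = 2)
    (hσ : q.toReal * σ = 2) (hw : ‖w‖ < 1) (f : Lp ℂ p (gaussian d τ)) :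
    kernelOp p q τ σ (mehler w) f =ᵐ[volume] kernelInt (mehler w) f := by
  obtain ⟨c, M, _, _, R, hc, hM, _, _, hR, _, h⟩ := exists_gaussianBound_mehler d hw
  exact kernelOp_apply hp hq hτ hσ hc hM (h w (Metric.mem_ball_self hR)).2.1 f

theorem kernelOp_mehlerDeriv_apply (hp : p ≠ ⊤) (hq : q ≠ ⊤) (hτ : p.toReal * τ = 2)
    (hσ : q.toReal * σ = 2) (hw : ‖w‖ < 1) (f : Lp ℂ p (gaussian d τ)) :
    kernelOp p q τ σ (mehlerDeriv w) f =ᵐ[volume] kernelInt (mehlerDeriv w) f := by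
  obtain ⟨c, _, M, _, R, hc, _, hM, _, _, h, _⟩ := exists_gaussianBound_mehler d hw
  exact kernelOp_apply hp hq hτ hσ hc hM h f

/-- The Mehler operators depend holomorphically on `w`, in operator norm. -/
theorem hasDerivAt_kernelOp_mehler (hp : p ≠ ⊤) (hq : q ≠ ⊤) (hτ : p.toReal * τ = 2)
    (hσ : q.toReal * σ = 2) (hw : ‖w‖ < 1) :
    HasDerivAt (fun w => kernelOp (d := d) p q τ σ (mehler w)) (kernelOp p q τ σ (mehlerDeriv w))
      w := by
  obtain ⟨c, M, M', M'', R, hc, hM, hM', hM'', hR, h', h⟩ := exists_gaussianBound_mehler d hw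
  obtain ⟨C, hC, hCK⟩ := exists_norm_kernelOp_le d hp hq hτ hσ hc
  rw [hasDerivAt_iff_isLittleO]
  have hbig : (fun z => kernelOp (d := d) p q τ σ (mehler z) - kernelOp p q τ σ (mehler w) -
      (z - w) • kernelOp p q τ σ (mehlerDeriv w)) =O[𝓝 w] fun z => ‖z - w‖ ^ 2 := by
    refine Asymptotics.IsBigO.of_bound (C * M'') ?_
    filter_upwards [Metric.ball_mem_nhds w hR] with z hz
    obtain ⟨-, hz1, hz2⟩ := h z hz
    have hw1 := (h w (Metric.mem_ball_self hR)).2.1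
    have := hCK _ _ (by positivity) hz2
    rw [(hz1.sub hw1).kernelOp_sub (h'.smul (z - w)) hp hq hτ hσ hc (by positivity)
      (by positivity), hz1.kernelOp_sub hw1 hp hq hτ hσ hc hM hM,
      h'.kernelOp_smul hp hq hτ hσ hc hM'] at this
    rw [norm_pow, norm_norm]
    exact this.trans_eq (by ring)
  refine hbig.trans_isLittleO ?_
  have : Tendsto (fun z : ℂ => z - w) (𝓝 w) (𝓝 0) := by
    have := (continuous_id.sub (continuous_const (y := w))).tendsto w
    simpa [Pi.sub_def] using this
  have h2 := (Asymptotics.isLittleO_norm_pow_id (E' := ℂ) (n := 2) one_lt_two).comp_tendsto this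
  exact h2

end Holomorphy

end Mehler

/-! ### Uniform bounds on proper subsectors -/

section Schur

variable {d : ℕ}

/-- Young's inequality `‖G * g‖_p ≤ ‖G‖_1 ‖g‖_p`. -/
theorem lintegral_young {G g : EuclideanSpace ℝ (Fin d) → ℝ≥0∞} (hG : Measurable G)
    (hg : AEMeasurable g volume) {p : ℝ} (hp : 1 ≤ p) (hGt : ∫⁻ x, G x ≠ ⊤) :
    ∫⁻ x, (∫⁻ y, G (x - y) * g y) ^ p ≤ (∫⁻ x, G x) ^ p * ∫⁻ y, g y ^ p := by
  have hp0 : 0 < p := zero_lt_one.trans_le hp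
  set I := ∫⁻ x, G x
  have hpq : 1 - 1 / p + 1 / p = 1 := by ring
  have hq : 0 ≤ 1 - 1 / p := by
    rw [sub_nonneg, div_le_one hp0]; exact hp
  have hGx : ∀ x, Measurable fun y => G (x - y) := fun x => hG.comp (measurable_const.sub
    measurable_id)
  have hGy : ∀ y, Measurable fun x => G (x - y) := fun y => hG.comp (measurable_id.sub_const y)
  have h1 : ∀ x, (∫⁻ y, G (x - y) * g y) ^ p ≤ I ^ (p - 1) * ∫⁻ y, G (x - y) * g y ^ p := by
    intro x
    -- Split `G = G^(1 - 1/p) G^(1/p)`, so that Hölder leaves `G g^p` inside the integral, ready for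
    -- Tonelli.
    have e : ∀ y, G (x - y) * g y =
        G (x - y) ^ (1 - 1 / p) * (G (x - y) * g y ^ p) ^ (1 / p) := by
      intro y
      rw [ENNReal.mul_rpow_of_nonneg _ _ (by positivity), ← mul_assoc,
        ← ENNReal.rpow_add_of_nonneg _ _ hq (by positivity), hpq, ENNReal.rpow_one,
        ← ENNReal.rpow_mul, mul_one_div_cancel hp0.ne', ENNReal.rpow_one]
    have h2 := ENNReal.lintegral_mul_norm_pow_le (μ := volume) (hGx x).aemeasurable
      ((hGx x).aemeasurable.mul (hg.pow_const p)) hq (by positivity : 0 ≤ 1 / p) hpq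
    have hI : ∫⁻ y, G (x - y) = I := lintegral_sub_left_eq_self G x
    simp only [Pi.mul_apply] at h2
    rw [hI] at h2
    calc (∫⁻ y, G (x - y) * g y) ^ p
        = (∫⁻ y, G (x - y) ^ (1 - 1 / p) * (G (x - y) * g y ^ p) ^ (1 / p)) ^ p := by
          simp_rw [← e]
      _ ≤ (I ^ (1 - 1 / p) * (∫⁻ y, G (x - y) * g y ^ p) ^ (1 / p)) ^ p := by gcongr
      _ = I ^ (p - 1) * ∫⁻ y, G (x - y) * g y ^ p := by
          rw [ENNReal.mul_rpow_of_nonneg _ _ hp0.le, ← ENNReal.rpow_mul, ← ENNReal.rpow_mul,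
            one_div_mul_cancel hp0.ne', ENNReal.rpow_one, sub_mul, one_mul,
            one_div_mul_cancel hp0.ne']
  calc ∫⁻ x, (∫⁻ y, G (x - y) * g y) ^ p
      ≤ ∫⁻ x, I ^ (p - 1) * ∫⁻ y, G (x - y) * g y ^ p := lintegral_mono h1
    _ = I ^ (p - 1) * ∫⁻ x, ∫⁻ y, G (x - y) * g y ^ p := by
        rw [lintegral_const_mul' _ _ (ENNReal.rpow_ne_top_of_nonneg (by linarith) hGt)]
    _ = I ^ (p - 1) * ∫⁻ y, ∫⁻ x, G (x - y) * g y ^ p := by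
        rw [lintegral_lintegral_swap]
        exact (hG.comp (measurable_fst.sub measurable_snd)).aemeasurable.mul
          (hg.pow_const p).comp_snd
    _ = I ^ (p - 1) * ∫⁻ y, I * g y ^ p := by
        congr 2
        ext y
        rw [lintegral_mul_const _ (hGy y)]
        congr 1
        exact lintegral_sub_right_eq_self G y
    _ = I ^ p * ∫⁻ y, g y ^ p := by
        rw [lintegral_const_mul' _ _ hGt, ← mul_assoc]
        congr 1
        nth_rewrite 2 [← ENNReal.rpow_one I]
        rw [← ENNReal.rpow_add_of_nonneg _ _ (by linarith) zero_le_one, sub_add_cancel]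

/-- Conjugation with the weight leaves a kernel dominated by the convolution kernel `N exp (-b
|x-y|²)`, whose integral is `N (π/b)^(d/2)`; Young's inequality does the rest. -/
theorem eLpNorm_kernelInt_le_of_convolution_bound
    {K : EuclideanSpace ℝ (Fin d) → EuclideanSpace ℝ (Fin d) → ℂ} {N b : ℝ} (hN : 0 ≤ N)
    (hb : 0 < b)
    (hK : ∀ x y, ‖K x y‖ ≤ N * Real.exp (‖x‖ ^ 2 / 4 - ‖y‖ ^ 2 / 4 - b * ‖x - y‖ ^ 2))
    {p : ℝ≥0∞} (hp1 : 1 ≤ p) (hp : p ≠ ⊤) {τ : ℝ} (hτ : p.toReal * τ = 2)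
    {f : EuclideanSpace ℝ (Fin d) → ℂ} (hf : AEStronglyMeasurable f volume) :
    eLpNorm (kernelInt K f) p (gaussian d τ) ≤
      ENNReal.ofReal (N * (Real.pi / b) ^ ((d : ℝ) / 2)) * eLpNorm f p (gaussian d τ) := by
  have hp0 : p ≠ 0 := (zero_lt_one.trans_le hp1).ne'
  have hpr : 1 ≤ p.toReal := by
    rw [← ENNReal.toReal_one]
    exact ENNReal.toReal_mono hp hp1
  have hpp : 0 < p.toReal := zero_lt_one.trans_le hpr
  let G : EuclideanSpace ℝ (Fin d) → ℝ≥0∞ := fun x =>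
    ENNReal.ofReal (N * Real.exp (-(b * ‖x‖ ^ 2)))
  have hGm : Measurable G := by
    simp only [G]
    fun_prop
  have hG : ∫⁻ x, G x = ENNReal.ofReal (N * (Real.pi / b) ^ ((d : ℝ) / 2)) := by
    rw [← ofReal_integral_eq_lintegral_ofReal ((integrable_exp_neg_mul_sq_norm hb).const_mul N)
      (Eventually.of_forall fun x => by positivity), integral_const_mul]
    have := GaussianFourier.integral_rexp_neg_mul_sq_norm (V := EuclideanSpace ℝ (Fin d)) hb
    simp only [neg_mul, finrank_euclideanSpace, Fintype.card_fin] at this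
    rw [this]
  have hpt : ∀ x, ‖weighted (kernelInt K f) x‖ₑ ≤ ∫⁻ y, G (x - y) * ‖weighted f y‖ₑ := by
    intro x
    rw [weighted, enorm_smul]
    refine (mul_le_mul_right (enorm_integral_le_lintegral_enorm _) _).trans ?_
    rw [← lintegral_const_mul' _ _ enorm_ne_top]
    refine lintegral_mono fun y => ?_
    rw [weighted, enorm_smul, enorm_mul, ← mul_assoc, ← mul_assoc]
    refine mul_le_mul_left ?_ _
    rw [Real.enorm_eq_ofReal (Real.exp_pos _).le, Real.enorm_eq_ofReal (Real.exp_pos _).le,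
      ← ofReal_norm, ← ENNReal.ofReal_mul (Real.exp_pos _).le, ← ENNReal.ofReal_mul (by positivity)]
    refine ENNReal.ofReal_le_ofReal
      ((mul_le_mul_of_nonneg_left (hK x y) (Real.exp_pos _).le).trans_eq ?_)
    rw [mul_left_comm, ← Real.exp_add, mul_assoc, ← Real.exp_add]
    ring_nf
  rw [eLpNorm_gaussian hp0 hp hτ, eLpNorm_gaussian hp0 hp hτ, mul_left_comm]
  gcongr
  rw [eLpNorm_eq_lintegral_rpow_enorm_toReal hp0 hp, eLpNorm_eq_lintegral_rpow_enorm_toReal hp0 hp,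
    ← hG]
  calc (∫⁻ x, ‖weighted (kernelInt K f) x‖ₑ ^ p.toReal) ^ (1 / p.toReal)
      ≤ ((∫⁻ x, G x) ^ p.toReal * ∫⁻ y, ‖weighted f y‖ₑ ^ p.toReal) ^ (1 / p.toReal) := by
        gcongr
        refine (lintegral_mono fun x => ENNReal.rpow_le_rpow (hpt x) hpp.le).trans ?_
        exact lintegral_young hGm hf.weighted.enorm hpr (by rw [hG]; exact ENNReal.ofReal_ne_top)
    _ = _ := by
        rw [ENNReal.mul_rpow_of_nonneg _ _ (by positivity), ← ENNReal.rpow_mul,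
          mul_one_div_cancel hpp.ne', ENNReal.rpow_one]

/-- The constants of `gaussianBound_mehler` blow up as `r → 1`, that is, near time `0`. Dropping the
`|x+y|²` term instead leaves a convolution Gaussian, where the width compensates the prefactor: only
the ratio of the two survives. -/
theorem norm_kernelOp_mehler_le {p : ℝ≥0∞} [Fact (1 ≤ p)] (hp : p ≠ ⊤) {τ : ℝ}
    (hτ : p.toReal * τ = 2) {w : ℂ} (hw : ‖w‖ < 1) :
    ‖kernelOp (d := d) p p τ τ (mehler w)‖ ≤
      (4 * ‖1 - w‖ / (‖1 + w‖ * (1 - ‖w‖ ^ 2))) ^ ((d : ℝ) / 2) := by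
  have hπ := Real.pi_pos
  have hw0 := norm_nonneg w
  have h1 : 0 < 1 - ‖w‖ ^ 2 := by nlinarith
  have ha : 0 < ‖1 + w‖ := norm_pos_iff.2 (one_add_ne_zero hw)
  have hb : 0 < ‖1 - w‖ := norm_pos_iff.2 (one_sub_ne_zero hw)
  set N : ℝ := ‖2 * Real.pi * (1 - w ^ 2)‖ ^ (-(d : ℝ) / 2) with hN
  set b : ℝ := 1 / 8 * ((1 - ‖w‖ ^ 2) / ‖1 - w‖ ^ 2) with hbdef
  have hb0 : 0 < b := by positivity
  have hN0 : 0 ≤ N := by positivity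
  have hK : ∀ x y : EuclideanSpace ℝ (Fin d), ‖mehler w x y‖ ≤
      N * Real.exp (‖x‖ ^ 2 / 4 - ‖y‖ ^ 2 / 4 - b * ‖x - y‖ ^ 2) := by
    intro x y
    rw [norm_mehler hw]
    refine mul_le_mul_of_nonneg_left (Real.exp_le_exp.2 ?_) hN0
    have : 0 ≤ (1 - ‖w‖ ^ 2) / ‖1 + w‖ ^ 2 * ‖x + y‖ ^ 2 := by positivity
    rw [hbdef]
    nlinarith
  have e : N * (Real.pi / b) ^ ((d : ℝ) / 2) =
      (4 * ‖1 - w‖ / (‖1 + w‖ * (1 - ‖w‖ ^ 2))) ^ ((d : ℝ) / 2) := by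
    have hn : ‖2 * (Real.pi : ℂ) * (1 - w ^ 2)‖ = 2 * Real.pi * (‖1 - w‖ * ‖1 + w‖) := by
      have : 1 - w ^ 2 = (1 - w) * (1 + w) := by ring
      rw [this, norm_mul, norm_mul, norm_mul, Complex.norm_ofNat, Complex.norm_real,
        Real.norm_eq_abs, abs_of_pos hπ]
    rw [hN, hn, neg_div, Real.rpow_neg (by positivity), ← Real.inv_rpow (by positivity),
      ← Real.mul_rpow (by positivity) (by positivity)]
    congr 1
    rw [hbdef]
    field_simp
    norm_num
  rw [← e]
  refine ContinuousLinearMap.opNorm_le_bound _ (by positivity) fun f => ?_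
  have hfm := (aestronglyMeasurable_gaussian_iff (tau_pos hτ)).1 (Lp.aestronglyMeasurable f)
  have h2 := eLpNorm_kernelInt_le_of_convolution_bound hN0 hb0 hK Fact.out hp hτ hfm
  have h3 : eLpNorm (kernelOp (d := d) p p τ τ (mehler w) f) p (gaussian d τ) =
      eLpNorm (kernelInt (mehler w) f) p (gaussian d τ) := by
    refine eLpNorm_congr_ae ?_
    rw [EventuallyEq, ae_gaussian (tau_pos hτ)]
    exact kernelOp_mehler_apply hp hp hτ hτ hw f
  rw [Lp.norm_def, Lp.norm_def, h3]
  have := ENNReal.toReal_mono (ENNReal.mul_ne_top ENNReal.ofReal_ne_top (Lp.eLpNorm_ne_top f)) h2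
  rwa [ENNReal.toReal_mul, ENNReal.toReal_ofReal (by positivity)] at this

theorem norm_exp_neg_lt_one {z : ℂ} (hz : 0 < z.re) : ‖Complex.exp (-z)‖ < 1 := by
  rw [Complex.norm_exp, Complex.neg_re]
  exact Real.exp_lt_one_iff.2 (by linarith)

theorem cos_mul_norm_le_re {θ : ℝ} (hθ2 : θ < Real.pi / 2) {z : ℂ}
    (hz : z ∈ sector θ) : Real.cos θ * ‖z‖ ≤ z.re := by
  have h1 : z.re = ‖z‖ * Real.cos (Complex.arg z) := by
    rw [Complex.cos_arg hz.1]
    field_simp [norm_ne_zero_iff.2 hz.1]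
  rw [h1, mul_comm]
  gcongr
  rw [← Real.cos_abs (Complex.arg z)]
  exact Real.cos_le_cos_of_nonneg_of_le_pi (abs_nonneg _) (by linarith [Real.pi_pos]) hz.2.le

theorem exists_mehler_ratio_le {θ : ℝ} (hθ : 0 < θ) (hθ2 : θ < Real.pi / 2) :
    ∃ B : ℝ, ∀ z ∈ sector θ, 4 * ‖1 - Complex.exp (-z)‖ /
      (‖1 + Complex.exp (-z)‖ * (1 - ‖Complex.exp (-z)‖ ^ 2)) ≤ B := by
  set k := Real.cos θ with hk
  have hk0 : 0 < k := Real.cos_pos_of_mem_Ioo ⟨by linarith, hθ2⟩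
  have hk1 : k ≤ 1 := Real.cos_le_one θ
  have hek : 0 < 1 - Real.exp (-k) := by
    have : Real.exp (-k) < 1 := Real.exp_lt_one_iff.2 (by linarith)
    linarith
  refine ⟨4 * 2 / ((1 - Real.exp (-k)) * (1 - Real.exp (-k))) + 16 / k, fun z hz => ?_⟩
  have hre := cos_mul_norm_le_re hθ2 hz
  rw [← hk] at hre
  have hz0 : 0 < ‖z‖ := norm_pos_iff.2 hz.1
  have ha : 0 < z.re := (mul_pos hk0 hz0).trans_le hre
  set w := Complex.exp (-z) with hw
  have hwn : ‖w‖ = Real.exp (-z.re) := by rw [hw, Complex.norm_exp, Complex.neg_re]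
  have hw1 : ‖w‖ < 1 := norm_exp_neg_lt_one ha
  have hw0 := norm_nonneg w
  -- For `Re z ≥ k = cos θ`, `‖w‖` is bounded away from `1` and every factor is controlled
  -- separately. Otherwise `|z| ≤ 1`, and both `|1 - w|` and `1 - ‖w‖²` are of first order in `z`:
  -- the ratio is at most a multiple of `|z| / Re z ≤ 1 / k`. The constant is the sum of the bounds
  -- in the two cases.
  rcases le_or_gt k z.re with h | h
  · have h1 : ‖w‖ ≤ Real.exp (-k) := by rw [hwn]; gcongr
    have h2 : ‖1 - w‖ ≤ 2 := (norm_sub_le _ _).trans (by rw [norm_one]; linarith)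
    have h3 : 1 - Real.exp (-k) ≤ ‖1 + w‖ := by
      have := norm_sub_norm_le (1 : ℂ) (-w)
      rw [norm_one, norm_neg, sub_neg_eq_add] at this
      linarith
    have h4 : 1 - Real.exp (-k) ≤ 1 - ‖w‖ ^ 2 := by nlinarith
    calc 4 * ‖1 - w‖ / (‖1 + w‖ * (1 - ‖w‖ ^ 2))
        ≤ 4 * 2 / ((1 - Real.exp (-k)) * (1 - Real.exp (-k))) := by gcongr
      _ ≤ _ := le_add_of_nonneg_right (by positivity)
  · have hz1 : ‖z‖ ≤ 1 := by
      by_contra! h'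
      nlinarith
    have h2 : ‖1 - w‖ ≤ 2 * ‖z‖ := by
      have := Complex.norm_exp_sub_one_le (x := -z) (by rwa [norm_neg])
      rwa [norm_neg, norm_sub_rev] at this
    have h3 : 1 ≤ ‖1 + w‖ := by
      refine le_trans ?_ (Complex.re_le_norm _)
      rw [Complex.add_re, Complex.one_re, hw, Complex.exp_re]
      have him : |(-z).im| ≤ 1 := (Complex.abs_im_le_norm _).trans (by rwa [norm_neg])
      rw [abs_le] at him
      have := Real.cos_nonneg_of_mem_Icc (x := (-z).im)
        ⟨by linarith [Real.pi_gt_three], by linarith [Real.pi_gt_three]⟩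
      have := Real.exp_pos (-z).re
      nlinarith
    have h4 : z.re / 2 ≤ 1 - ‖w‖ ^ 2 := by
      have h5 : ‖w‖ * (1 + z.re) ≤ 1 := by
        have h6 := Real.add_one_le_exp z.re
        have h7 : Real.exp (-z.re) * Real.exp z.re = 1 := by rw [← Real.exp_add]; simp
        rw [hwn, ← h7]
        gcongr
        linarith
      have h8 : ‖w‖ ^ 2 ≤ ‖w‖ := by nlinarith
      nlinarith
    calc 4 * ‖1 - w‖ / (‖1 + w‖ * (1 - ‖w‖ ^ 2))
        ≤ 4 * (2 * ‖z‖) / (1 * (z.re / 2)) := by gcongr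
      _ = 16 * (‖z‖ / z.re) := by field_simp; norm_num
      _ ≤ 16 * (1 / k) := by
        gcongr 16 * ?_
        rw [div_le_div_iff₀ ha hk0]
        linarith
      _ = 16 / k := by ring
      _ ≤ _ := le_add_of_nonneg_left (by positivity)

/-- The Mehler operators are uniformly bounded on proper subsectors. -/
theorem exists_norm_kernelOp_mehler_le (d : ℕ) {p : ℝ≥0∞} [Fact (1 ≤ p)] (hp : p ≠ ⊤) {τ : ℝ}
    (hτ : p.toReal * τ = 2) {θ : ℝ} (hθ : 0 < θ) (hθ2 : θ < Real.pi / 2) :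
    ∃ B : ℝ, ∀ z ∈ sector θ,
      ‖kernelOp (d := d) p p τ τ (mehler (Complex.exp (-z)))‖ ≤ B := by
  obtain ⟨B, hB⟩ := exists_mehler_ratio_le hθ hθ2
  refine ⟨B ^ ((d : ℝ) / 2), fun z hz => ?_⟩
  have hre := cos_mul_norm_le_re hθ2 hz
  have hk0 : 0 < Real.cos θ := Real.cos_pos_of_mem_Ioo ⟨by linarith, hθ2⟩
  have ha : 0 < z.re := (mul_pos hk0 (norm_pos_iff.2 hz.1)).trans_le hre
  refine (norm_kernelOp_mehler_le hp hτ (norm_exp_neg_lt_one ha)).trans ?_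
  have h1 : 0 ≤ 1 - ‖Complex.exp (-z)‖ ^ 2 := by
    have := norm_exp_neg_lt_one ha
    nlinarith [norm_nonneg (Complex.exp (-z))]
  exact Real.rpow_le_rpow (by positivity) (hB z hz) (by positivity)

end Schur

/-! ### The Kolmogorov equation on test functions -/

section TestFunctions

variable {d : ℕ}

theorem hasFDerivAt_mehler (w : ℂ) (x y : EuclideanSpace ℝ (Fin d)) :
    ∃ D : EuclideanSpace ℝ (Fin d) →L[ℝ] ℂ, HasFDerivAt (mehler w x) D y ∧
      ∀ v, D v = (w * (inner ℝ x v : ℝ) - (inner ℝ y v : ℝ)) / (1 - w ^ 2) * mehler w x y := by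
  have h1 : HasFDerivAt (fun y : EuclideanSpace ℝ (Fin d) => ((inner ℝ x y : ℝ) : ℂ))
      (Complex.ofRealCLM.comp (innerSL ℝ x)) y :=
    Complex.ofRealCLM.hasFDerivAt.comp y (innerSL ℝ x).hasFDerivAt
  have h2 : HasFDerivAt (fun y : EuclideanSpace ℝ (Fin d) => ((‖y‖ ^ 2 : ℝ) : ℂ))
      (Complex.ofRealCLM.comp (2 • innerSL ℝ y)) y :=
    Complex.ofRealCLM.hasFDerivAt.comp y (hasStrictFDerivAt_norm_sq y).hasFDerivAt
  have h3 := (((((h1.const_mul (2 * w)).const_sub (w ^ 2 * (‖x‖ ^ 2 : ℝ))).add h2).neg.mul_const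
    (2 * (1 - w ^ 2))⁻¹).cexp).const_mul ((2 * Real.pi * (1 - w ^ 2)) ^ (-(d : ℂ) / 2))
  have e : ∀ y, mehler w x y = (2 * Real.pi * (1 - w ^ 2)) ^ (-(d : ℂ) / 2) *
      Complex.exp (-(w ^ 2 * (‖x‖ ^ 2 : ℝ) - 2 * w * (inner ℝ x y : ℝ) + (‖y‖ ^ 2 : ℝ)) *
        (2 * (1 - w ^ 2))⁻¹) := fun y => by rw [mehler, div_eq_mul_inv _ (2 * (1 - w ^ 2))]
  refine ⟨_, h3.congr_of_eventuallyEq (Eventually.of_forall e), fun v => ?_⟩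
  rw [e]
  simp
  ring

theorem differentiable_mehler (w : ℂ) (x : EuclideanSpace ℝ (Fin d)) :
    Differentiable ℝ (mehler w x) := fun y => by
  obtain ⟨D, hD, -⟩ := hasFDerivAt_mehler w x y
  exact hD.differentiableAt

theorem fderiv_mehler (w : ℂ) (x y v : EuclideanSpace ℝ (Fin d)) :
    fderiv ℝ (mehler w x) y v =
      (w * (inner ℝ x v : ℝ) - (inner ℝ y v : ℝ)) / (1 - w ^ 2) * mehler w x y := by
  obtain ⟨D, hD, h⟩ := hasFDerivAt_mehler w x y
  rw [hD.fderiv, h]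

theorem continuous_mehler_right (w : ℂ) (x : EuclideanSpace ℝ (Fin d)) :
    Continuous (mehler w x) := (differentiable_mehler w x).continuous

/-- The first order expression `∂_v k + ⟨y, v⟩ k` applied to the Mehler kernel. -/
def mehlerFlux (w : ℂ) (x v y : EuclideanSpace ℝ (Fin d)) : ℂ :=
  (w * (inner ℝ x v : ℝ) - w ^ 2 * (inner ℝ y v : ℝ)) / (1 - w ^ 2) * mehler w x y

theorem differentiable_mehlerFlux (w : ℂ) (x v : EuclideanSpace ℝ (Fin d)) :
    Differentiable ℝ (mehlerFlux w x v) ∧ ∀ y, fderiv ℝ (mehlerFlux w x v) y v =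
      (-(w ^ 2 * (‖v‖ ^ 2 : ℝ)) / (1 - w ^ 2) +
        (w * (inner ℝ x v : ℝ) - w ^ 2 * (inner ℝ y v : ℝ)) *
        (w * (inner ℝ x v : ℝ) - (inner ℝ y v : ℝ)) / (1 - w ^ 2) ^ 2) * mehler w x y := by
  have key : ∀ y, HasFDerivAt (fun y : EuclideanSpace ℝ (Fin d) =>
      (w * ((inner ℝ x v : ℝ) : ℂ) - w ^ 2 * ((inner ℝ v y : ℝ) : ℂ)) * (1 - w ^ 2)⁻¹) _ y := fun y =>
    (((Complex.ofRealCLM.hasFDerivAt.comp y (innerSL ℝ v).hasFDerivAt).const_mul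
      (w ^ 2)).const_sub (w * ((inner ℝ x v : ℝ) : ℂ))).mul_const (1 - w ^ 2)⁻¹
  have e : mehlerFlux w x v = fun y => ((w * ((inner ℝ x v : ℝ) : ℂ) -
      w ^ 2 * ((inner ℝ v y : ℝ) : ℂ)) * (1 - w ^ 2)⁻¹) * mehler w x y := by
    ext y
    rw [mehlerFlux, real_inner_comm y v, div_eq_mul_inv]
  have key2 := fun y => (key y).fun_mul (differentiable_mehler w x y).hasFDerivAt
  rw [e]
  refine ⟨fun y => (key2 y).differentiableAt, fun y => ?_⟩
  rw [show fderiv ℝ _ y = _ from (key2 y).fderiv]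
  simp only [add_apply, smul_apply, fderiv_mehler, neg_apply,
    ContinuousLinearMap.comp_apply, innerSL_apply_apply, Complex.ofRealCLM_apply, smul_eq_mul,
    real_inner_self_eq_norm_sq, real_inner_comm y v, div_eq_mul_inv, ← inv_pow]
  generalize (1 - w ^ 2)⁻¹ = u
  ring

variable {f : EuclideanSpace ℝ (Fin d) → ℂ}

theorem contDiff_fderiv_apply (hf : ContDiff ℝ 2 f) (v : EuclideanSpace ℝ (Fin d)) :
    ContDiff ℝ 1 fun y => fderiv ℝ f y v :=
  (hf.fderiv_right (m := 1) (by norm_num)).clm_apply contDiff_const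

theorem ouExpr_eq_sum (hf : ContDiff ℝ 2 f) (y : EuclideanSpace ℝ (Fin d)) :
    ouExpr f y = ∑ i, (-fderiv ℝ (fun y => fderiv ℝ f y (EuclideanSpace.basisFun (Fin d) ℝ i)) y
        (EuclideanSpace.basisFun (Fin d) ℝ i) +
      (inner ℝ y (EuclideanSpace.basisFun (Fin d) ℝ i) : ℝ) *
        fderiv ℝ f y (EuclideanSpace.basisFun (Fin d) ℝ i)) := by
  set b := EuclideanSpace.basisFun (Fin d) ℝ
  rw [ouExpr, InnerProductSpace.laplacian_eq_iteratedFDeriv_orthonormalBasis f b,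
    Finset.sum_add_distrib, Finset.sum_neg_distrib]
  congr 1
  · congr 1
    refine Finset.sum_congr rfl fun i _ => ?_
    rw [iteratedFDeriv_two_apply]
    have h := (hf.fderiv_right (m := 1) (by norm_num)).differentiable (by norm_num) y
    have h2 := h.hasFDerivAt.clm_apply (hasFDerivAt_const (b i) y)
    rw [show fderiv ℝ _ y = _ from h2.fderiv]
    simp
  · conv_lhs => rw [← b.sum_repr' y, map_sum]
    refine Finset.sum_congr rfl fun i _ => ?_
    rw [b.sum_repr' y, map_smul, real_inner_comm, Complex.real_smul]

theorem continuous_ouExpr (hf : ContDiff ℝ 2 f) : Continuous (ouExpr f) := by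
  rw [show ouExpr f = _ from funext (ouExpr_eq_sum hf)]
  refine continuous_finsetSum _ fun i _ => ?_
  have h := contDiff_fderiv_apply hf (EuclideanSpace.basisFun (Fin d) ℝ i)
  refine ((h.continuous_fderiv (by norm_num)).clm_apply continuous_const).neg.add (.mul ?_ h.continuous)
  fun_prop

theorem hasCompactSupport_ouExpr (hf : ContDiff ℝ 2 f) (hc : HasCompactSupport f) :
    HasCompactSupport (ouExpr f) := by
  refine hc.mono' fun y hy => ?_
  by_contra hy'
  refine hy ?_
  rw [ouExpr_eq_sum hf]
  have h0 : f =ᶠ[𝓝 y] 0 := notMem_tsupport_iff_eventuallyEq.1 hy'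
  have h1 : fderiv ℝ f =ᶠ[𝓝 y] 0 := by
    have := h0.fderiv (𝕜 := ℝ)
    refine this.trans (Eventually.of_forall fun z => ?_)
    simp [Pi.zero_def]
  refine Finset.sum_eq_zero fun i _ => ?_
  have h2 : (fun y => fderiv ℝ f y (EuclideanSpace.basisFun (Fin d) ℝ i)) =ᶠ[𝓝 y]
      fun _ => (0 : ℂ) := by
    filter_upwards [h1] with z hz
    rw [hz]; rfl
  rw [h2.fderiv_eq, h1.eq_of_nhds]
  simp

/-- Two integrations by parts in the direction `v`. The first merges the second-order and drift
terms into `mehlerFlux` times `∂_v f`; the second moves the remaining derivative onto the flux.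
Summed over an orthonormal basis, the polynomial factor becomes the one in `w * mehlerDeriv w`. -/
theorem integral_mehler_mul_directional (hf : ContDiff ℝ 2 f) (hc : HasCompactSupport f) {w : ℂ}
    (hw : ‖w‖ < 1) (x v : EuclideanSpace ℝ (Fin d)) :
    ∫ y, mehler w x y * (-fderiv ℝ (fun y => fderiv ℝ f y v) y v +
        (inner ℝ y v : ℝ) * fderiv ℝ f y v) =
      ∫ y, -((-(w ^ 2 * (‖v‖ ^ 2 : ℝ)) / (1 - w ^ 2) +
        (w * (inner ℝ x v : ℝ) - w ^ 2 * (inner ℝ y v : ℝ)) *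
        (w * (inner ℝ x v : ℝ) - (inner ℝ y v : ℝ)) / (1 - w ^ 2) ^ 2) * mehler w x y) * f y := by
  have hne := one_sub_sq_ne_zero hw
  have hg := contDiff_fderiv_apply hf v
  have hgc : HasCompactSupport fun y => fderiv ℝ f y v := hc.fderiv_apply ℝ v
  have hk := continuous_mehler_right w x
  obtain ⟨hq, hq'⟩ := differentiable_mehlerFlux w x v
  have hgc' := hgc.fderiv_apply ℝ v
  have hgcont : Continuous fun y => fderiv ℝ (fun y => fderiv ℝ f y v) y v :=
    (hg.continuous_fderiv (by norm_num)).clm_apply continuous_const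
  have hic : Continuous fun y : EuclideanSpace ℝ (Fin d) => ((inner ℝ y v : ℝ) : ℂ) := by fun_prop
  have hk' : Continuous fun y => fderiv ℝ (mehler w x) y v := by
    simp only [fderiv_mehler]
    fun_prop
  have hqc' : Continuous fun y => fderiv ℝ (mehlerFlux w x v) y v := by
    simp only [hq']
    fun_prop
  have i1 : Integrable fun y => mehler w x y * fderiv ℝ (fun y => fderiv ℝ f y v) y v :=
    (hk.mul hgcont).integrable_of_hasCompactSupport hgc'.mul_left
  have i2 : Integrable fun y => fderiv ℝ (mehler w x) y v * fderiv ℝ f y v :=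
    (hk'.mul hg.continuous).integrable_of_hasCompactSupport hgc.mul_left
  have i3 : Integrable fun y => mehler w x y * fderiv ℝ f y v :=
    (hk.mul hg.continuous).integrable_of_hasCompactSupport hgc.mul_left
  have i4 : Integrable fun y => (inner ℝ y v : ℝ) * (mehler w x y * fderiv ℝ f y v) :=
    (hic.mul (hk.mul hg.continuous)).integrable_of_hasCompactSupport hgc.mul_left.mul_left
  have i5 : Integrable fun y => mehlerFlux w x v y * fderiv ℝ f y v :=
    (hq.continuous.mul hg.continuous).integrable_of_hasCompactSupport hgc.mul_left
  have i6 : Integrable fun y => mehlerFlux w x v y * f y :=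
    (hq.continuous.mul hf.continuous).integrable_of_hasCompactSupport hc.mul_left
  have i7 : Integrable fun y => fderiv ℝ (mehlerFlux w x v) y v * f y :=
    (hqc'.mul hf.continuous).integrable_of_hasCompactSupport hc.mul_left
  have e1 := integral_mul_fderiv_eq_neg_fderiv_mul_of_integrable i2 i1 i3
    (fun y _ => differentiable_mehler w x y) (fun y _ => hg.differentiable (by norm_num) y)
  have e2 := integral_mul_fderiv_eq_neg_fderiv_mul_of_integrable i7 i5 i6
    (fun y _ => hq y) (fun y _ => hf.differentiable (by norm_num) y)
  calc ∫ y, mehler w x y * (-fderiv ℝ (fun y => fderiv ℝ f y v) y v +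
        (inner ℝ y v : ℝ) * fderiv ℝ f y v)
      = ∫ y, ((inner ℝ y v : ℝ) * (mehler w x y * fderiv ℝ f y v) -
          mehler w x y * fderiv ℝ (fun y => fderiv ℝ f y v) y v) := by
        congr 1
        ext y
        ring
    _ = ∫ y, ((inner ℝ y v : ℝ) * (mehler w x y * fderiv ℝ f y v) +
          fderiv ℝ (mehler w x) y v * fderiv ℝ f y v) := by
        rw [integral_sub i4 i1, integral_add i4 i2, e1, sub_neg_eq_add]
    _ = ∫ y, mehlerFlux w x v y * fderiv ℝ f y v := by
        congr 1
        ext y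
        rw [fderiv_mehler, mehlerFlux]
        field_simp
        ring
    _ = _ := by
        rw [e2, ← integral_neg]
        congr 1
        ext y
        rw [hq']
        ring

/-- The Kolmogorov equation `w ∂_w T_w f = T_w (L f)` on test functions. -/
theorem kernelInt_mehlerDeriv (hf : ContDiff ℝ 2 f) (hc : HasCompactSupport f) {w : ℂ}
    (hw : ‖w‖ < 1) (x : EuclideanSpace ℝ (Fin d)) :
    w * kernelInt (mehlerDeriv w) f x = kernelInt (mehler w) (ouExpr f) x := by
  have hne := one_sub_sq_ne_zero hw
  set b := EuclideanSpace.basisFun (Fin d) ℝ with hb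
  have hk := continuous_mehler_right w x
  have hA : ∀ v : EuclideanSpace ℝ (Fin d), Integrable fun y => mehler w x y *
      (-fderiv ℝ (fun y => fderiv ℝ f y v) y v + (inner ℝ y v : ℝ) * fderiv ℝ f y v) := by
    intro v
    have hg := contDiff_fderiv_apply hf v
    have hgc : HasCompactSupport fun y => fderiv ℝ f y v := hc.fderiv_apply ℝ v
    have hgc' := hgc.fderiv_apply ℝ v
    have hgcont : Continuous fun y => fderiv ℝ (fun y => fderiv ℝ f y v) y v :=
      (hg.continuous_fderiv (by norm_num)).clm_apply continuous_const
    have hic : Continuous fun y : EuclideanSpace ℝ (Fin d) => ((inner ℝ y v : ℝ) : ℂ) := by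
      fun_prop
    exact (hk.mul (hgcont.neg.add (hic.mul hg.continuous))).integrable_of_hasCompactSupport
      (HasCompactSupport.mul_left (HasCompactSupport.add hgc'.neg hgc.mul_left))
  have hB : ∀ v : EuclideanSpace ℝ (Fin d), Integrable fun y =>
      -((-(w ^ 2 * (‖v‖ ^ 2 : ℝ)) / (1 - w ^ 2) +
        (w * (inner ℝ x v : ℝ) - w ^ 2 * (inner ℝ y v : ℝ)) *
        (w * (inner ℝ x v : ℝ) - (inner ℝ y v : ℝ)) / (1 - w ^ 2) ^ 2) * mehler w x y) * f y := by
    intro v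
    refine Continuous.integrable_of_hasCompactSupport (Continuous.mul ?_ hf.continuous) hc.mul_left
    fun_prop
  symm
  calc kernelInt (mehler w) (ouExpr f) x
      = ∫ y, ∑ i, mehler w x y * (-fderiv ℝ (fun y => fderiv ℝ f y (b i)) y (b i) +
        (inner ℝ y (b i) : ℝ) * fderiv ℝ f y (b i)) := by
        rw [kernelInt]
        congr 1
        ext y
        rw [ouExpr_eq_sum hf, Finset.mul_sum]
    _ = ∫ y, ∑ i, -((-(w ^ 2 * (‖b i‖ ^ 2 : ℝ)) / (1 - w ^ 2) +
        (w * (inner ℝ x (b i) : ℝ) - w ^ 2 * (inner ℝ y (b i) : ℝ)) *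
        (w * (inner ℝ x (b i) : ℝ) - (inner ℝ y (b i) : ℝ)) / (1 - w ^ 2) ^ 2) *
          mehler w x y) * f y := by
        rw [integral_finsetSum _ fun i _ => hA (b i), integral_finsetSum _ fun i _ => hB (b i)]
        exact Finset.sum_congr rfl fun i _ => integral_mehler_mul_directional hf hc hw x (b i)
    _ = ∫ y, w * (mehlerDeriv w x y * f y) := by
        congr 1
        ext y
        have s1 : ∑ i, (inner ℝ x (b i) : ℝ) * (inner ℝ y (b i) : ℝ) = inner ℝ x y := by
          rw [← b.sum_inner_mul_inner x y]
          exact Finset.sum_congr rfl fun i _ => by rw [real_inner_comm y]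
        have s2 : ∑ i, (inner ℝ x (b i) : ℝ) * (inner ℝ x (b i) : ℝ) = ‖x‖ ^ 2 := by
          rw [← real_inner_self_eq_norm_sq, ← b.sum_inner_mul_inner x x]
          exact Finset.sum_congr rfl fun i _ => by rw [real_inner_comm x]
        have s3 : ∑ i, (inner ℝ y (b i) : ℝ) * (inner ℝ y (b i) : ℝ) = ‖y‖ ^ 2 := by
          rw [← real_inner_self_eq_norm_sq, ← b.sum_inner_mul_inner y y]
          exact Finset.sum_congr rfl fun i _ => by rw [real_inner_comm y]
        have e : ∀ i, -((-(w ^ 2 * (‖b i‖ ^ 2 : ℝ)) / (1 - w ^ 2) +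
            (w * (inner ℝ x (b i) : ℝ) - w ^ 2 * (inner ℝ y (b i) : ℝ)) *
            (w * (inner ℝ x (b i) : ℝ) - (inner ℝ y (b i) : ℝ)) / (1 - w ^ 2) ^ 2) *
              mehler w x y) * f y =
            (w ^ 2 / (1 - w ^ 2) - w ^ 2 / (1 - w ^ 2) ^ 2 *
              (((inner ℝ x (b i) : ℝ) * (inner ℝ x (b i) : ℝ) : ℝ) : ℂ) +
              (w + w ^ 3) / (1 - w ^ 2) ^ 2 *
                (((inner ℝ x (b i) : ℝ) * (inner ℝ y (b i) : ℝ) : ℝ) : ℂ) -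
              w ^ 2 / (1 - w ^ 2) ^ 2 *
                (((inner ℝ y (b i) : ℝ) * (inner ℝ y (b i) : ℝ) : ℝ) : ℂ)) *
              (mehler w x y * f y) := by
          intro i
          rw [b.norm_eq_one]
          push_cast
          field_simp
          ring
        rw [Finset.sum_congr rfl fun i _ => e i, ← Finset.sum_mul, Finset.sum_sub_distrib,
          Finset.sum_add_distrib, Finset.sum_sub_distrib, ← Finset.mul_sum, ← Finset.mul_sum,
          ← Finset.mul_sum, ← Complex.ofReal_sum, ← Complex.ofReal_sum, ← Complex.ofReal_sum,
          s1, s2, s3, mehlerDeriv, Finset.sum_const, Finset.card_univ, Fintype.card_fin,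
          nsmul_eq_mul]
        field_simp
        ring
    _ = w * kernelInt (mehlerDeriv w) f x := by
        rw [kernelInt, integral_const_mul]

end TestFunctions

/-! ### Action on exponentials, their density, and the semigroup law -/

section Exponentials

variable {d : ℕ}

/-- The Mehler operators map exponentials to exponentials. -/
theorem kernelInt_mehler_exp {w : ℂ} (hw : ‖w‖ < 1) (c : ℂ) (ξ x : EuclideanSpace ℝ (Fin d)) :
    kernelInt (mehler w) (fun y => Complex.exp (c * (inner ℝ ξ y : ℝ))) x =
      Complex.exp (c ^ 2 * (1 - w ^ 2) / 2 * (‖ξ‖ ^ 2 : ℝ)) *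
        Complex.exp (c * w * (inner ℝ ξ x : ℝ)) := by
  have hne := one_sub_sq_ne_zero hw
  have hπ : (Real.pi : ℂ) ≠ 0 := by exact_mod_cast Real.pi_ne_zero
  have hne' : 2 * (Real.pi : ℂ) * (1 - w ^ 2) ≠ 0 := mul_ne_zero (mul_ne_zero two_ne_zero hπ) hne
  set b : ℂ := 1 / (2 * (1 - w ^ 2)) with hb
  have hbre : 0 < b.re := by
    have h2 : (2 * (1 - w ^ 2)).re = 2 * (1 - w ^ 2).re := by
      rw [show (2 : ℂ) = ((2 : ℝ) : ℂ) by norm_num, Complex.re_ofReal_mul]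
    rw [hb, one_div, Complex.inv_re]
    refine div_pos (by rw [h2]; have := re_one_sub_sq_pos hw; positivity)
      (Complex.normSq_pos.2 (mul_ne_zero two_ne_zero hne))
  have hnorm : ∀ y : EuclideanSpace ℝ (Fin d), ((‖y‖ ^ 2 : ℝ) : ℂ) = ∑ i, (y i : ℂ) ^ 2 := by
    intro y
    rw [EuclideanSpace.norm_sq_eq]
    simp
  have hinner : ∀ y z : EuclideanSpace ℝ (Fin d),
      ((inner ℝ y z : ℝ) : ℂ) = ∑ i, (y i : ℂ) * (z i : ℂ) := by
    intro y z
    simp [PiLp.inner_apply, mul_comm]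
  have hG := GaussianFourier.integral_cexp_neg_mul_sum_add hbre
    (fun i => 2 * b * w * (x i : ℂ) + c * (ξ i : ℂ))
  set A : ℂ := (2 * Real.pi * (1 - w ^ 2)) ^ (-(d : ℂ) / 2) with hA
  have h1 : kernelInt (mehler w) (fun y => Complex.exp (c * (inner ℝ ξ y : ℝ))) x =
      A * Complex.exp (-(w ^ 2 * b * (‖x‖ ^ 2 : ℝ))) * ∫ v : Fin d → ℝ,
        Complex.exp (-b * ∑ i, (v i : ℂ) ^ 2 +
          ∑ i, (2 * b * w * (x i : ℂ) + c * (ξ i : ℂ)) * (v i : ℂ)) := by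
    rw [kernelInt, ← (PiLp.volume_preserving_toLp (Fin d)).integral_comp
      (MeasurableEquiv.toLp 2 _).measurableEmbedding, ← integral_const_mul]
    congr 1
    ext v
    rw [mehler, ← hA, mul_assoc, mul_assoc A, ← Complex.exp_add, ← Complex.exp_add]
    congr 2
    rw [hnorm (WithLp.toLp 2 v), hinner, hinner]
    simp only [add_mul, Finset.sum_add_distrib, mul_assoc, ← Finset.mul_sum]
    rw [hb]
    field_simp
    ring
  rw [h1, hG, Fintype.card_fin]
  have h2 : (Real.pi / b : ℂ) = 2 * Real.pi * (1 - w ^ 2) := by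
    rw [hb]
    field_simp
  -- Both complex powers have the same base, so the exponents add and no branch correction appears.
  have h3 : A * (2 * Real.pi * (1 - w ^ 2)) ^ ((d : ℂ) / 2) = 1 := by
    rw [hA, ← Complex.cpow_add _ _ hne']
    ring_nf
    exact Complex.cpow_zero _
  have h4 : (∑ i, (2 * b * w * (x i : ℂ) + c * (ξ i : ℂ)) ^ 2) = (2 * b * w) ^ 2 * (‖x‖ ^ 2 : ℝ) +
      4 * b * w * c * (inner ℝ ξ x : ℝ) + c ^ 2 * (‖ξ‖ ^ 2 : ℝ) := by
    rw [hnorm, hnorm, hinner, Finset.mul_sum, Finset.mul_sum, Finset.mul_sum,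
      ← Finset.sum_add_distrib, ← Finset.sum_add_distrib]
    refine Finset.sum_congr rfl fun i _ => ?_
    ring
  rw [h2, h4, mul_mul_mul_comm, h3, one_mul, ← Complex.exp_add, ← Complex.exp_add]
  congr 1
  rw [hb]
  field_simp
  ring

/-- An integrable function with vanishing Fourier transform vanishes almost everywhere. -/
theorem ae_eq_zero_of_integral_exp_eq_zero {h : EuclideanSpace ℝ (Fin d) → ℂ} (hi : Integrable h)
    (h0 : ∀ ξ : EuclideanSpace ℝ (Fin d),
      ∫ y, Complex.exp (Complex.I * (inner ℝ ξ y : ℝ)) * h y = 0) :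
    ∀ᵐ y, h y = 0 := by
  refine ae_eq_zero_of_integral_contDiff_smul_eq_zero hi.locallyIntegrable fun g hg hgc => ?_
  have hgc' : HasCompactSupport fun x => (g x : ℂ) := hgc.comp_left (g := Complex.ofReal) rfl
  have hg' : ContDiff ℝ ((⊤ : ℕ∞) : WithTop ℕ∞) fun x => (g x : ℂ) := Complex.ofRealCLM.contDiff.comp hg
  let G : SchwartzMap (EuclideanSpace ℝ (Fin d)) ℂ := hgc'.toSchwartzMap hg'
  -- The test function is the Fourier transform of `ψ`; moving that transform onto `h` in `∫ h ψ̂`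
  -- gives `∫ ĥ ψ = 0`.
  let ψ : SchwartzMap (EuclideanSpace ℝ (Fin d)) ℂ := FourierTransform.fourierInv G
  have key := VectorFourier.integral_fourierIntegral_smul_eq_flip (μ := volume) (ν := volume)
    (L := innerₗ (EuclideanSpace ℝ (Fin d))) (f := h) (g := ψ) Real.continuous_fourierChar
    continuous_inner hi ψ.integrable
  have e1 : ∀ ξ, VectorFourier.fourierIntegral Real.fourierChar volume
      (innerₗ (EuclideanSpace ℝ (Fin d))) h ξ = 0 := by
    intro ξ
    -- The rescaling by `-2π` matches the phase of the Fourier character.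
    rw [Real.vector_fourierIntegral_eq_integral_exp_smul, ← h0 ((-2 * Real.pi) • ξ)]
    congr 1
    ext y
    rw [smul_eq_mul, real_inner_smul_left, innerₗ_apply_apply, real_inner_comm, mul_comm Complex.I]
  have e2 : ∀ x, VectorFourier.fourierIntegral Real.fourierChar volume
      (innerₗ (EuclideanSpace ℝ (Fin d))).flip ψ x = g x := by
    intro x
    have h1 : FourierTransform.fourier ψ = G := FourierTransform.fourier_fourierInv_eq G
    have h2 : FourierTransform.fourier ψ x = (g x : ℂ) := by rw [h1]; rfl
    rw [← h2, flip_innerₗ, SchwartzMap.fourier_coe]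
    rfl
  simp only [e1, e2, zero_smul, integral_zero] at key
  rw [key]
  congr 1
  ext x
  rw [Complex.real_smul, smul_eq_mul, mul_comm]

theorem continuous_exp_inner (c : ℂ) (ξ : EuclideanSpace ℝ (Fin d)) :
    Continuous fun y : EuclideanSpace ℝ (Fin d) => Complex.exp (c * (inner ℝ ξ y : ℝ)) := by
  fun_prop

theorem norm_exp_I_mul_inner (ξ y : EuclideanSpace ℝ (Fin d)) :
    ‖Complex.exp (Complex.I * (inner ℝ ξ y : ℝ))‖ = 1 := by
  rw [mul_comm, Complex.norm_exp_ofReal_mul_I]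

theorem memLp_exp_inner (p : ℝ≥0∞) {τ : ℝ} (hτ : 0 < τ) (ξ : EuclideanSpace ℝ (Fin d)) :
    MemLp (fun y => Complex.exp (Complex.I * (inner ℝ ξ y : ℝ))) p (gaussian d τ) := by
  have := isFiniteMeasure_gaussian (d := d) hτ
  exact MemLp.of_bound (continuous_exp_inner _ ξ).aestronglyMeasurable 1
    (Eventually.of_forall fun y => (norm_exp_I_mul_inner ξ y).le)

/-- The exponential `exp (i ξ · y)` as an element of `L²(γ)`. -/
def expLp (ξ : EuclideanSpace ℝ (Fin d)) : Lp ℂ 2 (gaussian d 1) :=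
  (memLp_exp_inner 2 one_pos ξ).toLp _

theorem expLp_ae (ξ : EuclideanSpace ℝ (Fin d)) :
    expLp ξ =ᵐ[volume] fun y => Complex.exp (Complex.I * (inner ℝ ξ y : ℝ)) :=
  ae_gaussian (d := d) one_pos ▸ MemLp.coeFn_toLp _

theorem inner_expLp (h : Lp ℂ 2 (gaussian d 1)) (ξ : EuclideanSpace ℝ (Fin d)) :
    inner ℂ (expLp ξ) h =
      ∫ y, Complex.exp (Complex.I * (inner ℝ (-ξ) y : ℝ)) * h y ∂gaussian d 1 := by
  rw [L2.inner_def]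
  refine integral_congr_ae ?_
  have : expLp ξ =ᵐ[gaussian d 1] _ := MemLp.coeFn_toLp _
  filter_upwards [this] with y hy
  rw [hy, RCLike.inner_apply, mul_comm, ← Complex.exp_conj, map_mul, Complex.conj_I,
    Complex.conj_ofReal, inner_neg_left]
  push_cast
  ring_nf

/-- The inner products are, up to the sign of the frequency, the Fourier transform of `h` times the
Gaussian density. This product is integrable because `γ` is finite, and the density never vanishes.
-/
theorem eq_zero_of_inner_expLp (h : Lp ℂ 2 (gaussian d 1))
    (h0 : ∀ ξ : EuclideanSpace ℝ (Fin d), inner ℂ (expLp ξ) h = 0) : h = 0 := by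
  have hπ := Real.pi_pos
  have := isFiniteMeasure_gaussian (d := d) one_pos
  have hint : Integrable h (gaussian d 1) :=
    (Lp.memLp h).integrable (by norm_num)
  let ρ : EuclideanSpace ℝ (Fin d) → ℝ := fun x =>
    (2 * Real.pi * 1) ^ (-(d : ℝ) / 2) * Real.exp (-‖x‖ ^ 2 / (2 * 1))
  have hρ : ∀ x, 0 < ρ x := fun x => by positivity
  have hρm : Measurable fun x => ENNReal.ofReal (ρ x) := by fun_prop
  have hconv : ∀ g : EuclideanSpace ℝ (Fin d) → ℂ, ∫ y, g y ∂gaussian d 1 = ∫ y, ρ y • g y := by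
    intro g
    rw [gaussian, integral_withDensity_eq_integral_toReal_smul hρm
      (Eventually.of_forall fun _ => ENNReal.ofReal_lt_top)]
    congr 1
    ext y
    rw [ENNReal.toReal_ofReal (hρ y).le]
  have hint' : Integrable fun y => ρ y • h y := by
    have hint2 : Integrable h (volume.withDensity fun x => ENNReal.ofReal (ρ x)) := hint
    rw [integrable_withDensity_iff_integrable_smul' hρm
      (Eventually.of_forall fun _ => ENNReal.ofReal_lt_top)] at hint2
    refine hint2.congr (Eventually.of_forall fun y => ?_)
    simp only
    rw [ENNReal.toReal_ofReal (hρ y).le]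
  have hz := ae_eq_zero_of_integral_exp_eq_zero hint' fun ξ => by
    have h1 := h0 (-ξ)
    rw [inner_expLp, neg_neg, hconv] at h1
    rw [← h1]
    congr 1
    ext y
    rw [mul_smul_comm]
  refine Lp_ext_volume one_pos ?_
  have hzero : (0 : Lp ℂ 2 (gaussian d 1)) =ᵐ[volume] 0 :=
    ae_gaussian (d := d) one_pos ▸ Lp.coeFn_zero ℂ 2 (gaussian d 1)
  filter_upwards [hz, hzero] with y hy hy0
  rw [hy0, Pi.zero_apply]
  exact (smul_eq_zero.1 hy).resolve_left (hρ y).ne'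

theorem dense_span_expLp :
    Dense (Submodule.span ℂ (Set.range (expLp (d := d))) : Set (Lp ℂ 2 (gaussian d 1))) := by
  rw [Submodule.dense_iff_topologicalClosure_eq_top, Submodule.topologicalClosure_eq_top_iff,
    Submodule.eq_bot_iff]
  intro h hh
  refine eq_zero_of_inner_expLp h fun ξ => ?_
  exact (Submodule.mem_orthogonal _ _).1 hh _ (Submodule.subset_span ⟨ξ, rfl⟩)

theorem norm_mul_lt_one {v w : ℂ} (hv : ‖v‖ < 1) (hw : ‖w‖ < 1) : ‖w * v‖ < 1 := by
  rw [norm_mul]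
  nlinarith [norm_nonneg v, norm_nonneg w]

theorem toReal_two_mul_one : (2 : ℝ≥0∞).toReal * 1 = 2 := by simp

theorem kernelOp_mehler_expLp_ae {w : ℂ} (hw : ‖w‖ < 1) (ξ : EuclideanSpace ℝ (Fin d)) :
    kernelOp 2 2 1 1 (mehler w) (expLp ξ) =ᵐ[volume] fun x =>
      Complex.exp (Complex.I ^ 2 * (1 - w ^ 2) / 2 * (‖ξ‖ ^ 2 : ℝ)) *
        Complex.exp (Complex.I * w * (inner ℝ ξ x : ℝ)) := by
  refine (kernelOp_mehler_apply (by norm_num) (by norm_num) toReal_two_mul_one toReal_two_mul_one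
    hw _).trans ?_
  rw [kernelInt_congr _ (expLp_ae ξ)]
  exact Eventually.of_forall fun x => kernelInt_mehler_exp hw _ _ _

/-- On exponentials the law reduces to `(1 - v²) + v² (1 - w²) = 1 - (w v)²`. After the first
operator the frequency `i v` is complex, which is why `kernelInt_mehler_exp` allows an arbitrary
complex `c`. -/
theorem kernelOp_mehler_mul_two {v w : ℂ} (hv : ‖v‖ < 1) (hw : ‖w‖ < 1) :
    kernelOp (d := d) 2 2 1 1 (mehler (w * v)) =
      (kernelOp 2 2 1 1 (mehler w)).comp (kernelOp 2 2 1 1 (mehler v)) := by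
  refine ContinuousLinearMap.ext_on dense_span_expLp ?_
  rintro _ ⟨ξ, rfl⟩
  refine Lp_ext_volume one_pos ?_
  refine (kernelOp_mehler_expLp_ae (norm_mul_lt_one hv hw) ξ).trans ?_
  refine EventuallyEq.trans ?_ (kernelOp_mehler_apply (by norm_num) (by norm_num)
    toReal_two_mul_one toReal_two_mul_one hw _).symm
  change _ =ᵐ[volume] kernelInt (mehler w) (kernelOp 2 2 1 1 (mehler v) (expLp ξ))
  rw [kernelInt_congr _ (kernelOp_mehler_expLp_ae hv ξ)]
  refine Eventually.of_forall fun x => ?_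
  have e : kernelInt (mehler w) (fun y =>
      Complex.exp (Complex.I ^ 2 * (1 - v ^ 2) / 2 * (‖ξ‖ ^ 2 : ℝ)) *
        Complex.exp (Complex.I * v * (inner ℝ ξ y : ℝ))) x =
      Complex.exp (Complex.I ^ 2 * (1 - v ^ 2) / 2 * (‖ξ‖ ^ 2 : ℝ)) *
        kernelInt (mehler w) (fun y => Complex.exp (Complex.I * v * (inner ℝ ξ y : ℝ))) x := by
    rw [kernelInt, kernelInt, ← integral_const_mul]
    congr 1
    ext y
    ring
  rw [e, kernelInt_mehler_exp hw]
  simp only [← Complex.exp_add]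
  congr 1
  ring

theorem dense_testFunctions (d : ℕ) {p : ℝ≥0∞} [Fact (1 ≤ p)] (hp : p ≠ ⊤) {τ : ℝ} (hτ : 0 < τ) :
    Dense {f : Lp ℂ p (gaussian d τ) | ∃ g : EuclideanSpace ℝ (Fin d) → ℂ,
      ContDiff ℝ 2 g ∧ HasCompactSupport g ∧ f =ᵐ[gaussian d τ] g} := by
  have := isFiniteMeasure_gaussian (d := d) hτ
  refine (Lp.dense_hasCompactSupport_contDiff (μ := gaussian d τ) (F := ℂ) hp).mono ?_
  rintro f ⟨g, hfg, hg, hg'⟩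
  exact ⟨g, contDiff_infty.1 hg' 2, hg, hfg⟩

theorem memLp_of_continuous_of_hasCompactSupport (p : ℝ≥0∞) {τ : ℝ} (hτ : 0 < τ)
    {g : EuclideanSpace ℝ (Fin d) → ℂ} (hg : Continuous g) (hc : HasCompactSupport g) :
    MemLp g p (gaussian d τ) := by
  have := isFiniteMeasure_gaussian (d := d) hτ
  exact hg.memLp_of_hasCompactSupport hc

theorem exists_mem_ouTestGraph {p : ℝ≥0∞} {τ : ℝ} {f : EuclideanSpace ℝ (Fin d) → ℂ} (hf : ContDiff ℝ 2 f)
    (hfc : HasCompactSupport f) (hτ : 0 < τ) {F : Lp ℂ p (gaussian d τ)}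
    (hF : F =ᵐ[gaussian d τ] f) : ∃ G, (F, G) ∈ ouTestGraph d p τ :=
  have hm := memLp_of_continuous_of_hasCompactSupport p hτ (continuous_ouExpr hf)
    (hasCompactSupport_ouExpr hf hfc)
  ⟨hm.toLp _, f, hf, hfc, hF, hm.coeFn_toLp⟩

/-- The semigroup law for the Mehler operators on `L^p(γ_τ)`. -/
theorem kernelOp_mehler_mul {p : ℝ≥0∞} [Fact (1 ≤ p)] (hp : p ≠ ⊤) {τ : ℝ}
    (hτ : p.toReal * τ = 2) {v w : ℂ} (hv : ‖v‖ < 1) (hw : ‖w‖ < 1) :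
    kernelOp (d := d) p p τ τ (mehler (w * v)) =
      (kernelOp p p τ τ (mehler w)).comp (kernelOp p p τ τ (mehler v)) := by
  refine ContinuousLinearMap.ext_on
    ((dense_testFunctions d hp (tau_pos hτ)).mono Submodule.subset_span) ?_
  rintro f ⟨g, hg, hgc, hfg⟩
  rw [EventuallyEq, ae_gaussian (tau_pos hτ)] at hfg
  have hg2 := memLp_of_continuous_of_hasCompactSupport 2 one_pos hg.continuous hgc
  have hF : hg2.toLp g =ᵐ[volume] g := ae_gaussian (d := d) one_pos ▸ hg2.coeFn_toLp
  have hfF : f =ᵐ[volume] hg2.toLp g := EventuallyEq.trans hfg hF.symm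
  -- The operators on `L^p(γ_τ)` and `L²(γ)` share their kernel, so they agree on functions common
  -- to both spaces; this transports the law from `L²` on the dense set of test functions.
  have step : ∀ {u : ℂ}, ‖u‖ < 1 → ∀ {f : Lp ℂ p (gaussian d τ)} {F : Lp ℂ 2 (gaussian d 1)},
      f =ᵐ[volume] F →
      kernelOp p p τ τ (mehler u) f =ᵐ[volume] kernelOp 2 2 1 1 (mehler u) F := by
    intro u hu f F h
    refine (kernelOp_mehler_apply hp hp hτ hτ hu f).trans ?_
    rw [kernelInt_congr _ h]
    exact (kernelOp_mehler_apply (by norm_num) (by norm_num) toReal_two_mul_one toReal_two_mul_one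
      hu F).symm
  refine Lp_ext_volume (tau_pos hτ) ?_
  refine (step (norm_mul_lt_one hv hw) hfF).trans ?_
  rw [kernelOp_mehler_mul_two hv hw]
  exact (step hw (step hv hfF)).symm

end Exponentials

/-- Dominated convergence in `L^p`. -/
theorem tendsto_eLpNorm_sub_of_dominated {α ι : Type*} [MeasurableSpace α] {μ : Measure α}
    {p : ℝ≥0∞} (hp0 : p ≠ 0) (hp : p ≠ ⊤) {l : Filter ι} [l.IsCountablyGenerated]
    {F : ι → α → ℂ} {f : α → ℂ} {g : α → ℝ} (hg : MemLp g p μ)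
    (hm : ∀ᶠ n in l, AEStronglyMeasurable (F n) μ) (hf : AEStronglyMeasurable f μ)
    (hb : ∀ᶠ n in l, ∀ᵐ x ∂μ, ‖F n x - f x‖ ≤ g x)
    (ht : ∀ᵐ x ∂μ, Tendsto (fun n => F n x) l (𝓝 (f x))) :
    Tendsto (fun n => eLpNorm (F n - f) p μ) l (𝓝 0) := by
  have hpp : 0 < p.toReal := ENNReal.toReal_pos hp0 hp
  simp_rw [eLpNorm_eq_lintegral_rpow_enorm_toReal hp0 hp]
  have key : Tendsto (fun n => ∫⁻ x, ‖(F n - f) x‖ₑ ^ p.toReal ∂μ) l (𝓝 (∫⁻ _, 0 ∂μ)) := by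
    refine tendsto_lintegral_filter_of_dominated_convergence' (fun x => ‖g x‖ₑ ^ p.toReal) ?_ ?_ ?_ ?_
    · filter_upwards [hm] with n hn
      exact (hn.sub hf).enorm.pow_const _
    · filter_upwards [hb] with n hn
      filter_upwards [hn] with x hx
      refine ENNReal.rpow_le_rpow ?_ hpp.le
      rw [Pi.sub_apply, enorm_le_iff_norm_le]
      exact hx.trans (le_abs_self _)
    · exact ((eLpNorm_lt_top_iff_lintegral_rpow_enorm_lt_top hp0 hp).1 hg.2).ne
    · filter_upwards [ht] with x hx
      have h1 : Tendsto (fun n => ‖(F n - f) x‖ₑ) l (𝓝 0) := by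
        have := (hx.sub_const (f x)).enorm
        simpa using this
      have := ((ENNReal.continuous_rpow_const (y := p.toReal)).tendsto 0).comp h1
      simpa [Function.comp_def, ENNReal.zero_rpow_of_pos hpp] using this
  have := ((ENNReal.continuous_rpow_const (y := 1 / p.toReal)).tendsto _).comp key
  simpa [Function.comp_def, ENNReal.zero_rpow_of_pos, hpp] using this

/-! ### The Ornstein-Uhlenbeck semigroup on `L^p(γ_τ)` with `p τ = 2` -/

section Semigroup

variable {d : ℕ}

/-- **Mehler's formula**. -/
theorem kernelInt_mehler_ofReal {w : ℝ} (hw : |w| < 1) (f : EuclideanSpace ℝ (Fin d) → ℂ)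
    (x : EuclideanSpace ℝ (Fin d)) :
    kernelInt (mehler (w : ℂ)) f x =
      ∫ u, mehler 0 0 u * f (w • x + Real.sqrt (1 - w ^ 2) • u) := by
  have hπ := Real.pi_pos
  have hw2 : 0 < 1 - w ^ 2 := by
    have := (sq_lt_one_iff_abs_lt_one w).2 hw
    linarith
  set s := Real.sqrt (1 - w ^ 2) with hs
  have hs0 : 0 < s := Real.sqrt_pos.2 hw2
  have hs2 : s ^ 2 = 1 - w ^ 2 := Real.sq_sqrt hw2.le
  have hs2' : (1 : ℂ) - (w : ℂ) ^ 2 = ((s ^ 2 : ℝ) : ℂ) := by rw [hs2]; push_cast; rfl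
  -- Under `y = w x + s u` with `s² = 1 - w²` the kernel becomes the standard Gaussian density
  -- `mehler 0 0 u`, up to the Jacobian factor `s^d`.
  have hker : ∀ u : EuclideanSpace ℝ (Fin d),
      mehler (w : ℂ) x (w • x + s • u) = ((s ^ d : ℝ) : ℂ)⁻¹ * mehler 0 0 u := by
    intro u
    have e1 : ‖w • x + s • u‖ ^ 2 = w ^ 2 * ‖x‖ ^ 2 + 2 * w * s * inner ℝ x u + s ^ 2 * ‖u‖ ^ 2 := by
      rw [norm_add_sq_real, norm_smul, norm_smul, real_inner_smul_left, real_inner_smul_right,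
        mul_pow, mul_pow, Real.norm_eq_abs, Real.norm_eq_abs, sq_abs, sq_abs]
      ring
    have e2 : inner ℝ x (w • x + s • u) = w * ‖x‖ ^ 2 + s * inner ℝ x u := by
      rw [inner_add_right, real_inner_smul_right, real_inner_smul_right, real_inner_self_eq_norm_sq]
    have e3 : (2 * Real.pi * (1 - (w : ℂ) ^ 2)) ^ (-(d : ℂ) / 2) =
        (2 * Real.pi * (1 - (0 : ℂ) ^ 2)) ^ (-(d : ℂ) / 2) * ((s ^ d : ℝ) : ℂ)⁻¹ := by
      have h1 : (2 * Real.pi * (1 - (0 : ℂ) ^ 2)) = ((2 * Real.pi : ℝ) : ℂ) := by push_cast; ring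
      have h2 : (2 * Real.pi * (1 - (w : ℂ) ^ 2)) = ((2 * Real.pi : ℝ) : ℂ) * ((s ^ 2 : ℝ) : ℂ) := by
        rw [hs2']; push_cast; ring
      rw [h1, h2, Complex.mul_cpow_ofReal_nonneg (by positivity) (by positivity)]
      congr 1
      have h3 : (-(d : ℂ) / 2) = ((-(d : ℝ) / 2 : ℝ) : ℂ) := by push_cast; rfl
      rw [h3, ← Complex.ofReal_cpow (by positivity), ← Complex.ofReal_inv]
      congr 1
      rw [← Real.rpow_natCast s 2, ← Real.rpow_mul hs0.le, ← Real.rpow_natCast s d,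
        ← Real.rpow_neg hs0.le]
      congr 1
      push_cast
      ring
    rw [mehler, mehler, e1, e2, e3, mul_assoc, mul_left_comm]
    congr 3
    rw [hs2']
    have hs0' : (s : ℂ) ≠ 0 := by exact_mod_cast hs0.ne'
    have hs2'' : (w : ℂ) ^ 2 = 1 - (s : ℂ) ^ 2 := by
      push_cast at hs2'
      rw [← hs2']; ring
    push_cast
    simp only [norm_zero, inner_zero_left]
    field_simp
    push_cast
    ring
  have h1 : kernelInt (mehler (w : ℂ)) f x =
      ∫ y, mehler (w : ℂ) x (w • x + y) * f (w • x + y) :=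
    (integral_add_left_eq_self (fun y => mehler (w : ℂ) x y * f y) (w • x)).symm
  have h2 := Measure.integral_comp_smul (volume : Measure (EuclideanSpace ℝ (Fin d)))
    (fun y => mehler (w : ℂ) x (w • x + y) * f (w • x + y)) s
  rw [finrank_euclideanSpace, Fintype.card_fin, ← h1] at h2
  simp only [hker, mul_assoc] at h2
  rw [integral_const_mul, abs_of_pos (by positivity), Complex.real_smul, Complex.ofReal_inv] at h2
  have h3 : ((s ^ d : ℝ) : ℂ)⁻¹ ≠ 0 := inv_ne_zero (by exact_mod_cast (pow_pos hs0 d).ne')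
  exact (mul_left_cancel₀ h3 h2).symm

theorem norm_zero_lt_one : ‖(0 : ℂ)‖ < 1 := by simp

theorem integrable_mehler_zero : Integrable (mehler (d := d) 0 0) := by
  have := isFiniteMeasure_gaussian (d := d) one_pos
  obtain ⟨c, M, _, _, R, hc, hM, _, _, hR, _, h⟩ := exists_gaussianBound_mehler d norm_zero_lt_one
  have h1 := (h 0 (Metric.mem_ball_self hR)).2.1.integrable hc (p := 2) (by norm_num) (by norm_num)
    toReal_two_mul_one (memLp_const (1 : ℂ)) 0
  simpa using h1

theorem integral_mehler_zero : ∫ u, mehler (d := d) 0 0 u = 1 := by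
  have := kernelInt_mehler_exp norm_zero_lt_one 0 (0 : EuclideanSpace ℝ (Fin d)) 0
  simpa [kernelInt] using this

/-- The Ornstein-Uhlenbeck semigroup on `L^p(γ_τ)`, in complex time. -/
def ouSemigroup (d : ℕ) (p : ℝ≥0∞) [Fact (1 ≤ p)] (τ : ℝ) (z : ℂ) :
    Lp ℂ p (gaussian d τ) →L[ℂ] Lp ℂ p (gaussian d τ) :=
  if z = 0 then ContinuousLinearMap.id ℂ _ else kernelOp p p τ τ (mehler (Complex.exp (-z)))

variable {p : ℝ≥0∞} [Fact (1 ≤ p)] {τ : ℝ}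

theorem ouSemigroup_zero : ouSemigroup d p τ 0 = ContinuousLinearMap.id ℂ _ := if_pos rfl

theorem ouSemigroup_of_re_pos {z : ℂ} (hz : 0 < z.re) :
    ouSemigroup d p τ z = kernelOp p p τ τ (mehler (Complex.exp (-z))) := by
  refine if_neg ?_
  rintro rfl
  simp at hz

theorem ouSemigroup_apply (hp : p ≠ ⊤) (hτ : p.toReal * τ = 2) {z : ℂ} (hz : 0 < z.re)
    (f : Lp ℂ p (gaussian d τ)) :
    ouSemigroup d p τ z f =ᵐ[volume] kernelInt (mehler (Complex.exp (-z))) f := by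
  rw [ouSemigroup_of_re_pos hz]
  exact kernelOp_mehler_apply hp hp hτ hτ (norm_exp_neg_lt_one hz) f

theorem hasDerivAt_ouSemigroup (hp : p ≠ ⊤) (hτ : p.toReal * τ = 2) {z : ℂ} (hz : 0 < z.re) :
    HasDerivAt (ouSemigroup d p τ)
      ((-Complex.exp (-z)) • kernelOp p p τ τ (mehlerDeriv (Complex.exp (-z)))) z := by
  have h1 : HasDerivAt (fun z => Complex.exp (-z)) (-Complex.exp (-z)) z := by
    simpa using (hasDerivAt_neg z).cexp
  have h2 := HasDerivAt.scomp (h := fun z => Complex.exp (-z)) z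
    (hasDerivAt_kernelOp_mehler (d := d) hp hp hτ hτ (norm_exp_neg_lt_one hz)) h1
  refine h2.congr_of_eventuallyEq ?_
  filter_upwards [isOpen_re_pos.mem_nhds hz] with u hu
  exact ouSemigroup_of_re_pos hu

theorem ouSemigroup_add (hp : p ≠ ⊤) (hτ : p.toReal * τ = 2) {z w : ℂ} (hz : 0 < z.re)
    (hw : 0 < w.re) :
    ouSemigroup d p τ (z + w) = (ouSemigroup d p τ z).comp (ouSemigroup d p τ w) := by
  rw [ouSemigroup_of_re_pos (z := z + w) (by rw [Complex.add_re]; positivity),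
    ouSemigroup_of_re_pos hz, ouSemigroup_of_re_pos hw, neg_add, Complex.exp_add]
  exact kernelOp_mehler_mul hp hτ (norm_exp_neg_lt_one hw) (norm_exp_neg_lt_one hz)

theorem sector_subset_re_pos {θ : ℝ} (hθ : θ ≤ Real.pi / 2) {z : ℂ} (hz : z ∈ sector θ) :
    0 < z.re := mem_sector_pi_div_two.1 ⟨hz.1, hz.2.trans_le hθ⟩

theorem exists_norm_ouSemigroup_le (d : ℕ) (hp : p ≠ ⊤) (hτ : p.toReal * τ = 2) {θ : ℝ}
    (hθ : 0 < θ) (hθ2 : θ < Real.pi / 2) :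
    ∃ B : ℝ, ∀ z ∈ sector θ, ‖ouSemigroup d p τ z‖ ≤ B := by
  obtain ⟨B, hB⟩ := exists_norm_kernelOp_mehler_le d hp hτ hθ hθ2
  refine ⟨B, fun z hz => ?_⟩
  rw [ouSemigroup_of_re_pos (sector_subset_re_pos hθ2.le hz)]
  exact hB z hz

theorem exists_norm_ouSemigroup_ofReal_le (d : ℕ) (hp : p ≠ ⊤) (hτ : p.toReal * τ = 2) :
    ∃ M : ℝ, ∀ t : ℝ, 0 ≤ t → ‖ouSemigroup d p τ t‖ ≤ M := by
  have hπ := Real.pi_pos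
  obtain ⟨B, hB⟩ := exists_norm_ouSemigroup_le d hp hτ (θ := Real.pi / 4) (by linarith)
    (by linarith)
  -- The sector omits `0`, where the operator is the identity.
  refine ⟨max B 1, fun t ht => ?_⟩
  rcases ht.eq_or_lt with rfl | ht
  · rw [Complex.ofReal_zero, ouSemigroup_zero]
    exact ContinuousLinearMap.norm_id_le.trans (le_max_right _ _)
  · exact (hB t (ofReal_mem_sector (by linarith) ht)).trans (le_max_left _ _)

/-- With `w = exp (-z)` one has `∂_z = -w ∂_w`, so this is the Kolmogorov equation
`kernelInt_mehlerDeriv` rewritten in complex time. -/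
theorem hasDerivAt_ouSemigroup_apply (hp : p ≠ ⊤) (hτ : p.toReal * τ = 2) {z : ℂ} (hz : 0 < z.re)
    {q : Lp ℂ p (gaussian d τ) × Lp ℂ p (gaussian d τ)} (hq : q ∈ ouTestGraph d p τ) :
    HasDerivAt (fun z => ouSemigroup d p τ z q.1) (-ouSemigroup d p τ z q.2) z := by
  obtain ⟨f, hf, hfc, h1, h2⟩ := hq
  rw [EventuallyEq, ae_gaussian (tau_pos hτ)] at h1 h2
  have hw := norm_exp_neg_lt_one hz
  have h3 := (hasDerivAt_ouSemigroup (d := d) hp hτ hz).clm_apply (hasDerivAt_const z q.1)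
  refine h3.congr_deriv ?_
  rw [map_zero, add_zero]
  have e : ((-Complex.exp (-z)) • kernelOp p p τ τ (mehlerDeriv (Complex.exp (-z)))) q.1 =
    (-Complex.exp (-z)) • kernelOp p p τ τ (mehlerDeriv (Complex.exp (-z))) q.1 := rfl
  rw [e]
  refine Lp_ext_volume (tau_pos hτ) ?_
  have h4 : ((-Complex.exp (-z)) • kernelOp p p τ τ (mehlerDeriv (Complex.exp (-z))) q.1 :
      Lp ℂ p (gaussian d τ)) =ᵐ[volume]
      (-Complex.exp (-z)) • ⇑(kernelOp p p τ τ (mehlerDeriv (Complex.exp (-z))) q.1) :=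
    ae_gaussian (d := d) (tau_pos hτ) ▸ Lp.coeFn_smul _ _
  have h5 : (-ouSemigroup d p τ z q.2 : Lp ℂ p (gaussian d τ)) =ᵐ[volume]
      -⇑(ouSemigroup d p τ z q.2) :=
    ae_gaussian (d := d) (tau_pos hτ) ▸ Lp.coeFn_neg _
  filter_upwards [h4, h5, kernelOp_mehlerDeriv_apply hp hp hτ hτ hw q.1,
    ouSemigroup_apply hp hτ hz q.2] with x h4 h5 h6 h7
  rw [h4, h5, Pi.smul_apply, Pi.neg_apply, h6, h7, kernelInt_congr _ h1, kernelInt_congr _ h2,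
    ← kernelInt_mehlerDeriv hf hfc hw, smul_eq_mul, neg_mul]

/-- Strong continuity in real time on test functions. -/
theorem tendsto_ouSemigroup_ofReal (hp : p ≠ ⊤) (hτ : p.toReal * τ = 2)
    {f : EuclideanSpace ℝ (Fin d) → ℂ} (hf : Continuous f) (hfc : HasCompactSupport f)
    {F : Lp ℂ p (gaussian d τ)} (hF : F =ᵐ[gaussian d τ] f) :
    Tendsto (fun t : ℝ => ouSemigroup d p τ t F) (𝓝[>] 0) (𝓝 F) := by
  have hfin := isFiniteMeasure_gaussian (d := d) (tau_pos hτ)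
  have hp0 : p ≠ 0 := (zero_lt_one.trans_le (Fact.out : 1 ≤ p)).ne'
  rw [EventuallyEq, ae_gaussian (tau_pos hτ)] at hF
  obtain ⟨C, hC⟩ := hf.bounded_above_of_compact_support hfc
  -- At real times `f` is evaluated at genuine points of space. Dominated convergence then applies
  -- twice: under the Gaussian integral for fixed `x`, and in `L^p`, where constants dominate
  -- because the measure is finite.
  have hker : ∀ t : ℝ, 0 < t → ∀ x, kernelInt (mehler (Complex.exp (-t))) f x =
      ∫ u, mehler 0 0 u * f (Real.exp (-t) • x + Real.sqrt (1 - Real.exp (-t) ^ 2) • u) := by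
    intro t ht x
    rw [← kernelInt_mehler_ofReal, Complex.ofReal_exp, Complex.ofReal_neg]
    rw [Real.abs_exp]
    exact Real.exp_lt_one_iff.2 (by linarith)
  have hae : ∀ t : ℝ, 0 < t → (ouSemigroup d p τ t F) =ᵐ[gaussian d τ]
      kernelInt (mehler (Complex.exp (-t))) f := by
    intro t ht
    rw [EventuallyEq, ae_gaussian (tau_pos hτ)]
    rw [← kernelInt_congr _ hF]
    exact ouSemigroup_apply hp hτ (by simpa using ht) F
  rw [Lp.tendsto_Lp_iff_tendsto_eLpNorm']
  have hbound : ∀ x (t : ℝ), 0 < t → ‖kernelInt (mehler (Complex.exp (-t))) f x‖ ≤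
      (∫ u, ‖mehler (d := d) 0 0 u‖) * C := by
    intro x t ht
    rw [hker t ht, ← integral_mul_const]
    refine norm_integral_le_of_norm_le (integrable_mehler_zero.norm.mul_const C)
      (Eventually.of_forall fun u => ?_)
    rw [norm_mul]
    exact mul_le_mul_of_nonneg_left (hC _) (norm_nonneg _)
  have key : Tendsto (fun t : ℝ => eLpNorm (kernelInt (mehler (Complex.exp (-t))) f - f) p
      (gaussian d τ)) (𝓝[>] 0) (𝓝 0) := by
    refine tendsto_eLpNorm_sub_of_dominated hp0 hp
      (memLp_const ((∫ u, ‖mehler (d := d) 0 0 u‖) * C + C)) ?_ hf.aestronglyMeasurable ?_ ?_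
    · filter_upwards [self_mem_nhdsWithin] with t ht
      exact (Lp.aestronglyMeasurable (ouSemigroup d p τ t F)).congr (hae t ht)
    · filter_upwards [self_mem_nhdsWithin] with t ht
      exact Eventually.of_forall fun x =>
        (norm_sub_le _ _).trans (add_le_add (hbound x t ht) (hC x))
    · refine Eventually.of_forall fun x => ?_
      have h1 : Tendsto (fun t : ℝ => ∫ u, mehler 0 0 u *
          f (Real.exp (-t) • x + Real.sqrt (1 - Real.exp (-t) ^ 2) • u)) (𝓝[>] 0)
          (𝓝 (∫ u, mehler (d := d) 0 0 u * f x)) := by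
        refine tendsto_integral_filter_of_dominated_convergence
          (fun u => ‖mehler (d := d) 0 0 u‖ * C) ?_ ?_ (integrable_mehler_zero.norm.mul_const C) ?_
        · refine Eventually.of_forall fun t => Continuous.aestronglyMeasurable ?_
          exact (continuous_mehler_right 0 0).mul (hf.comp (by fun_prop))
        · refine Eventually.of_forall fun t => Eventually.of_forall fun u => ?_
          rw [norm_mul]
          exact mul_le_mul_of_nonneg_left (hC _) (norm_nonneg _)
        · refine Eventually.of_forall fun u => ?_
          have hcont : Continuous fun t : ℝ => mehler 0 0 u *
              f (Real.exp (-t) • x + Real.sqrt (1 - Real.exp (-t) ^ 2) • u) := by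
            refine continuous_const.mul (hf.comp ?_)
            fun_prop
          have := hcont.tendsto 0
          simp only [neg_zero, Real.exp_zero, one_pow, sub_self, Real.sqrt_zero, zero_smul,
            one_smul, add_zero] at this
          exact this.mono_left nhdsWithin_le_nhds
      rw [integral_mul_const, integral_mehler_zero, one_mul] at h1
      refine h1.congr' ?_
      filter_upwards [self_mem_nhdsWithin] with t ht
      exact (hker t ht x).symm
  refine key.congr' ?_
  filter_upwards [self_mem_nhdsWithin] with t ht
  refine eLpNorm_congr_ae ?_
  have hF' : F =ᵐ[gaussian d τ] f := by rwa [EventuallyEq, ae_gaussian (tau_pos hτ)]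
  exact ((hae t ht).sub hF').symm

theorem mem_sector_iff {θ : ℝ} (hθ : 0 < θ) (hθ2 : θ < Real.pi / 2) {z : ℂ} :
    z ∈ sector θ ↔ Real.cos θ * ‖z‖ - z.re < 0 := by
  have hπ := Real.pi_pos
  rcases eq_or_ne z 0 with rfl | hz
  · simp [sector]
  have h1 : z.re = ‖z‖ * Real.cos |Complex.arg z| := by
    rw [Real.cos_abs, Complex.cos_arg hz]
    field_simp [norm_ne_zero_iff.2 hz]
  have hz0 : 0 < ‖z‖ := norm_pos_iff.2 hz
  rw [h1]
  constructor
  · rintro ⟨-, h⟩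
    have := Real.cos_lt_cos_of_nonneg_of_le_pi (abs_nonneg _) (by linarith) h
    nlinarith
  · intro h
    refine ⟨hz, ?_⟩
    by_contra! h'
    have := Real.cos_le_cos_of_nonneg_of_le_pi hθ.le (Complex.abs_arg_le_pi z) h'
    nlinarith

/-- For `θ < π/2` the sector is a strict sublevel set of the convex function `cos θ |z| - Re z`.
Convexity is what the mean value inequality on the sector needs. -/
theorem convex_sector {θ : ℝ} (hθ : 0 < θ) (hθ2 : θ < Real.pi / 2) : Convex ℝ (sector θ) := by
  have hk : 0 ≤ Real.cos θ := (Real.cos_pos_of_mem_Ioo ⟨by linarith, hθ2⟩).le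
  have e : sector θ = {z ∈ Set.univ | Real.cos θ * ‖z‖ - z.re < 0} := by
    ext z
    simpa using mem_sector_iff hθ hθ2
  rw [e]
  refine ConvexOn.convex_lt (f := fun z : ℂ => Real.cos θ * ‖z‖ - z.re) ?_ 0
  exact ((convexOn_univ_norm (E := ℂ)).smul hk).sub (Complex.reLm.concaveOn convex_univ)

/-- The orbit of a test function has derivative `-T(z) L f`, bounded on the sector, so it is
Lipschitz there. Comparing with a real time `t` and letting `t` decrease to `0` extends real-time
continuity to the sector. -/
theorem tendsto_ouSemigroup_sector_of_mem (hp : p ≠ ⊤) (hτ : p.toReal * τ = 2) {θ : ℝ}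
    (hθ : 0 < θ) (hθ2 : θ < Real.pi / 2)
    {q : Lp ℂ p (gaussian d τ) × Lp ℂ p (gaussian d τ)} (hq : q ∈ ouTestGraph d p τ) :
    Tendsto (fun z => ouSemigroup d p τ z q.1) (𝓝[sector θ] 0) (𝓝 q.1) := by
  obtain ⟨B, hB⟩ := exists_norm_ouSemigroup_le d hp hτ hθ hθ2
  have h1 : ∀ z ∈ sector θ, ∀ t : ℝ, 0 < t → ‖ouSemigroup d p τ z q.1 - ouSemigroup d p τ t q.1‖ ≤
      B * ‖q.2‖ * ‖z - t‖ := by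
    intro z hz t ht
    refine (convex_sector hθ hθ2).norm_image_sub_le_of_norm_hasDerivWithin_le
      (f := fun z => ouSemigroup d p τ z q.1) (f' := fun z => -ouSemigroup d p τ z q.2)
      (fun u hu => (hasDerivAt_ouSemigroup_apply hp hτ
        (sector_subset_re_pos hθ2.le hu) hq).hasDerivWithinAt)
      (fun u hu => ?_) (ofReal_mem_sector hθ ht) hz
    rw [norm_neg]
    exact ContinuousLinearMap.le_of_opNorm_le _ (hB u hu) _
  have hreal : Tendsto (fun t : ℝ => ouSemigroup d p τ t q.1) (𝓝[>] 0) (𝓝 q.1) := by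
    obtain ⟨f, hf, hfc, h, -⟩ := hq
    exact tendsto_ouSemigroup_ofReal hp hτ hf.continuous hfc h
  have h2 : ∀ z ∈ sector θ, ‖ouSemigroup d p τ z q.1 - q.1‖ ≤ B * ‖q.2‖ * ‖z‖ := by
    intro z hz
    have l1 : Tendsto (fun t : ℝ => ‖ouSemigroup d p τ z q.1 - ouSemigroup d p τ t q.1‖) (𝓝[>] 0)
        (𝓝 ‖ouSemigroup d p τ z q.1 - q.1‖) := (hreal.const_sub _).norm
    have l2 : Tendsto (fun t : ℝ => B * ‖q.2‖ * ‖z - t‖) (𝓝[>] 0) (𝓝 (B * ‖q.2‖ * ‖z‖)) := by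
      have hc : Continuous fun t : ℝ => B * ‖q.2‖ * ‖z - t‖ := by fun_prop
      have := hc.tendsto 0
      simp only [Complex.ofReal_zero, sub_zero] at this
      exact this.mono_left nhdsWithin_le_nhds
    refine le_of_tendsto_of_tendsto l1 l2 ?_
    filter_upwards [self_mem_nhdsWithin] with t ht using h1 z hz t ht
  rw [tendsto_iff_norm_sub_tendsto_zero]
  have l3 : Tendsto (fun z : ℂ => B * ‖q.2‖ * ‖z‖) (𝓝[sector θ] 0) (𝓝 0) := by
    have hc : Continuous fun z : ℂ => B * ‖q.2‖ * ‖z‖ := by fun_prop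
    have := hc.tendsto 0
    simp only [norm_zero, mul_zero] at this
    exact this.mono_left nhdsWithin_le_nhds
  refine squeeze_zero' (Eventually.of_forall fun _ => norm_nonneg _) ?_ l3
  filter_upwards [self_mem_nhdsWithin] with z hz using h2 z hz

theorem tendsto_ouSemigroup_sector (hp : p ≠ ⊤) (hτ : p.toReal * τ = 2) {θ : ℝ}
    (hθ : 0 < θ) (hθ2 : θ < Real.pi / 2) (f : Lp ℂ p (gaussian d τ)) :
    Tendsto (fun z => ouSemigroup d p τ z f) (𝓝[sector θ] 0) (𝓝 f) := by
  obtain ⟨B, hB⟩ := exists_norm_ouSemigroup_le d hp hτ hθ hθ2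
  rw [Metric.tendsto_nhds]
  intro ε hε
  have hB1 : 0 < |B| + 2 := by positivity
  -- Three errors, with weights `|B|`, `1` and `1`, must sum to at most `ε`; hence the tolerance `ε
  -- / (|B| + 2)`.
  obtain ⟨g, ⟨φ, hφ, hφc, hg⟩, hfg⟩ := (dense_testFunctions d hp (tau_pos hτ)).exists_dist_lt f
    (ε := ε / (|B| + 2)) (by positivity)
  obtain ⟨G, hG⟩ := exists_mem_ouTestGraph hφ hφc (tau_pos hτ) hg
  have h1 := Metric.tendsto_nhds.1 (tendsto_ouSemigroup_sector_of_mem hp hτ hθ hθ2 hG)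
    (ε / (|B| + 2)) (by positivity)
  filter_upwards [h1, self_mem_nhdsWithin] with z hz hzs
  rw [dist_eq_norm] at hz hfg ⊢
  have e : ouSemigroup d p τ z f - f =
      ouSemigroup d p τ z (f - g) + (ouSemigroup d p τ z g - g) - (f - g) := by
    rw [map_sub]; abel
  have h2 : ‖ouSemigroup d p τ z (f - g)‖ ≤ |B| * ‖f - g‖ :=
    ContinuousLinearMap.le_of_opNorm_le _ ((hB z hzs).trans (le_abs_self B)) _
  rw [e]
  calc _ ≤ ‖ouSemigroup d p τ z (f - g)‖ + ‖ouSemigroup d p τ z g - g‖ + ‖f - g‖ :=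
        (norm_sub_le _ _).trans (add_le_add_left (norm_add_le _ _) _)
    _ ≤ |B| * ‖f - g‖ + ‖ouSemigroup d p τ z g - g‖ + ‖f - g‖ := by gcongr
    _ < |B| * (ε / (|B| + 2)) + ε / (|B| + 2) + ε / (|B| + 2) := by
        have := mul_le_mul_of_nonneg_left hfg.le (abs_nonneg B)
        linarith
    _ = ε := by field_simp; ring

theorem isHolomorphicSemigroup_ouSemigroup (hp : p ≠ ⊤) (hτ : p.toReal * τ = 2) :
    IsHolomorphicSemigroup (Real.pi / 2) (ouSemigroup d p τ) where
  map_zero := ouSemigroup_zero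
  map_add _ hz _ hw := ouSemigroup_add hp hτ (mem_sector_pi_div_two.1 hz)
    (mem_sector_pi_div_two.1 hw)
  holomorphic _ hz := (hasDerivAt_ouSemigroup hp hτ
    (mem_sector_pi_div_two.1 hz)).differentiableAt.differentiableWithinAt
  strongly_continuous _ h1 h2 f := tendsto_ouSemigroup_sector hp hτ h1 h2 f

/-- The derivative `-T(t) L f` at `t > 0` converges to `-L f` by strong continuity, and a function
continuous at `0` whose derivative has a limit is differentiable there from the right. -/
theorem mem_generatorGraph_ouSemigroup (hp : p ≠ ⊤) (hτ : p.toReal * τ = 2)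
    {q : Lp ℂ p (gaussian d τ) × Lp ℂ p (gaussian d τ)} (hq : q ∈ ouTestGraph d p τ) :
    (q.1, -q.2) ∈ generatorGraph (ouSemigroup d p τ) := by
  have h := isHolomorphicSemigroup_ouSemigroup (d := d) hp hτ
  rw [h.mem_generatorGraph_iff]
  have hd : ∀ t : ℝ, 0 < t → HasDerivAt (fun s : ℝ => ouSemigroup d p τ s q.1)
      (-ouSemigroup d p τ t q.2) t := fun t ht =>
    (hasDerivAt_ouSemigroup_apply (z := t) hp hτ (by simpa using ht) hq).comp_complex_ofReal
  refine hasDerivWithinAt_Ici_of_tendsto_deriv (s := Set.Ioi 0)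
    (fun t ht => (hd t ht).differentiableAt.differentiableWithinAt) ?_ self_mem_nhdsWithin ?_
  · have := h.tendsto_real q.1
    rw [ContinuousWithinAt]
    simpa [h.map_zero] using this
  · refine (h.tendsto_real q.2).neg.congr' ?_
    filter_upwards [self_mem_nhdsWithin] with t ht
    exact (hd t ht).deriv.symm

end Semigroup

/-! ### Test functions form a core of the generator on `L²(γ)` -/

section Core

variable {d : ℕ}

theorem fderiv_comp_smul_mul_exp {g : EuclideanSpace ℝ (Fin d) → ℂ} (hg : ContDiff ℝ 1 g) (s : ℝ)
    (ξ v y : EuclideanSpace ℝ (Fin d)) :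
    fderiv ℝ (fun y => g (s • y) * Complex.exp (Complex.I * (inner ℝ ξ y : ℝ))) y v =
      (s * fderiv ℝ g (s • y) v + Complex.I * (inner ℝ ξ v : ℝ) * g (s • y)) *
        Complex.exp (Complex.I * (inner ℝ ξ y : ℝ)) := by
  have h1 : HasFDerivAt (fun y : EuclideanSpace ℝ (Fin d) =>
      Complex.exp (Complex.I * (inner ℝ ξ y : ℝ))) _ y :=
    ((Complex.ofRealCLM.hasFDerivAt.comp y (innerSL ℝ ξ).hasFDerivAt).const_mul Complex.I).cexp
  have h2 : HasFDerivAt (fun y : EuclideanSpace ℝ (Fin d) => g (s • y)) _ y :=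
    (hg.differentiable (by norm_num) (s • y)).hasFDerivAt.comp y
      ((hasFDerivAt_id y).const_smul s)
  rw [show fderiv ℝ _ y = _ from (h2.fun_mul h1).fderiv]
  simp
  ring

/-- The value of `L` on a dilated function times an exponential. -/
def ouCutoff (g : EuclideanSpace ℝ (Fin d) → ℂ) (ξ : EuclideanSpace ℝ (Fin d)) (s : ℝ)
    (x : EuclideanSpace ℝ (Fin d)) : ℂ :=
  ∑ i, let b := EuclideanSpace.basisFun (Fin d) ℝ i
    (-(s * (s * fderiv ℝ (fun y => fderiv ℝ g y b) (s • x) b +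
        Complex.I * (inner ℝ ξ b : ℝ) * fderiv ℝ g (s • x) b) +
      Complex.I * (inner ℝ ξ b : ℝ) * (s * fderiv ℝ g (s • x) b +
        Complex.I * (inner ℝ ξ b : ℝ) * g (s • x))) +
      (inner ℝ x b : ℝ) * (s * fderiv ℝ g (s • x) b + Complex.I * (inner ℝ ξ b : ℝ) * g (s • x))) *
    Complex.exp (Complex.I * (inner ℝ ξ x : ℝ))

theorem contDiff_comp_smul_mul_exp {g : EuclideanSpace ℝ (Fin d) → ℂ} (hg : ContDiff ℝ 2 g) (s : ℝ)
    (ξ : EuclideanSpace ℝ (Fin d)) :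
    ContDiff ℝ 2 fun y => g (s • y) * Complex.exp (Complex.I * (inner ℝ ξ y : ℝ)) := by
  refine (hg.comp (contDiff_const_smul s)).mul (ContDiff.cexp (contDiff_const.mul ?_))
  exact Complex.ofRealCLM.contDiff.comp (innerSL ℝ ξ).contDiff

theorem ouExpr_comp_smul_mul_exp {g : EuclideanSpace ℝ (Fin d) → ℂ} (hg : ContDiff ℝ 2 g) (s : ℝ)
    (ξ x : EuclideanSpace ℝ (Fin d)) :
    ouExpr (fun y => g (s • y) * Complex.exp (Complex.I * (inner ℝ ξ y : ℝ))) x =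
      ouCutoff g ξ s x := by
  rw [ouExpr_eq_sum (contDiff_comp_smul_mul_exp hg s ξ), ouCutoff]
  refine Finset.sum_congr rfl fun i _ => ?_
  set b := EuclideanSpace.basisFun (Fin d) ℝ i
  have hg1 := hg.of_le (m := 1) (by norm_num)
  have hg2 := contDiff_fderiv_apply hg b
  simp only [fderiv_comp_smul_mul_exp hg1]
  have h3 : ContDiff ℝ 1 fun z => s * fderiv ℝ g z b + Complex.I * (inner ℝ ξ b : ℝ) * g z :=
    (contDiff_const.mul hg2).add (contDiff_const.mul hg1)
  have h4 := fderiv_comp_smul_mul_exp h3 s ξ b x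
  have h5 : HasFDerivAt (fun z => s * fderiv ℝ g z b + Complex.I * (inner ℝ ξ b : ℝ) * g z) _
      (s • x) := ((hg2.differentiable (by norm_num) (s • x)).hasFDerivAt.const_mul (s : ℂ)).add
    ((hg1.differentiable (by norm_num) (s • x)).hasFDerivAt.const_mul _)
  rw [h4, show fderiv ℝ _ (s • x) = _ from h5.fderiv]
  simp
  ring

theorem continuous_ouCutoff {g : EuclideanSpace ℝ (Fin d) → ℂ} (hg : ContDiff ℝ 2 g)
    (ξ : EuclideanSpace ℝ (Fin d)) :
    Continuous fun q : ℝ × EuclideanSpace ℝ (Fin d) => ouCutoff g ξ q.1 q.2 := by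
  have h1 : ∀ b, Continuous fun y => fderiv ℝ g y b := fun b =>
    (contDiff_fderiv_apply hg b).continuous
  have h2 : ∀ b, Continuous fun y => fderiv ℝ (fun y => fderiv ℝ g y b) y b := fun b =>
    ((contDiff_fderiv_apply hg b).continuous_fderiv (by norm_num)).clm_apply continuous_const
  have h0 := hg.continuous
  refine continuous_finsetSum _ fun i _ => ?_
  have hs : Continuous fun q : ℝ × EuclideanSpace ℝ (Fin d) => q.1 • q.2 := by fun_prop
  have h1' := (h1 (EuclideanSpace.basisFun (Fin d) ℝ i)).comp hs
  have h2' := (h2 (EuclideanSpace.basisFun (Fin d) ℝ i)).comp hs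
  have h0' := h0.comp hs
  simp only [Function.comp_def] at h0' h1' h2'
  fun_prop

/-- Only the drift carries an unbounded factor, linear in `x`; everything else is bounded through
`g` and its derivatives. Uniformity in `|s| ≤ 1` provides the dominating function when the cutoff is
removed. -/
theorem exists_norm_ouCutoff_le {g : EuclideanSpace ℝ (Fin d) → ℂ} (hg : ContDiff ℝ 2 g)
    (hgc : HasCompactSupport g) (ξ : EuclideanSpace ℝ (Fin d)) :
    ∃ C, 0 ≤ C ∧ ∀ s : ℝ, |s| ≤ 1 → ∀ x, ‖ouCutoff g ξ s x‖ ≤ C * (1 + ‖x‖) := by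
  obtain ⟨A, hA⟩ := hg.continuous.bounded_above_of_compact_support hgc
  have h1 : ∀ b, ∃ B, ∀ y, ‖fderiv ℝ g y b‖ ≤ B := fun b =>
    (contDiff_fderiv_apply hg b).continuous.bounded_above_of_compact_support
      (hgc.fderiv_apply ℝ b)
  have h2 : ∀ b, ∃ B, ∀ y, ‖fderiv ℝ (fun y => fderiv ℝ g y b) y b‖ ≤ B := fun b =>
    (((contDiff_fderiv_apply hg b).continuous_fderiv (by norm_num)).clm_apply
      continuous_const).bounded_above_of_compact_support
      ((hgc.fderiv_apply ℝ b).fderiv_apply ℝ b)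
  choose B hB using h1
  choose D hD using h2
  have hA0 : 0 ≤ A := (norm_nonneg _).trans (hA 0)
  have hB0 : ∀ b, 0 ≤ B b := fun b => (norm_nonneg _).trans (hB b 0)
  have hD0 : ∀ b, 0 ≤ D b := fun b => (norm_nonneg _).trans (hD b 0)
  let u : Fin d → EuclideanSpace ℝ (Fin d) := fun i => EuclideanSpace.basisFun (Fin d) ℝ i
  have hu : ∀ i, ‖u i‖ = 1 := fun i => (EuclideanSpace.basisFun (Fin d) ℝ).norm_eq_one i
  have hinner : ∀ x i, |inner ℝ x (u i)| ≤ ‖x‖ := fun x i => by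
    have := abs_real_inner_le_norm x (u i)
    rwa [hu, mul_one] at this
  refine ⟨∑ i, (D (u i) + ‖ξ‖ * B (u i) + ‖ξ‖ * (B (u i) + ‖ξ‖ * A) + (B (u i) + ‖ξ‖ * A)),
    Finset.sum_nonneg fun i _ => ?_, fun s hs x => ?_⟩
  · have := hB0 (u i)
    have := hD0 (u i)
    positivity
  rw [Finset.sum_mul]
  refine norm_sum_le_of_le _ fun i _ => ?_
  have hs' : ‖(s : ℂ)‖ ≤ 1 := by rwa [Complex.norm_real]
  have hI : ∀ x, ‖((inner ℝ x (u i) : ℝ) : ℂ)‖ ≤ ‖x‖ := fun x => by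
    rw [Complex.norm_real]; exact hinner x i
  have hIξ : ‖Complex.I * ((inner ℝ ξ (u i) : ℝ) : ℂ)‖ ≤ ‖ξ‖ := by
    rw [norm_mul, Complex.norm_I, one_mul]; exact hI ξ
  have hss : ∀ {z : ℂ} {r : ℝ}, ‖z‖ ≤ r → ‖(s : ℂ) * z‖ ≤ r := fun {z r} h => by
    rw [norm_mul]
    exact (mul_le_of_le_one_left (norm_nonneg _) hs').trans h
  have hmul : ∀ {z w : ℂ} {r t : ℝ}, ‖z‖ ≤ r → ‖w‖ ≤ t → ‖z * w‖ ≤ r * t := fun {z w r t} h h' => by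
    rw [norm_mul]
    exact mul_le_mul h h' (norm_nonneg _) ((norm_nonneg _).trans h)
  have e1 : ‖(s : ℂ) * fderiv ℝ g (s • x) (u i) +
      Complex.I * (inner ℝ ξ (u i) : ℝ) * g (s • x)‖ ≤ B (u i) + ‖ξ‖ * A :=
    norm_add_le_of_le (hss (hB _ _)) (hmul hIξ (hA _))
  have e2 : ‖(s : ℂ) * (s * fderiv ℝ (fun y => fderiv ℝ g y (u i)) (s • x) (u i) +
      Complex.I * (inner ℝ ξ (u i) : ℝ) * fderiv ℝ g (s • x) (u i))‖ ≤
      D (u i) + ‖ξ‖ * B (u i) :=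
    hss (norm_add_le_of_le (hss (hD _ _)) (hmul hIξ (hB _ _)))
  have e3 := norm_add_le_of_le ((norm_neg _).trans_le (norm_add_le_of_le e2 (hmul hIξ e1)))
    (hmul (hI x) e1)
  have hP : 0 ≤ D (u i) + ‖ξ‖ * B (u i) + ‖ξ‖ * (B (u i) + ‖ξ‖ * A) := by
    have := hB0 (u i)
    have := hD0 (u i)
    positivity
  have hQ : 0 ≤ B (u i) + ‖ξ‖ * A := (norm_nonneg _).trans e1
  simp only
  rw [norm_mul, norm_exp_I_mul_inner, mul_one]
  refine e3.trans ?_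
  nlinarith [norm_nonneg x, mul_nonneg hP (norm_nonneg x)]

theorem memLp_exp_sq_norm (d : ℕ) :
    MemLp (fun x : EuclideanSpace ℝ (Fin d) => Real.exp (‖x‖ ^ 2 / 8)) 2 (gaussian d 1) := by
  refine (memLp_two_iff_integrable_sq (Continuous.aestronglyMeasurable (by fun_prop))).2 ?_
  rw [gaussian, integrable_withDensity_iff (by fun_prop) (by simp)]
  refine ((integrable_exp_neg_mul_sq_norm (d := d) (b := 1 / 4) (by norm_num)).const_mul
    ((2 * Real.pi * 1) ^ (-(d : ℝ) / 2))).congr (Eventually.of_forall fun x => ?_)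
  have hπ := Real.pi_pos
  simp only
  rw [ENNReal.toReal_ofReal (by positivity), ← Real.exp_nat_mul, mul_left_comm, ← Real.exp_add]
  congr 2
  ring

theorem mem_closure_ouTestGraph {p : ℝ≥0∞} [Fact (1 ≤ p)] (hp0 : p ≠ 0) (hp : p ≠ ⊤) {τ : ℝ}
    {U : ℕ → EuclideanSpace ℝ (Fin d) → ℂ} {u v : EuclideanSpace ℝ (Fin d) → ℂ}
    {G H : EuclideanSpace ℝ (Fin d) → ℝ} (hU : ∀ n, ContDiff ℝ 2 (U n))
    (hUc : ∀ n, HasCompactSupport (U n)) (hτ : 0 < τ) (hu : MemLp u p (gaussian d τ))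
    (hv : MemLp v p (gaussian d τ)) (hG : MemLp G p (gaussian d τ)) (hH : MemLp H p (gaussian d τ))
    (hUG : ∀ n x, ‖U n x - u x‖ ≤ G x) (hUH : ∀ n x, ‖ouExpr (U n) x - v x‖ ≤ H x)
    (hlim : ∀ x, Tendsto (fun n => U n x) atTop (𝓝 (u x)))
    (hlim' : ∀ x, Tendsto (fun n => ouExpr (U n) x) atTop (𝓝 (v x))) :
    (hu.toLp u, hv.toLp v) ∈ closure (ouTestGraph d p τ) := by
  have hm : ∀ n, MemLp (U n) p (gaussian d τ) := fun n =>
    memLp_of_continuous_of_hasCompactSupport p hτ (hU n).continuous (hUc n)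
  have hm' : ∀ n, MemLp (ouExpr (U n)) p (gaussian d τ) := fun n =>
    memLp_of_continuous_of_hasCompactSupport p hτ (continuous_ouExpr (hU n))
      (hasCompactSupport_ouExpr (hU n) (hUc n))
  refine mem_closure_of_tendsto (b := atTop) (f := fun n => ((hm n).toLp _, (hm' n).toLp _))
    (Tendsto.prodMk_nhds ?_ ?_) (Eventually.of_forall fun n =>
      ⟨U n, hU n, hUc n, (hm n).coeFn_toLp, (hm' n).coeFn_toLp⟩)
  · rw [Lp.tendsto_Lp_iff_tendsto_eLpNorm'']
    exact tendsto_eLpNorm_sub_of_dominated hp0 hp hG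
      (Eventually.of_forall fun n => (hm n).1) hu.1
      (Eventually.of_forall fun n => Eventually.of_forall (hUG n)) (Eventually.of_forall hlim)
  · rw [Lp.tendsto_Lp_iff_tendsto_eLpNorm'']
    exact tendsto_eLpNorm_sub_of_dominated hp0 hp hH
      (Eventually.of_forall fun n => (hm' n).1) hv.1
      (Eventually.of_forall fun n => Eventually.of_forall (hUH n)) (Eventually.of_forall hlim')

theorem exists_cutoff (d : ℕ) : ∃ g : EuclideanSpace ℝ (Fin d) → ℂ, ContDiff ℝ 2 g ∧
    HasCompactSupport g ∧ g 0 = 1 ∧ ∀ x, ‖g x‖ ≤ 1 := by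
  let χ : ContDiffBump (0 : EuclideanSpace ℝ (Fin d)) := default
  refine ⟨fun x => (χ x : ℂ), Complex.ofRealCLM.contDiff.comp χ.contDiff,
    χ.hasCompactSupport.comp_left (g := Complex.ofReal) rfl, ?_, fun x => ?_⟩
  · simp [χ.eventuallyEq_one.eq_of_nhds]
  · rw [Complex.norm_real, Real.norm_of_nonneg χ.nonneg]
    exact χ.le_one

/-- The exponentials lie in the domain of the closure of `L` on test functions. -/
theorem exists_expLp_mem_closure (ξ : EuclideanSpace ℝ (Fin d)) :
    ∃ v, (expLp ξ, v) ∈ closure (ouTestGraph d 2 1) := by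
  obtain ⟨g, hg, hgc, hg0, hg1⟩ := exists_cutoff d
  have := isFiniteMeasure_gaussian (d := d) one_pos
  obtain ⟨C, hC0, hC⟩ := exists_norm_ouCutoff_le hg hgc ξ
  let E : EuclideanSpace ℝ (Fin d) → ℂ := fun y => Complex.exp (Complex.I * (inner ℝ ξ y : ℝ))
  let U : ℝ → EuclideanSpace ℝ (Fin d) → ℂ := fun s y => g (s • y) * E y
  have hU : ∀ s, ContDiff ℝ 2 (U s) := fun s => contDiff_comp_smul_mul_exp hg s ξ
  have hUc : ∀ s, s ≠ 0 → HasCompactSupport (U s) := fun s hs =>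
    (hgc.comp_homeomorph (Homeomorph.smulOfNeZero s hs)).mul_right
  have hUL : ∀ s, ouExpr (U s) = ouCutoff g ξ s := fun s =>
    funext fun x => ouExpr_comp_smul_mul_exp hg s ξ x
  have hcont : Continuous fun q : ℝ × EuclideanSpace ℝ (Fin d) => ouCutoff g ξ q.1 q.2 :=
    continuous_ouCutoff hg ξ
  have hcs : ∀ s, Continuous (ouCutoff g ξ s) := fun s =>
    hcont.comp (f := fun x => (s, x)) (Continuous.prodMk_right s)
  have hexp : ∀ x : EuclideanSpace ℝ (Fin d), 1 + ‖x‖ ≤ 3 * Real.exp (‖x‖ ^ 2 / 8) := fun x => by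
    nlinarith [Real.add_one_le_exp (‖x‖ ^ 2 / 8), sq_nonneg (‖x‖ - 2)]
  have hC' : ∀ s : ℝ, |s| ≤ 1 → ∀ x, ‖ouCutoff g ξ s x‖ ≤ C * 3 * Real.exp (‖x‖ ^ 2 / 8) :=
    fun s hs x => (hC s hs x).trans (by
      rw [mul_assoc]
      exact mul_le_mul_of_nonneg_left (hexp x) hC0)
  have hdom := (memLp_exp_sq_norm d).const_mul (C * 3)
  have hmem : ∀ s : ℝ, |s| ≤ 1 → MemLp (ouCutoff g ξ s) 2 (gaussian d 1) := fun s hs =>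
    hdom.mono' (hcs s).aestronglyMeasurable (Eventually.of_forall (hC' s hs))
  -- At `s = 0` the cutoff is constantly `g 0 = 1`, so `ouCutoff g ξ 0` is `L` applied to the
  -- exponential itself.
  have hm0 := hmem 0 (by simp)
  let a : ℕ → ℝ := fun n => ((n : ℝ) + 1)⁻¹
  have ha0 : ∀ n, a n ≠ 0 := fun n => inv_ne_zero (by positivity)
  have ha1 : ∀ n, |a n| ≤ 1 := fun n => by
    rw [abs_of_nonneg (by positivity)]
    exact inv_le_one_of_one_le₀ (by simp)
  have hal : Tendsto a atTop (𝓝 0) := by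
    simpa [a, one_div] using tendsto_one_div_add_atTop_nhds_zero_nat (𝕜 := ℝ)
  have hm := memLp_exp_inner 2 one_pos ξ
  refine ⟨hm0.toLp _, mem_closure_ouTestGraph (by norm_num) (by norm_num) (fun n => hU (a n))
    (fun n => hUc _ (ha0 n)) one_pos hm hm0 (memLp_const 2) (hdom.add hdom) (fun n x => ?_)
    (fun n x => ?_) (fun x => ?_) fun x => ?_⟩
  · refine (norm_sub_le _ _).trans ?_
    rw [norm_mul, norm_exp_I_mul_inner, mul_one]
    linarith [hg1 (a n • x)]
  · rw [hUL]
    exact (norm_sub_le _ _).trans (add_le_add (hC' _ (ha1 n) x) (hC' 0 (by simp) x))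
  · have hc : Continuous fun s : ℝ => U s x :=
      (hg.continuous.comp (continuous_id.smul continuous_const)).mul continuous_const
    have := (hc.tendsto 0).comp hal
    simpa only [U, E, zero_smul, hg0, one_mul, Function.comp_def] using this
  · simp only [hUL]
    have hc : Continuous fun s : ℝ => ouCutoff g ξ s x :=
      hcont.comp (f := fun s => (s, x)) (Continuous.prodMk_left x)
    exact (hc.tendsto 0).comp hal

theorem ouExpr_add {f g : EuclideanSpace ℝ (Fin d) → ℂ} (hf : ContDiff ℝ 2 f)
    (hg : ContDiff ℝ 2 g) : ouExpr (f + g) = ouExpr f + ouExpr g := by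
  ext x
  rw [Pi.add_apply, ouExpr, ouExpr, ouExpr, ContDiffAt.laplacian_add hf.contDiffAt hg.contDiffAt,
    fderiv_add (hf.differentiable (by norm_num) x) (hg.differentiable (by norm_num) x), add_apply]
  ring

theorem ouExpr_const_smul {f : EuclideanSpace ℝ (Fin d) → ℂ} (hf : ContDiff ℝ 2 f) (c : ℂ) :
    ouExpr (c • f) = c • ouExpr f := by
  ext x
  have hd := hf.differentiable (by norm_num)
  have h1 : ∀ x v, fderiv ℝ (fun y => c * f y) x v = c * fderiv ℝ f x v := fun x v => by
    rw [fderiv_const_mul (hd x)]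
    rfl
  have h2 : ∀ x v, fderiv ℝ (fun y => c * fderiv ℝ f y v) x v =
      c * fderiv ℝ (fun y => fderiv ℝ f y v) x v := fun x v => by
    rw [fderiv_const_mul ((contDiff_fderiv_apply hf v).differentiable (by norm_num) x)]
    rfl
  have e : c • f = fun y => c * f y := rfl
  have hc : ContDiff ℝ 2 fun y => c * f y := contDiff_const.mul hf
  rw [Pi.smul_apply, e, ouExpr_eq_sum hc, ouExpr_eq_sum hf, smul_eq_mul, Finset.mul_sum]
  refine Finset.sum_congr rfl fun i _ => ?_
  simp only [h1, h2]
  ring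

/-- The graph of `L` on test functions as a subspace. -/
def ouTestSubmodule (d : ℕ) (p : ℝ≥0∞) [Fact (1 ≤ p)] (τ : ℝ) :
    Submodule ℂ (Lp ℂ p (gaussian d τ) × Lp ℂ p (gaussian d τ)) where
  carrier := ouTestGraph d p τ
  zero_mem' := ⟨0, contDiff_const, HasCompactSupport.zero, Lp.coeFn_zero _ _ _, by
    have : ouExpr (0 : EuclideanSpace ℝ (Fin d) → ℂ) = 0 := by
      simpa using ouExpr_const_smul (contDiff_const (c := (0 : ℂ))) (0 : ℂ)
    rw [this]
    exact Lp.coeFn_zero _ _ _⟩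
  add_mem' := by
    rintro a b ⟨f, hf, hfc, h1, h2⟩ ⟨g, hg, hgc, h3, h4⟩
    refine ⟨f + g, hf.add hg, hfc.add hgc, (Lp.coeFn_add _ _).trans (h1.add h3), ?_⟩
    rw [ouExpr_add hf hg]
    exact (Lp.coeFn_add _ _).trans (h2.add h4)
  smul_mem' := by
    rintro c a ⟨f, hf, hfc, h1, h2⟩
    refine ⟨c • f, hf.const_smul c, hfc.smul_left (f := fun _ => c), (Lp.coeFn_smul _ _).trans
      (h1.const_smul c), ?_⟩
    rw [ouExpr_const_smul hf]
    exact (Lp.coeFn_smul _ _).trans (h2.const_smul c)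

/-- This invariance keeps the orbit of an exponential inside the domain of the closure, where
orthogonality to the range of `1 + L` can be used at every time. -/
theorem exists_ouSemigroup_expLp {t : ℝ} (ht : 0 < t) (ξ : EuclideanSpace ℝ (Fin d)) :
    ∃ c : ℂ, ouSemigroup d 2 1 t (expLp ξ) = c • expLp (Real.exp (-t) • ξ) := by
  have htre : 0 < (t : ℂ).re := by simpa using ht
  refine ⟨Complex.exp (Complex.I ^ 2 * (1 - Complex.exp (-t) ^ 2) / 2 * (‖ξ‖ ^ 2 : ℝ)),
    Lp_ext_volume one_pos ?_⟩
  have hs (c : ℂ) (F : Lp ℂ 2 (gaussian d 1)) : (c • F : Lp ℂ 2 (gaussian d 1)) =ᵐ[volume] c • ⇑F :=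
    ae_gaussian (d := d) one_pos ▸ Lp.coeFn_smul _ _
  rw [ouSemigroup_of_re_pos htre]
  refine (kernelOp_mehler_expLp_ae (norm_exp_neg_lt_one htre) ξ).trans ?_
  refine EventuallyEq.symm ((hs _ _).trans ?_)
  filter_upwards [expLp_ae (Real.exp (-t) • ξ)] with x hx
  rw [Pi.smul_apply, hx, smul_eq_mul, real_inner_smul_left]
  push_cast
  ring_nf

/-- The operator `1 + L` on test functions has dense range in `L²(γ)`. -/
theorem dense_image_add_ouTestGraph (d : ℕ) :
    Dense ((fun q => q.1 + q.2) '' ouTestGraph d 2 1) := by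
  set T := ouSemigroup d 2 1 with hTdef
  have hT : IsHolomorphicSemigroup (Real.pi / 2) T :=
    isHolomorphicSemigroup_ouSemigroup (by norm_num) toReal_two_mul_one
  obtain ⟨M, hM⟩ := exists_norm_ouSemigroup_ofReal_le (p := 2) (τ := 1) d (by norm_num)
    toReal_two_mul_one
  have hgen : ∀ q ∈ closure (ouTestGraph d 2 1), (q.1, -q.2) ∈ generatorGraph T := by
    have hcl : IsClosed {q : Lp ℂ 2 (gaussian d 1) × Lp ℂ 2 (gaussian d 1) |
        (q.1, -q.2) ∈ generatorGraph T} :=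
      (hT.isClosed_generatorGraph hM).preimage (by fun_prop)
    intro q hq
    exact closure_minimal (fun q hq => mem_generatorGraph_ouSemigroup (by norm_num)
      toReal_two_mul_one hq) hcl hq
  let K : Submodule ℂ (Lp ℂ 2 (gaussian d 1)) := (ouTestSubmodule d 2 1).map
    (LinearMap.fst ℂ _ _ + LinearMap.snd ℂ _ _)
  change Dense (K : Set (Lp ℂ 2 (gaussian d 1)))
  rw [Submodule.dense_iff_topologicalClosure_eq_top, Submodule.topologicalClosure_eq_top_iff,
    Submodule.eq_bot_iff]
  intro h hh
  -- Orthogonality to the range of `1 + L` passes to the closure, which contains the exponentials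
  -- although they lack compact support.
  have horth : ∀ q ∈ closure (ouTestGraph d 2 1), inner ℂ h (q.1 + q.2) = 0 := by
    have hcl : IsClosed {q : Lp ℂ 2 (gaussian d 1) × Lp ℂ 2 (gaussian d 1) |
        inner ℂ h (q.1 + q.2) = 0} := isClosed_eq (by fun_prop) continuous_const
    intro q hq
    refine closure_minimal (fun q hq => ?_) hcl hq
    exact (Submodule.mem_orthogonal' _ _).1 hh _ ⟨q, hq, rfl⟩
  have hsmul : ∀ (c : ℂ) (q), q ∈ closure (ouTestGraph d 2 1) →
      c • q ∈ closure (ouTestGraph d 2 1) := fun c q hq =>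
    (ouTestSubmodule d 2 1).topologicalClosure.smul_mem c hq
  refine eq_zero_of_inner_expLp h fun ξ => ?_
  obtain ⟨v, hv⟩ := exists_expLp_mem_closure ξ
  have hG := hgen _ hv
  -- `T t (expLp ξ)` has an image `w` under the closure of `L`. Uniqueness of the generator's value
  -- gives `T t (-v) = -w`, and `h` is orthogonal to `T t (expLp ξ) + w`.
  have hstep : ∀ t : ℝ, 0 ≤ t → inner ℂ h (T t (-v)) = inner ℂ h (T t (expLp ξ)) := by
    intro t ht
    have hw : ∃ w, (T t (expLp ξ), w) ∈ closure (ouTestGraph d 2 1) := by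
      rcases ht.eq_or_lt with rfl | ht
      · exact ⟨v, by simpa [hT.map_zero] using hv⟩
      obtain ⟨w, hw⟩ := exists_expLp_mem_closure (Real.exp (-t) • ξ)
      obtain ⟨c, hc⟩ := exists_ouSemigroup_expLp ht ξ
      exact ⟨c • w, hc ▸ hsmul c _ hw⟩
    obtain ⟨w, hw⟩ := hw
    have h1 : (T t (expLp ξ), T t (-v)) ∈ generatorGraph T := by
      rcases ht.eq_or_lt with rfl | ht
      · simpa [hT.map_zero] using hG
      · exact hT.map_mem_generatorGraph hG (by simpa using ht)
    have h2 : T t (-v) = -w := tendsto_nhds_unique h1 (hgen _ hw)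
    have h3 := horth _ hw
    rw [inner_add_right] at h3
    rw [h2, inner_neg_right]
    exact (eq_neg_of_add_eq_zero_left h3).symm
  -- By `hstep`, `⟨h, T t e_ξ⟩` is its own derivative, so the factor `exp (-t)` makes it constant;
  -- boundedness of the semigroup then forces it to vanish.
  have hψd : ∀ t : ℝ, 0 ≤ t → HasDerivWithinAt
      (fun t : ℝ => (Real.exp (-t) : ℂ) * inner ℂ h (T t (expLp ξ))) 0 (Set.Ici t) t := by
    intro t ht
    have h1 : HasDerivWithinAt (fun t : ℝ => inner ℂ h (T t (expLp ξ)))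
        (inner ℂ h (T t (-v))) (Set.Ici t) t :=
      ((innerSL ℂ h).restrictScalars ℝ).hasFDerivAt.comp_hasDerivWithinAt t
        (hT.hasDerivWithinAt_real hG ht)
    have h2 : HasDerivWithinAt (fun t : ℝ => (Real.exp (-t) : ℂ)) _ (Set.Ici t) t :=
      ((hasDerivAt_neg t).exp.ofReal_comp).hasDerivWithinAt
    refine (h2.fun_mul h1).congr_deriv ?_
    rw [hstep t ht]
    push_cast
    ring
  have hconst : ∀ t : ℝ, 0 ≤ t →
      (Real.exp (-t) : ℂ) * inner ℂ h (T t (expLp ξ)) = inner ℂ h (expLp ξ) := by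
    intro t ht
    have hc : ContinuousOn (fun t : ℝ => (Real.exp (-t) : ℂ) * inner ℂ h (T t (expLp ξ)))
        (Set.Icc 0 t) := by
      have h1 := (hT.continuousOn_real (expLp ξ)).mono (t := Set.Icc 0 t) Set.Icc_subset_Ici_self
      have h2 : ContinuousOn (fun t : ℝ => inner ℂ h (T t (expLp ξ))) (Set.Icc 0 t) :=
        (innerSL ℂ h).continuous.comp_continuousOn h1
      exact ContinuousOn.mul (Continuous.continuousOn (by fun_prop)) h2
    have := constant_of_has_deriv_right_zero hc (fun s hs => hψd s hs.1) t ⟨ht, le_rfl⟩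
    simpa [hT.map_zero] using this
  have hbound : ∀ t : ℝ, 0 ≤ t → ‖(inner ℂ h (expLp ξ) : ℂ)‖ ≤
      Real.exp (-t) * (‖h‖ * (M * ‖expLp ξ‖)) := by
    intro t ht
    rw [← hconst t ht, norm_mul, Complex.norm_real, Real.norm_of_nonneg (Real.exp_pos _).le]
    refine mul_le_mul_of_nonneg_left ((norm_inner_le_norm _ _).trans ?_) (Real.exp_pos _).le
    exact mul_le_mul_of_nonneg_left (ContinuousLinearMap.le_of_opNorm_le _ (hM t ht) _)
      (norm_nonneg _)
  have hlim : Tendsto (fun t : ℝ => Real.exp (-t) * (‖h‖ * (M * ‖expLp ξ‖))) atTop (𝓝 0) := by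
    simpa using Real.tendsto_exp_neg_atTop_nhds_zero.mul_const (‖h‖ * (M * ‖expLp ξ‖))
  have hzero := ge_of_tendsto hlim ((eventually_ge_atTop 0).mono hbound)
  rw [← inner_conj_symm, norm_le_zero_iff.1 hzero, map_zero]

end Core

/-! ### Identification of `expNegL` and compatibility between the spaces -/

section Main

theorem isGeneratedByNeg_ouSemigroup (d : ℕ) :
    IsGeneratedByNeg (Real.pi / 2) (ouGraph d) (ouSemigroup d 2 1) := by
  have hT : IsHolomorphicSemigroup (Real.pi / 2) (ouSemigroup d 2 1) :=
    isHolomorphicSemigroup_ouSemigroup (by norm_num) toReal_two_mul_one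
  obtain ⟨M, hM⟩ := exists_norm_ouSemigroup_ofReal_le (p := 2) (τ := 1) d (by norm_num)
    toReal_two_mul_one
  exact ⟨hT, hT.generatorGraph_eq_closure hM (fun q hq => mem_generatorGraph_ouSemigroup
    (by norm_num) toReal_two_mul_one hq) (dense_image_add_ouTestGraph d)⟩

theorem isGeneratedByNeg_expNegL (d : ℕ) :
    IsGeneratedByNeg (Real.pi / 2) (ouGraph d) (expNegL d) :=
  Classical.epsilon_spec ⟨_, isGeneratedByNeg_ouSemigroup d⟩

theorem dense_fst_generatorGraph (d : ℕ) {p : ℝ≥0∞} [Fact (1 ≤ p)] (hp : p ≠ ⊤) {τ : ℝ}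
    (hτ : p.toReal * τ = 2) : Dense (Prod.fst '' generatorGraph (ouSemigroup d p τ)) := by
  refine (dense_testFunctions d hp (tau_pos hτ)).mono ?_
  rintro F ⟨f, hf, hfc, hF⟩
  obtain ⟨G, hG⟩ := exists_mem_ouTestGraph hf hfc (tau_pos hτ) hF
  have h := mem_generatorGraph_ouSemigroup hp hτ hG
  exact ⟨_, h, rfl⟩

/-- `expNegL` is a choice, known only through its generator; uniqueness of the semigroup gives it
the Mehler kernel. -/
theorem expNegL_eq {d : ℕ} {z : ℂ} (hz : 0 < z.re) : expNegL d z = ouSemigroup d 2 1 z := by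
  obtain ⟨hT, hTG⟩ := isGeneratedByNeg_ouSemigroup d
  obtain ⟨hS, hSG⟩ := isGeneratedByNeg_expNegL d
  obtain ⟨M, hM⟩ := exists_norm_ouSemigroup_ofReal_le (p := 2) (τ := 1) d (by norm_num)
    toReal_two_mul_one
  have hG : generatorGraph (ouSemigroup d 2 1) = generatorGraph (expNegL d) := by rw [hTG, hSG]
  have hd := dense_fst_generatorGraph d (p := 2) (by norm_num) toReal_two_mul_one
  exact (hT.eq_of_generatorGraph_eq hS hM hG hd hz).symm

/-- The kernel integral sees only the almost everywhere class of `f`, not the space it is taken in.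
The choice `q = 2` serves the map into `L²(γ)`, and `q = p` the extended semigroup. -/
theorem kernelOp_mehler_toLp_ae {d : ℕ} {p q : ℝ≥0∞} [Fact (1 ≤ p)] [Fact (1 ≤ q)] (hp : p ≠ ⊤)
    (hq : q ≠ ⊤) {τ σ : ℝ} (hτ : p.toReal * τ = 2) (hσ : q.toReal * σ = 2) {z : ℂ}
    (hz : 0 < z.re) {f : EuclideanSpace ℝ (Fin d) → ℂ} (hfp : MemLp f p (gaussian d τ))
    (hf2 : MemLp f 2 (gaussian d 1)) :
    kernelOp p q τ σ (mehler (Complex.exp (-z))) (hfp.toLp f) =ᵐ[volume]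
      expNegL d z (hf2.toLp f) := by
  have h1 : hfp.toLp f =ᵐ[volume] f := ae_gaussian (d := d) (tau_pos hτ) ▸ hfp.coeFn_toLp
  have h2 : hf2.toLp f =ᵐ[volume] f := ae_gaussian (d := d) one_pos ▸ hf2.coeFn_toLp
  refine (kernelOp_mehler_apply hp hq hτ hσ (norm_exp_neg_lt_one hz) _).trans ?_
  rw [expNegL_eq hz, kernelInt_congr _ h1, ← kernelInt_congr _ h2]
  exact (ouSemigroup_apply (by norm_num) toReal_two_mul_one hz _).symm

end Main

end OU

end

theorem mainTheorem6 (d : ℕ) :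
    -- `-L` generates the holomorphic semigroup `exp (-z L)` on `L²(γ)`
    OU.IsGeneratedByNeg (Real.pi / 2) (OU.ouGraph d) (OU.expNegL d) ∧
    ∀ (p : ℝ≥0∞) [Fact (1 ≤ p)], p ≤ 2 →
      -- `exp (-z L)` maps `L^p(γ_{2/p})` into `L²(γ)`
      (∀ z : ℂ, 0 < z.re →
        ∃ R : Lp ℂ p (OU.gaussian d (2 / p.toReal)) →L[ℂ] Lp ℂ 2 (OU.gaussian d 1),
          ∀ (f : EuclideanSpace ℝ (Fin d) → ℂ)
            (hp : MemLp f p (OU.gaussian d (2 / p.toReal))) (h2 : MemLp f 2 (OU.gaussian d 1)),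
            R (hp.toLp f) = OU.expNegL d z (h2.toLp f)) ∧
      -- the semigroup extends to `L^p(γ_{2/p})`
      ∃ T : ℂ → Lp ℂ p (OU.gaussian d (2 / p.toReal)) →L[ℂ]
          Lp ℂ p (OU.gaussian d (2 / p.toReal)),
        (∀ z : ℂ, 0 < z.re →
          ∀ (f : EuclideanSpace ℝ (Fin d) → ℂ)
            (hp : MemLp f p (OU.gaussian d (2 / p.toReal))) (h2 : MemLp f 2 (OU.gaussian d 1)),
            T z (hp.toLp f) =ᵐ[volume] OU.expNegL d z (h2.toLp f)) ∧
        OU.IsHolomorphicSemigroup (Real.pi / 2) T ∧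
        (∀ q ∈ OU.ouTestGraph d p (2 / p.toReal), (q.1, -q.2) ∈ OU.generatorGraph T) ∧
        ∀ θ : ℝ, 0 < θ → θ < Real.pi / 2 →
          ∃ C : ℝ, ∀ z ∈ OU.sector θ, ‖T z‖ ≤ C := by
  refine ⟨OU.isGeneratedByNeg_expNegL d, fun p _ hp2 => ?_⟩
  have hp : p ≠ ⊤ := ne_top_of_le_ne_top (by norm_num) hp2
  have hp0 : p ≠ 0 := (zero_lt_one.trans_le (Fact.out : 1 ≤ p)).ne'
  -- The relation between exponent and variance that makes the weight `exp (-|x|²/4)` common to all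
  -- the spaces.
  have hτ : p.toReal * (2 / p.toReal) = 2 :=
    mul_div_cancel₀ 2 (ENNReal.toReal_pos hp0 hp).ne'
  refine ⟨fun z hz => ⟨OU.kernelOp p 2 (2 / p.toReal) 1 (OU.mehler (Complex.exp (-z))),
      fun f hfp hf2 => OU.Lp_ext_volume one_pos (OU.kernelOp_mehler_toLp_ae hp (by norm_num) hτ
        OU.toReal_two_mul_one hz hfp hf2)⟩,
    OU.ouSemigroup d p (2 / p.toReal), fun z hz f hfp hf2 => ?_,
    OU.isHolomorphicSemigroup_ouSemigroup hp hτ,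
    fun q hq => OU.mem_generatorGraph_ouSemigroup hp hτ hq,
    fun θ hθ hθ2 => OU.exists_norm_ouSemigroup_le d hp hτ hθ hθ2⟩
  rw [OU.ouSemigroup_of_re_pos hz]
  exact OU.kernelOp_mehler_toLp_ae hp hp hτ hτ hz hfp hf2
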